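/- **Theorem (Semi-parametric efficiency).** *Population.* Each market participant has covariates $X\in\mathcal X$, a binary treatment $W\in\{0,1\}$ and potential submissions $B(1),B(0)\in\mathcal B$; the researcher observes $(B,W,X)$ with $B=B(W)$. A population is a law of $(X,B(1),B(0),W)$ satisfying unconfoundedness and overlap: given $X=x$, $(B(1),B(0))$ has some conditional law (a Markov kernel in $x$) and, independently of it, $W\sim\mathrm{Bernoulli}(e(x))$ with $0<e(x)<1$ for all $x$. *Mechanism.* There are $J$ items, bounded allocation and outcome functions $d(b,p)\in\mathbb R^J$ and $y(b,p)\in\mathbb R$ for $b\in\mathcal B$ and cutoffs $p\in\mathcal S\subset\mathbb R^J$, measurable in $b$, and capacities $s^*\in[0,1]^J$. For $w\in\{0,1\}$ put $z_w(p)=\mathbb E[d(B(w),p)]-s^*$, $y_w(p)=\mathbb E[y(B(w),p)]$, $\mu^d_w(x,p)=\mathbb E[d(B(w),p)\mid X=x]$ and $\mu^y_w(x,p)=\mathbb E[y(B(w),p)\mid X=x]$. Market-clearing cutoffs are $p^*_w\in\mathcal S$ with $z_w(p^*_w)=0$, and $\tau^*_{\mathrm{GTE}}=y_1(p_1^*)-y_0(p_0^*)$.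 *Assumptions on the true population.* 1. Strong overlap: for some $\kappa>0$, $\kappa\le e(X)\le 1-\kappa$ almost surely. 2. There is $L>0$ with $\mathbb E[(d_j(B(w),p)-d_j(B(w),p'))^2]\le L\|p-p'\|$ and $\mathbb E[(y(B(w),p)-y(B(w),p'))^2]\le L\|p-p'\|$ for all $w$, $j$ and $p,p'\in\mathcal S$. 3. For all $w$ and $x$, $\mu^d_w(x,\cdot)$ and $\mu^y_w(x,\cdot)$ are twice continuously differentiable on the interior of $\mathcal S$, with first and second derivatives bounded uniformly in $w$, $x$ and $p$. 4. For $w\in\{0,1\}$ the singular values of $\nabla_p z_w(p^*_w)$ lie in an interval $[c_3,c_4]$ with $c_3>0$. 5. $\mathcal S$ is compact; for $w\in\{0,1\}$ market-clearing cutoffs $p^*_w$ exist and are unique in $\mathcal S$, and $\mathcal S$ contains a ball of some radius $c_1>0$ around $p_w^*$. *Variance.* Let $\nu^*_w=\nabla_p^\top y_w(p^*_w)\,[\nabla_p z_w(p^*_w)]^{-1}$, let $$\Gamma^{y}_w=\mu^y_w(X,p^*_w)+\frac{\mathbf 1(W=w)}{P(W=w\mid X)}\bigl(y(B(w),p^*_w)-\mu^y_w(X,p^*_w)\bigr),\qquad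 \Gamma^{d}_w=\mu^d_w(X,p^*_w)+\frac{\mathbf 1(W=w)}{P(W=w\mid X)}\bigl(d(B(w),p^*_w)-\mu^d_w(X,p^*_w)\bigr),$$ $\Gamma^q_w=\Gamma^y_w-\nu^*_w(\Gamma^d_w-s^*)$, and $$\sigma^2=\mathbb E\bigl[(\Gamma^q_1-\Gamma^q_0-\tau^*_{\mathrm{GTE}})^2\bigr].$$ *Model and efficiency bound.* The model consists of all populations for which market-clearing cutoffs in $\mathcal S$ exist for $w=0$ and $w=1$; it is otherwise nonparametric. The functional $\tau_{\mathrm{GTE}}$ is defined on it through any fixed rule that selects market-clearing cutoffs (at the true population there is no choice). A regular parametric submodel is a path $t\mapsto F_t$ through the true population $F_0$, in the model for $t$ near $0$, whose laws of $(B,W,X)$ are, for $t$ near $0$, dominated by a common $\sigma$-finite measure and differentiable in quadratic mean at $t=0$ with square-integrable score $s$. The tangent space is the closed linear span in $L^2$ (of the true law of $(B,W,X)$) of all such scores. *Claim.* Then $\sigma^2$ is the semiparametric efficiency bound for $\tau^*_{\mathrm{GTE}}$. That is: there is a function $\psi(B,W,X)$ in the tangent space such that along every regular parametric submodel $t\mapsto\tau_{\mathrm{GTE}}(F_t)$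 is differentiable at $0$ with derivative $\mathbb E[\psi\, s]$, and $\mathbb E[\psi^2]=\sigma^2$; and $\sigma^2$ is the supremum, over all regular parametric submodels with $\mathbb E[s^2]>0$, of the Cramér–Rao bounds $\bigl(\tfrac{d}{dt}\tau_{\mathrm{GTE}}(F_t)|_{t=0}\bigr)^2/\mathbb E[s^2]$. This holds for every selection rule. -/

import Mathlib

open MeasureTheory ProbabilityTheory Filter Topology

noncomputable section

/-! ## Semiparametric efficiency in a general statistical model

A model is a set `𝓜` of parameters `θ : Θ`; under `θ` one observes a draw from the law
`obs θ` on `Z`. The estimand is a real functional `τ` of the parameter. -/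

namespace Semiparametric

variable {Θ Z : Type*} [MeasurableSpace Z]

/-- `path` is a regular one-dimensional parametric submodel of `𝓜` through `θ₀` with score `s`:
it passes through `θ₀` at `t = 0`, it stays in the model for `t` near `0`, its observed laws have
densities `q t` with respect to a common σ-finite measure `ν`, and the root densities are
differentiable in quadratic mean at `t = 0`, with a score `s` that is square integrable. -/
structure IsRegularSubmodel (obs : Θ → Measure Z) (𝓜 : Set Θ) (θ₀ : Θ)
    (path : ℝ → Θ) (s : Z → ℝ) : Prop where
  base : path 0 = θ₀
  mem : ∀ᶠ t in 𝓝 (0 : ℝ), path t ∈ 𝓜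
  memLp : MemLp s 2 (obs θ₀)
  qmd : ∃ (ν : Measure Z) (q : ℝ → Z → ℝ), SigmaFinite ν ∧
    (∀ t, Measurable (q t)) ∧ (∀ t z, 0 ≤ q t z) ∧
    (∀ᶠ t in 𝓝 (0 : ℝ), obs (path t) = ν.withDensity (fun z => ENNReal.ofReal (q t z))) ∧
    Tendsto
      (fun t : ℝ => ∫⁻ z, ENNReal.ofReal
        (((√(q t z) - √(q 0 z)) / t - s z / 2 * √(q 0 z)) ^ 2) ∂ν)
      (𝓝[≠] 0) (𝓝 0)

/-- The tangent space at `θ₀`: the closed linear span in `L²(obs θ₀)` of the scores of all regular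
parametric submodels through `θ₀`. -/
def tangentSpace (obs : Θ → Measure Z) (𝓜 : Set Θ) (θ₀ : Θ) :
    Submodule ℝ (Lp ℝ 2 (obs θ₀)) :=
  (Submodule.span ℝ
    {g : Lp ℝ 2 (obs θ₀) | ∃ path, IsRegularSubmodel obs 𝓜 θ₀ path g}).topologicalClosure

/-- `ψ` is the efficient influence function of `τ` at `θ₀`: `τ` is differentiable at `θ₀` along
every regular parametric submodel, with derivative the inner product of `ψ` with the score,
and `ψ` lies in the tangent space. -/
structure IsEfficientInfluenceFunction (obs : Θ → Measure Z) (𝓜 : Set Θ) (τ : Θ → ℝ) (θ₀ : Θ)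
    (ψ : Lp ℝ 2 (obs θ₀)) : Prop where
  mem_tangentSpace : ψ ∈ tangentSpace obs 𝓜 θ₀
  hasDerivAt : ∀ (path : ℝ → Θ) (s : Z → ℝ), IsRegularSubmodel obs 𝓜 θ₀ path s →
    HasDerivAt (fun t => τ (path t)) (∫ z, ψ z * s z ∂(obs θ₀)) 0

/-- The Cramér–Rao bounds `τ'(0)² / I(0)` for estimating `τ`, over all regular parametric
submodels through `θ₀` with positive Fisher information `I(0) = E[s²]`. -/
def cramerRaoBounds (obs : Θ → Measure Z) (𝓜 : Set Θ) (τ : Θ → ℝ) (θ₀ : Θ) : Set ℝ :=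
  {v | ∃ (path : ℝ → Θ) (s : Z → ℝ) (τ' : ℝ), IsRegularSubmodel obs 𝓜 θ₀ path s ∧
    HasDerivAt (fun t => τ (path t)) τ' 0 ∧
    0 < ∫ z, s z ^ 2 ∂(obs θ₀) ∧ v = τ' ^ 2 / ∫ z, s z ^ 2 ∂(obs θ₀)}

/-- `V` is the semiparametric efficiency bound for `τ` at `θ₀`: `τ` is pathwise differentiable,
its efficient influence function has variance `V`, and `V` is the supremum of the Cramér–Rao
bounds of the regular parametric submodels. -/
def IsEfficiencyBound (obs : Θ → Measure Z) (𝓜 : Set Θ) (τ : Θ → ℝ) (θ₀ : Θ) (V : ℝ) : Prop :=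
  (∃ ψ : Lp ℝ 2 (obs θ₀), IsEfficientInfluenceFunction obs 𝓜 τ θ₀ ψ ∧
    ∫ z, (ψ z) ^ 2 ∂(obs θ₀) = V) ∧
  IsLUB (cramerRaoBounds obs 𝓜 τ θ₀) V

end Semiparametric

/-! ## Populations of market participants -/

/-- A population law for `(X, B(0), B(1), W)` under unconfoundedness and overlap, given through
its factorization: `X` has law `cov`; given `X = x`, the potential submissions
`(B(w))_{w : Bool}` have law `bid x` (arbitrarily dependent on each other), and, independently of
them, `W = true` (treated) with probability `prop x ∈ (0, 1)`. -/
structure Population (𝓑 𝓧 : Type*) [MeasurableSpace 𝓑] [MeasurableSpace 𝓧] where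
  cov : Measure 𝓧
  bid : Kernel 𝓧 (Bool → 𝓑)
  prop : 𝓧 → ℝ
  isProbabilityMeasure_cov : IsProbabilityMeasure cov
  isMarkovKernel_bid : IsMarkovKernel bid
  measurable_prop : Measurable prop
  prop_pos : ∀ x, 0 < prop x
  prop_lt_one : ∀ x, prop x < 1

namespace Population

variable {𝓑 𝓧 : Type*} [MeasurableSpace 𝓑] [MeasurableSpace 𝓧]

/-- `P(W = w | X = x)`. -/
def armProb (F : Population 𝓑 𝓧) (w : Bool) (x : 𝓧) : ℝ :=
  if w then F.prop x else 1 - F.prop x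

/-- The conditional law of the treatment `W` given `X = x`. -/
def treatment (F : Population 𝓑 𝓧) : Kernel 𝓧 Bool where
  toFun x := ENNReal.ofReal (F.prop x) • Measure.dirac true +
    ENNReal.ofReal (1 - F.prop x) • Measure.dirac false
  measurable' := by
    refine Measure.measurable_of_measurable_coe _ fun s hs => ?_
    simp only [Measure.coe_add, Measure.coe_smul, Pi.add_apply, Pi.smul_apply, smul_eq_mul]
    exact (F.measurable_prop.ennreal_ofReal.mul_const _).add
      ((measurable_const.sub F.measurable_prop).ennreal_ofReal.mul_const _)

/-- The joint law of `(X, ((B(w))_w, W))`. -/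
def fullLaw (F : Population 𝓑 𝓧) : Measure (𝓧 × (Bool → 𝓑) × Bool) :=
  F.cov.compProd (F.bid.prod F.treatment)

/-- What the researcher sees of one participant: `(B, W, X)` with `B = B(W)`. -/
def observe (ω : 𝓧 × (Bool → 𝓑) × Bool) : 𝓑 × Bool × 𝓧 :=
  (ω.2.1 ω.2.2, ω.2.2, ω.1)

theorem measurable_observe : Measurable (observe (𝓑 := 𝓑) (𝓧 := 𝓧)) := by
  have h : Measurable fun q : (Bool → 𝓑) × Bool => q.1 q.2 :=
    measurable_from_prod_countable_left fun w => measurable_pi_apply w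
  exact (h.comp measurable_snd).prodMk (measurable_snd.snd.prodMk measurable_fst)

/-- The law of the observed data `(B, W, X)`. -/
def obsLaw (F : Population 𝓑 𝓧) : Measure (𝓑 × Bool × 𝓧) :=
  F.fullLaw.map observe

/-- The law of the potential submission `B(w)`. -/
def potLaw (F : Population 𝓑 𝓧) (w : Bool) : Measure 𝓑 :=
  (F.cov.bind F.bid).map fun b => b w

end Population

/-! ## Cutoff mechanisms in the continuum market -/

/-- A cutoff mechanism for `J` items: the allocation `d(b, p)` and the outcome `y(b, p)` of a
participant with submission `b` at cutoffs `p`, the set `S` of admissible cutoffs, and the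
fractional capacities `s*`. -/
structure CutoffMechanism (𝓑 : Type*) [MeasurableSpace 𝓑] (J : ℕ) where
  alloc : 𝓑 → EuclideanSpace ℝ (Fin J) → EuclideanSpace ℝ (Fin J)
  outcome : 𝓑 → EuclideanSpace ℝ (Fin J) → ℝ
  cutoffs : Set (EuclideanSpace ℝ (Fin J))
  capacity : EuclideanSpace ℝ (Fin J)
  measurable_alloc : ∀ p, Measurable fun b => alloc b p
  measurable_outcome : ∀ p, Measurable fun b => outcome b p

namespace CutoffMechanism

variable {𝓑 𝓧 : Type*} [MeasurableSpace 𝓑] [MeasurableSpace 𝓧] {J : ℕ}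

/-- Expected excess demand when everyone has treatment `w`: `z_w(p) = E[d(B(w), p)] - s*`. -/
def excess (M : CutoffMechanism 𝓑 J) (F : Population 𝓑 𝓧) (w : Bool)
    (p : EuclideanSpace ℝ (Fin J)) : EuclideanSpace ℝ (Fin J) :=
  (∫ b, M.alloc b p ∂(F.potLaw w)) - M.capacity

/-- Expected outcome when everyone has treatment `w`: `y_w(p) = E[y(B(w), p)]`. -/
def meanOutcome (M : CutoffMechanism 𝓑 J) (F : Population 𝓑 𝓧) (w : Bool)
    (p : EuclideanSpace ℝ (Fin J)) : ℝ :=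
  ∫ b, M.outcome b p ∂(F.potLaw w)

/-- `μ^d_w(x, p) = E[d(B(w), p) | X = x]`. -/
def condAlloc (M : CutoffMechanism 𝓑 J) (F : Population 𝓑 𝓧) (w : Bool) (x : 𝓧)
    (p : EuclideanSpace ℝ (Fin J)) : EuclideanSpace ℝ (Fin J) :=
  ∫ b, M.alloc (b w) p ∂(F.bid x)

/-- `μ^y_w(x, p) = E[y(B(w), p) | X = x]`. -/
def condOutcome (M : CutoffMechanism 𝓑 J) (F : Population 𝓑 𝓧) (w : Bool) (x : 𝓧)
    (p : EuclideanSpace ℝ (Fin J)) : ℝ :=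
  ∫ b, M.outcome (b w) p ∂(F.bid x)

/-- The cutoffs `p ∈ S` clear the continuum market in which everyone has treatment `w`. -/
def Clears (M : CutoffMechanism 𝓑 J) (F : Population 𝓑 𝓧) (w : Bool)
    (p : EuclideanSpace ℝ (Fin J)) : Prop :=
  p ∈ M.cutoffs ∧ M.excess F w p = 0

/-- The semiparametric model: the populations for which market-clearing cutoffs exist, both when
everyone is treated and when nobody is. The law of the data is otherwise unrestricted. -/
def model (M : CutoffMechanism 𝓑 J) (𝓧 : Type*) [MeasurableSpace 𝓧] : Set (Population 𝓑 𝓧) :=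
  {F | ∀ w, ∃ p, M.Clears F w p}

/-- `cut` assigns to every population in which market-clearing cutoffs exist such cutoffs. Where
they are unique there is no choice; elsewhere the selection is arbitrary. -/
def IsCutoffRule (M : CutoffMechanism 𝓑 J)
    (cut : Population 𝓑 𝓧 → Bool → EuclideanSpace ℝ (Fin J)) : Prop :=
  ∀ F w, (∃ p, M.Clears F w p) → M.Clears F w (cut F w)

/-- The continuum-market global treatment effect at cutoffs `p`:
`E[y(B(1), p 1)] - E[y(B(0), p 0)]`. -/
def globalEffect (M : CutoffMechanism 𝓑 J) (F : Population 𝓑 𝓧)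
    (p : Bool → EuclideanSpace ℝ (Fin J)) : ℝ :=
  M.meanOutcome F true (p true) - M.meanOutcome F false (p false)

/-- `ν_w = ∇ᵀ y_w(p) [∇ z_w(p)]⁻¹`, as a linear functional on `ℝ^J`. -/
def nu (M : CutoffMechanism 𝓑 J) (F : Population 𝓑 𝓧) (w : Bool)
    (p : EuclideanSpace ℝ (Fin J)) : EuclideanSpace ℝ (Fin J) →L[ℝ] ℝ :=
  (fderiv ℝ (M.meanOutcome F w) p).comp (fderiv ℝ (M.excess F w) p).inverse

/-- `1(W = w) / P(W = w | X)`. -/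
def ipw (F : Population 𝓑 𝓧) (w : Bool) (ω : 𝓧 × (Bool → 𝓑) × Bool) : ℝ :=
  if ω.2.2 = w then (F.armProb w ω.1)⁻¹ else 0

/-- The doubly robust score for outcomes,
`Γ^y_w(p) = μ^y_w(X, p) + 1(W = w) / P(W = w | X) * (y(B(w), p) - μ^y_w(X, p))`. -/
def scoreOutcome (M : CutoffMechanism 𝓑 J) (F : Population 𝓑 𝓧) (w : Bool)
    (p : EuclideanSpace ℝ (Fin J)) (ω : 𝓧 × (Bool → 𝓑) × Bool) : ℝ :=
  M.condOutcome F w ω.1 p +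
    ipw F w ω * (M.outcome (ω.2.1 w) p - M.condOutcome F w ω.1 p)

/-- The doubly robust score for allocations,
`Γ^d_w(p) = μ^d_w(X, p) + 1(W = w) / P(W = w | X) * (d(B(w), p) - μ^d_w(X, p))`. -/
def scoreAlloc (M : CutoffMechanism 𝓑 J) (F : Population 𝓑 𝓧) (w : Bool)
    (p : EuclideanSpace ℝ (Fin J)) (ω : 𝓧 × (Bool → 𝓑) × Bool) : EuclideanSpace ℝ (Fin J) :=
  M.condAlloc F w ω.1 p +
    ipw F w ω • (M.alloc (ω.2.1 w) p - M.condAlloc F w ω.1 p)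

/-- `Γ^q_w(p) = Γ^y_w(p) - ν_w (Γ^d_w(p) - s*)`. -/
def scoreQ (M : CutoffMechanism 𝓑 J) (F : Population 𝓑 𝓧) (w : Bool)
    (p : EuclideanSpace ℝ (Fin J)) (ω : 𝓧 × (Bool → 𝓑) × Bool) : ℝ :=
  M.scoreOutcome F w p ω - M.nu F w p (M.scoreAlloc F w p ω - M.capacity)

/-- `σ² = E[(Γ^q_1(p 1) - Γ^q_0(p 0) - τ)²]`. -/
def asymptoticVariance (M : CutoffMechanism 𝓑 J) (F : Population 𝓑 𝓧)
    (p : Bool → EuclideanSpace ℝ (Fin J)) : ℝ :=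
  ∫ ω, (M.scoreQ F true (p true) ω - M.scoreQ F false (p false) ω - M.globalEffect F p) ^ 2
    ∂F.fullLaw

/-- The assumptions on the mechanism and on the true population `F`, whose market-clearing cutoffs
are `pstar w` when everyone has treatment `w`. -/
structure Assumptions (M : CutoffMechanism 𝓑 J) (F : Population 𝓑 𝓧)
    (pstar : Bool → EuclideanSpace ℝ (Fin J)) : Prop where
  capacity_mem : ∀ j, M.capacity j ∈ Set.Icc (0 : ℝ) 1
  strong_overlap : ∃ κ : ℝ, 0 < κ ∧ ∀ᵐ x ∂F.cov, κ ≤ F.prop x ∧ F.prop x ≤ 1 - κ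
  alloc_bounded : ∃ K : ℝ, ∀ b, ∀ p ∈ M.cutoffs, ‖M.alloc b p‖ ≤ K
  outcome_bounded : ∃ K : ℝ, ∀ b, ∀ p ∈ M.cutoffs, |M.outcome b p| ≤ K
  weak_continuity : ∃ L : ℝ, 0 < L ∧ ∀ w, ∀ p ∈ M.cutoffs, ∀ p' ∈ M.cutoffs,
    (∀ j, ∫ b, (M.alloc b p j - M.alloc b p' j) ^ 2 ∂(F.potLaw w) ≤ L * ‖p - p'‖) ∧
    ∫ b, (M.outcome b p - M.outcome b p') ^ 2 ∂(F.potLaw w) ≤ L * ‖p - p'‖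
  smooth : ∃ c' : ℝ, ∀ w x,
    ContDiffOn ℝ 2 (M.condAlloc F w x) (interior M.cutoffs) ∧
    ContDiffOn ℝ 2 (M.condOutcome F w x) (interior M.cutoffs) ∧
    ∀ k : ℕ, 1 ≤ k → k ≤ 2 → ∀ p ∈ interior M.cutoffs,
      ‖iteratedFDeriv ℝ k (M.condAlloc F w x) p‖ ≤ c' ∧
      ‖iteratedFDeriv ℝ k (M.condOutcome F w x) p‖ ≤ c'
  /-- The singular values of the Jacobian of excess demand lie in `[c₃, c₄]`. -/
  jacobian : ∃ c₃ c₄ : ℝ, 0 < c₃ ∧ ∀ w v,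
    c₃ * ‖v‖ ≤ ‖fderiv ℝ (M.excess F w) (pstar w) v‖ ∧
    ‖fderiv ℝ (M.excess F w) (pstar w) v‖ ≤ c₄ * ‖v‖
  compact_cutoffs : IsCompact M.cutoffs
  interior_equilibrium : ∃ c₁ : ℝ, 0 < c₁ ∧ ∀ w, Metric.ball (pstar w) c₁ ⊆ M.cutoffs
  clears : ∀ w, M.Clears F w (pstar w)
  /-- Uniqueness; as `S` is compact and `z_w` continuous on it, this makes `pstar w`
  well-separated. -/
  unique_equilibrium : ∀ w p, M.Clears F w p → p = pstar w

end CutoffMechanism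

end

/-! The efficient influence function is ψ = Γ^q_1 - Γ^q_0 - τ, written as a function of the observed
data (`influence`). Three facts suffice: τ has derivative E[ψ s] along every regular submodel, ψ is
itself the score of a regular submodel, and Cauchy-Schwarz holds.

Derivative. Along a submodel, quadratic-mean differentiability gives E_t[g] = E_0[g] + t E_0[g s] +
o(t), uniformly over |g| ≤ 1 (`IsRegularSubmodel.expansion`). Potential-outcome means are not linear
in the observed law, so they are replaced by the mean of a doubly robust score that keeps the true
regression and propensity. Its bias is a product of two nuisance errors, each of squared size O(t²)
because the squared Hellinger distance is (`abs_integral_potLaw_sub_doublyRobust_le`). This yields a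
uniform expansion of E_t[h(B(w))] (`potLaw_expansion`).

Cutoffs. The clearing cutoffs p_t satisfy z_t(p_t) = 0, hence z_0(p_t) = O(t). Compactness and
uniqueness give p_t → p*, and the invertible Jacobian gives p_t - p* = O(t) (`cut_lipschitz`).
Because z_t(p_t) = 0, the mean outcome at p_t equals the mean of the outcome net of ν times excess
demand. Under the true population this net mean has zero gradient at p*, so the movement of p_t
contributes o(t) and only the score of the net outcome survives (`hasDerivAt_meanOutcome`). No
smoothness of y_t or z_t at t ≠ 0 is needed.

Attainment. ψ is bounded and splits into a centred function of X and, in each arm, a function of B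
centred given X. Tilting the law of X and the law of each B(w) by these functions gives a path with
score ψ (`exists_tilt`). It must stay in the model, that is, perturbed markets must still clear.
Their excess demand is known to be continuous and uniformly close to the true one, and Brouwer's
theorem supplies a zero (`exists_clears_of_close`). The Cramér-Rao bound along this path is σ² if σ²
> 0; if σ² = 0, any submodel with positive information shows that 0 is the supremum, and varying the
propensity alone provides one. -/

/-! ## Brouwer's fixed point theorem -/

namespace Brouwer

variable {E : Type*} [NormedAddCommGroup E] [InnerProductSpace ℝ E] [FiniteDimensional ℝ E]

/-- `t ↦ det (1 + t A)` is a polynomial of degree at most `dim E`, so that its value at `1` is a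
fixed affine combination of its values at points of `(0, δ)`. -/
theorem exists_det_interpolation (E : Type*) [NormedAddCommGroup E] [InnerProductSpace ℝ E]
    [FiniteDimensional ℝ E] {δ : ℝ} (hδ : 0 < δ) :
    ∃ (s : Finset ℝ) (c : ℝ → ℝ), (∀ t ∈ s, 0 < t ∧ t < δ) ∧ ∑ t ∈ s, c t = 1 ∧
      ∀ A : E →L[ℝ] E, (ContinuousLinearMap.id ℝ E + A).det =
        ∑ t ∈ s, c t * (ContinuousLinearMap.id ℝ E + t • A).det := by
  classical
  set n := Module.finrank ℝ E with hn
  -- The nodes are δ/2, δ/3, ...; starting the denominators at 2 keeps them strictly below δ. Since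
  -- det(1 + tA) has degree at most n in t, n + 1 nodes determine it.
  have hinj : Function.Injective fun i : ℕ => δ / (i + 2 : ℝ) := by
    intro i j hij
    have hi : (i + 2 : ℝ) ≠ 0 := by positivity
    have hj : (j + 2 : ℝ) ≠ 0 := by positivity
    simp only at hij
    rw [div_eq_div_iff hi hj] at hij
    have := mul_left_cancel₀ hδ.ne' hij
    exact_mod_cast (by linarith : (i : ℝ) = j)
  set s : Finset ℝ := (Finset.range (n + 1)).image fun i : ℕ => δ / (i + 2 : ℝ) with hs
  have hcard : s.card = n + 1 := by
    rw [hs, Finset.card_image_of_injective _ hinj, Finset.card_range]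
  have hne : s.Nonempty := by rw [← Finset.card_pos, hcard]; omega
  refine ⟨s, fun t => (Lagrange.basis s id t).eval 1, ?_, ?_, ?_⟩
  · intro t ht
    obtain ⟨i, -, rfl⟩ := Finset.mem_image.1 ht
    refine ⟨by positivity, ?_⟩
    rw [div_lt_iff₀ (by positivity)]
    nlinarith [(Nat.cast_nonneg i : (0 : ℝ) ≤ i)]
  · rw [← Polynomial.eval_finsetSum, Lagrange.sum_basis (Set.injOn_id _) hne, Polynomial.eval_one]
  · intro A
    set b := Module.finBasis ℝ E
    set a : Matrix (Fin n) (Fin n) ℝ := LinearMap.toMatrix b b (A : E →ₗ[ℝ] E) with ha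
    set p : Polynomial ℝ :=
      ((Polynomial.X : Polynomial ℝ) • a.map Polynomial.C +
        (1 : Matrix (Fin n) (Fin n) ℝ).map Polynomial.C).det with hp
    have heval : ∀ t : ℝ, (ContinuousLinearMap.id ℝ E + t • A).det = p.eval t := by
      intro t
      rw [hp, ← Polynomial.coe_evalRingHom, RingHom.map_det]
      change LinearMap.det ((ContinuousLinearMap.id ℝ E + t • A : E →L[ℝ] E) : E →ₗ[ℝ] E) = _
      rw [← LinearMap.det_toMatrix b]
      congr 1
      ext i j
      simp [ha, LinearMap.toMatrix_apply, Matrix.one_apply, apply_ite, add_comm,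
        Finsupp.single_apply, eq_comm]
      exact mul_comm _ _
    have hdeg : p.degree < s.card := by
      rw [hcard]
      refine lt_of_le_of_lt Polynomial.degree_le_natDegree ?_
      have := Polynomial.natDegree_det_X_add_C_le a 1
      rw [Fintype.card_fin] at this
      exact_mod_cast Nat.lt_succ_of_le this
    have h1 := heval 1
    rw [one_smul] at h1
    rw [h1, Lagrange.eq_interpolate (v := id) (Set.injOn_id _) hdeg, Lagrange.interpolate_apply,
      Polynomial.eval_finsetSum]
    refine Finset.sum_congr rfl fun t _ => ?_
    rw [Polynomial.eval_mul, Polynomial.eval_C, heval t, mul_comm]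
    simp only [id]

omit [FiniteDimensional ℝ E] in
theorem injective_id_add {A : E →L[ℝ] E} (hA : ‖A‖ < 1) :
    Function.Injective (ContinuousLinearMap.id ℝ E + A) := by
  rw [injective_iff_map_eq_zero]
  intro v hv
  by_contra h
  have h1 : v = -A v := eq_neg_of_add_eq_zero_left (by simpa using hv)
  have h2 : ‖v‖ ≤ ‖A‖ * ‖v‖ := by
    calc ‖v‖ = ‖A v‖ := by rw [h1, norm_neg, ← h1]
      _ ≤ _ := A.le_opNorm v
  have := norm_pos_iff.2 h
  nlinarith

theorem det_ne_zero_of_norm_lt_one {A : E →L[ℝ] E} (hA : ‖A‖ < 1) :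
    (ContinuousLinearMap.id ℝ E + A).det ≠ 0 := by
  intro h
  have := LinearMap.bot_lt_ker_of_det_eq_zero (f := ((ContinuousLinearMap.id ℝ E + A :
    E →L[ℝ] E) : E →ₗ[ℝ] E)) h
  rw [LinearMap.ker_eq_bot.2 (injective_id_add hA)] at this
  exact lt_irrefl _ this

/-- The determinant of id + tA is 1 at t = 0 and cannot vanish for t in [0, 1], so it keeps its
sign. -/
theorem det_pos_of_norm_lt_one {A : E →L[ℝ] E} (hA : ‖A‖ < 1) :
    0 < (ContinuousLinearMap.id ℝ E + A).det := by
  by_contra hcon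
  have hcont : Continuous fun t : ℝ => (ContinuousLinearMap.id ℝ E + t • A).det :=
    ContinuousLinearMap.continuous_det.comp (by fun_prop)
  have hmem : (0 : ℝ) ∈ Set.Icc ((ContinuousLinearMap.id ℝ E + (1 : ℝ) • A).det)
      ((ContinuousLinearMap.id ℝ E + (0 : ℝ) • A).det) := by
    constructor
    · simpa using hcon
    · simp [ContinuousLinearMap.det]
  obtain ⟨t, ht, h0⟩ := intermediate_value_Icc' zero_le_one hcont.continuousOn hmem
  refine det_ne_zero_of_norm_lt_one (A := t • A) ?_ h0
  rw [norm_smul, Real.norm_of_nonneg ht.1]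
  nlinarith [ht.1, ht.2, norm_nonneg A]

/-- There is no continuously differentiable retraction of the unit ball onto the sphere. -/
theorem no_retraction {r : E → E} {U : Set E} (hU : IsOpen U)
    (hBU : Metric.closedBall (0 : E) 1 ⊆ U) (hr : ContDiffOn ℝ 1 r U)
    (hnorm : ∀ x ∈ U, ‖r x‖ = 1) (hid : ∀ x : E, ‖x‖ = 1 → r x = x) : False := by
  let _ : MeasurableSpace E := borel E
  have : BorelSpace E := ⟨rfl⟩
  have hrd : ∀ x ∈ U, HasStrictFDerivAt r (fderiv ℝ r x) x := fun x hx =>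
    (hr.contDiffAt (hU.mem_nhds hx)).hasStrictFDerivAt one_ne_zero
  set D : E → E →L[ℝ] E := fun x => fderiv ℝ r x - ContinuousLinearMap.id ℝ E with hD
  have hDc : ContinuousOn D U := (hr.continuousOn_fderiv_of_isOpen hU le_rfl).sub continuousOn_const
  have hcomp : IsCompact (Metric.closedBall (0 : E) 1) := isCompact_closedBall 0 1
  obtain ⟨K, hK⟩ := hcomp.exists_bound_of_continuousOn (hDc.mono hBU)
  have hK0 : 0 ≤ K := (norm_nonneg _).trans (hK 0 (by simp))
  set g : E → E := fun x => r x - x with hg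
  have hgd : ∀ x ∈ U, HasStrictFDerivAt g (D x) x := fun x hx =>
    (hrd x hx).sub (hasStrictFDerivAt_id x)
  have hlip : ∀ x ∈ Metric.closedBall (0 : E) 1, ∀ y ∈ Metric.closedBall (0 : E) 1,
      ‖g y - g x‖ ≤ K * ‖y - x‖ := fun x hx y hy =>
    (convex_closedBall (0 : E) 1).norm_image_sub_le_of_norm_hasFDerivWithin_le
      (fun z hz => (hgd z (hBU hz)).hasFDerivAt.hasFDerivWithinAt) hK hx hy
  -- Below 1 / (K + 1) one has both t K < 1, for injectivity and positive Jacobian, and t < 1, so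
  -- that x + t (r x - x) is a convex combination of x and r x.
  have hδ : 0 < 1 / (K + 1) := by positivity
  obtain ⟨s, c, hs, hc, hdet⟩ := exists_det_interpolation E hδ
  set B := Metric.ball (0 : E) 1 with hB
  have hBc : B ⊆ Metric.closedBall (0 : E) 1 := Metric.ball_subset_closedBall
  have hsmall : ∀ t ∈ s, t * K < 1 ∧ t < 1 := by
    intro t ht
    obtain ⟨h0, h1⟩ := hs t ht
    rw [lt_div_iff₀ (by positivity)] at h1
    constructor <;> nlinarith
  have hnormlt : ∀ t ∈ s, ∀ x ∈ Metric.closedBall (0 : E) 1, ‖t • D x‖ < 1 := by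
    intro t ht x hx
    rw [norm_smul, Real.norm_of_nonneg (hs t ht).1.le]
    exact lt_of_le_of_lt (mul_le_mul_of_nonneg_left (hK x hx) (hs t ht).1.le) (hsmall t ht).1
  -- The Milnor-Rogers argument: for small t the map x + t (r x - x) is a bijection of the open ball
  -- with positive Jacobian, so its Jacobian integrates to the volume of the ball.
  have hvol : ∀ t ∈ s, ∫ x in B, (ContinuousLinearMap.id ℝ E + t • D x).det = volume.real B := by
    intro t ht
    obtain ⟨ht0, -⟩ := hs t ht
    obtain ⟨htK, ht1⟩ := hsmall t ht
    set f : E → E := fun x => x + t • g x with hf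
    have hfd : ∀ x ∈ U, HasStrictFDerivAt f (ContinuousLinearMap.id ℝ E + t • D x) x :=
      fun x hx => (hasStrictFDerivAt_id x).add ((hgd x hx).const_smul t)
    have hinj : Set.InjOn f (Metric.closedBall (0 : E) 1) := by
      intro x hx y hy hxy
      by_contra hne
      have h1 : x - y = t • (g y - g x) := by
        have : x + t • g x = y + t • g y := hxy
        rw [smul_sub, sub_eq_sub_iff_add_eq_add, this, add_comm]
      have h2 : ‖x - y‖ ≤ t * (K * ‖x - y‖) := by
        calc ‖x - y‖ = t * ‖g y - g x‖ := by rw [h1, norm_smul, Real.norm_of_nonneg ht0.le]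
          _ ≤ t * (K * ‖y - x‖) := mul_le_mul_of_nonneg_left (hlip x hx y hy) ht0.le
          _ = _ := by rw [norm_sub_rev]
      have := norm_pos_iff.2 (sub_ne_zero.2 hne)
      nlinarith
    have hfB : ∀ x ∈ B, f x ∈ B := by
      intro x hx
      have hx' : ‖x‖ < 1 := by simpa [hB] using hx
      have : f x = (1 - t) • x + t • r x := by
        simp only [hf, hg, smul_sub, sub_smul, one_smul]; abel
      rw [hB, mem_ball_zero_iff, this]
      calc ‖(1 - t) • x + t • r x‖ ≤ (1 - t) * ‖x‖ + t * 1 := by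
            refine (norm_add_le _ _).trans ?_
            rw [norm_smul, norm_smul, hnorm x (hBU (hBc hx)), Real.norm_of_nonneg ht0.le,
              Real.norm_of_nonneg (by linarith)]
        _ < 1 := by nlinarith
    have hopen : IsOpen (f '' B) := by
      rw [isOpen_iff_mem_nhds]
      rintro _ ⟨x, hx, rfl⟩
      have hsurj : LinearMap.range
          ((ContinuousLinearMap.id ℝ E + t • D x : E →L[ℝ] E) : E →ₗ[ℝ] E) = ⊤ :=
        LinearMap.range_eq_top.2 (LinearMap.injective_iff_surjective.1
          (injective_id_add (hnormlt t ht x (hBc hx))))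
      rw [← (hfd x (hBU (hBc hx))).map_nhds_eq_of_surj hsurj]
      exact image_mem_map (Metric.isOpen_ball.mem_nhds hx)
    -- Surjectivity by connectedness. The image f(B) is open, and the complement of the compact set
    -- f(closed ball) is open and disjoint from it. They cover B because f fixes the sphere, so a
    -- point of B hit by f is hit from the open ball.
    have himage : f '' B = B := by
      refine Set.Subset.antisymm (Set.image_subset_iff.2 hfB) ?_
      have hclosed : IsClosed (f '' Metric.closedBall (0 : E) 1) :=
        (hcomp.image_of_continuousOn fun x hx =>
          (hfd x (hBU hx)).continuousAt.continuousWithinAt).isClosed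
      have hcov : B ⊆ f '' B ∪ (f '' Metric.closedBall (0 : E) 1)ᶜ := by
        intro y hy
        by_cases h : y ∈ f '' Metric.closedBall (0 : E) 1
        · left
          obtain ⟨x, hx, rfl⟩ := h
          rcases (mem_closedBall_zero_iff.1 hx).lt_or_eq with h1 | h1
          · exact ⟨x, mem_ball_zero_iff.2 h1, rfl⟩
          · exfalso
            have : f x = x := by simp [hf, hg, hid x h1]
            rw [this, hB, mem_ball_zero_iff] at hy
            exact hy.ne h1
        · exact Or.inr h
      refine (convex_ball (0 : E) 1).isPreconnected.subset_left_of_subset_union hopen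
        hclosed.isOpen_compl ?_ hcov ?_
      · rw [Set.disjoint_compl_right_iff_subset]
        exact Set.image_mono hBc
      · exact ⟨f 0, hfB 0 (by simp [hB]), 0, by simp [hB], rfl⟩
    have := integral_image_eq_integral_abs_det_fderiv_smul (volume : Measure E)
      (measurableSet_ball (x := (0 : E)) (ε := 1))
      (fun x hx => (hfd x (hBU (hBc hx))).hasFDerivAt.hasFDerivWithinAt) (hinj.mono hBc)
      (fun _ => (1 : ℝ))
    rw [← hB, himage] at this
    simp only [smul_eq_mul, mul_one, integral_const, measureReal_restrict_apply_univ] at this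
    rw [this]
    refine setIntegral_congr_fun measurableSet_ball fun x hx => ?_
    exact (abs_of_pos (det_pos_of_norm_lt_one (hnormlt t ht x (hBc hx)))).symm
  have hint : ∀ t : ℝ, IntegrableOn (fun x => (ContinuousLinearMap.id ℝ E + t • D x).det) B := by
    intro t
    refine (ContinuousOn.integrableOn_compact hcomp ?_).mono_set hBc
    exact ContinuousLinearMap.continuous_det.comp_continuousOn
      (continuousOn_const.add ((hDc.mono hBU).const_smul t))
  -- The integral is a polynomial in t, so interpolation carries its value from small t to t = 1,
  -- where the map is r itself.
  have hone : ∫ x in B, (ContinuousLinearMap.id ℝ E + D x).det = volume.real B := by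
    rw [show (fun x => (ContinuousLinearMap.id ℝ E + D x).det) = fun x =>
      ∑ t ∈ s, c t * (ContinuousLinearMap.id ℝ E + t • D x).det from funext fun x => hdet (D x)]
    rw [integral_finsetSum _ fun t _ => (hint t).const_mul _]
    simp_rw [integral_const_mul]
    rw [Finset.sum_congr rfl fun t ht => by rw [hvol t ht], ← Finset.sum_mul, hc, one_mul]
  -- Differentiating |r|² = 1 shows that r(x) is orthogonal to the range of Dr(x). So Dr(x) is
  -- singular: a vector v with Dr(x) v = r(x) would give 2 |r(x)|² = 0.
  have hzero : ∀ x ∈ B, (ContinuousLinearMap.id ℝ E + D x).det = 0 := by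
    intro x hx
    have hxU := hBU (hBc hx)
    have hDx : ContinuousLinearMap.id ℝ E + D x = fderiv ℝ r x := by simp [hD]
    rw [hDx]
    by_contra hne
    have hu : IsUnit (LinearMap.det (fderiv ℝ r x : E →ₗ[ℝ] E)) := isUnit_iff_ne_zero.2 hne
    obtain ⟨v, hv⟩ : ∃ v, fderiv ℝ r x v = r x := by
      obtain ⟨v, hv⟩ := (LinearMap.equivOfIsUnitDet hu).surjective (r x)
      exact ⟨v, by simpa using hv⟩
    have h1 : HasFDerivAt (fun y => inner ℝ (r y) (r y)) _ x :=
      (hrd x hxU).hasFDerivAt.inner ℝ (hrd x hxU).hasFDerivAt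
    have h2 : (fun y => inner ℝ (r y) (r y)) =ᶠ[𝓝 x] fun _ => (1 : ℝ) := by
      filter_upwards [hU.mem_nhds hxU] with y hy
      rw [real_inner_self_eq_norm_sq, hnorm y hy, one_pow]
    have h3 := h1.unique ((hasFDerivAt_const (1 : ℝ) x).congr_of_eventuallyEq h2)
    have h4 := congrArg (fun L => L v) h3
    simp [hv, hnorm x hxU] at h4
  rw [setIntegral_congr_fun measurableSet_ball hzero] at hone
  simp only [integral_zero] at hone
  have hpos : 0 < volume.real B :=
    ENNReal.toReal_pos (Metric.measure_ball_pos volume (0 : E) one_pos).ne' measure_ball_lt_top.ne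
  exact hpos.ne hone

/-- The ray from k x through x leaves the ball at a point r x, which defines a retraction. Writing r
x = x + c u with u = x - k x, the number c is the larger root of |x + c u|² = 1, and Δ is a quarter
of the discriminant. On the sphere |k x| < 1 gives ⟨x, u⟩ > 0, which makes Δ positive and c zero
there. -/
theorem not_contDiff_fixedPointFree {k : E → E} (hk : ContDiff ℝ 1 k) (hlt : ∀ x, ‖k x‖ < 1)
    (hne : ∀ x, k x ≠ x) : False := by
  set u : E → E := fun x => x - k x with hu
  have hu0 : ∀ x, 0 < ‖u x‖ ^ 2 := fun x => by
    have : u x ≠ 0 := sub_ne_zero.2 (hne x).symm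
    positivity
  have huc : ContDiff ℝ 1 u := contDiff_id.sub hk
  set Δ : E → ℝ := fun x => inner ℝ x (u x) ^ 2 + ‖u x‖ ^ 2 * (1 - ‖x‖ ^ 2) with hΔ
  have hΔc : ContDiff ℝ 1 Δ :=
    ((contDiff_id.inner ℝ huc).pow 2).add
      ((huc.norm_sq ℝ).mul (contDiff_const.sub (contDiff_id.norm_sq ℝ)))
  set c : E → ℝ := fun x => (√(Δ x) - inner ℝ x (u x)) / ‖u x‖ ^ 2 with hc
  have hsphere : ∀ x, ‖x‖ = 1 → 0 < inner ℝ x (u x) := by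
    intro x hx
    have h1 : inner ℝ x (u x) = 1 - inner ℝ x (k x) := by
      rw [hu, inner_sub_right, real_inner_self_eq_norm_sq, hx, one_pow]
    have h2 := real_inner_le_norm x (k x)
    rw [hx, one_mul] at h2
    linarith [hlt x]
  refine no_retraction (r := fun x => x + c x • u x) (U := {x | 0 < Δ x})
    (isOpen_lt continuous_const hΔc.continuous) ?_ ?_ ?_ ?_
  · intro x hx
    change 0 < Δ x
    rcases (mem_closedBall_zero_iff.1 hx).lt_or_eq with h | h
    · have h1 : 0 < 1 - ‖x‖ ^ 2 := by nlinarith [norm_nonneg x]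
      have := mul_pos (hu0 x) h1
      have := sq_nonneg (inner ℝ x (u x))
      simp only [hΔ]
      linarith
    · simp only [hΔ, h]
      have := hsphere x h
      nlinarith [sq_pos_of_pos this]
  · intro x hx
    refine ContDiffAt.contDiffWithinAt ?_
    have hx' : Δ x ≠ 0 := (show 0 < Δ x from hx).ne'
    exact contDiffAt_id.add ((((hΔc.contDiffAt.sqrt hx').sub
      (contDiff_id.inner ℝ huc).contDiffAt).div (huc.norm_sq ℝ).contDiffAt (hu0 x).ne').smul
      huc.contDiffAt)
  · intro x hx
    have h1 : c x * ‖u x‖ ^ 2 = √(Δ x) - inner ℝ x (u x) := div_mul_cancel₀ _ (hu0 x).ne'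
    have h2 : √(Δ x) ^ 2 = Δ x := Real.sq_sqrt (le_of_lt hx)
    have h3 : ‖x + c x • u x‖ ^ 2 = 1 := by
      rw [norm_add_sq_real, inner_smul_right, norm_smul, mul_pow, Real.norm_eq_abs, sq_abs]
      refine mul_right_cancel₀ (hu0 x).ne' ?_
      have h4 : (c x * ‖u x‖ ^ 2) ^ 2 + 2 * inner ℝ x (u x) * (c x * ‖u x‖ ^ 2) =
          ‖u x‖ ^ 2 * (1 - ‖x‖ ^ 2) := by
        rw [h1]
        simp only [hΔ] at h2 ⊢
        linear_combination h2
      linear_combination h4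
    have := norm_nonneg (x + c x • u x)
    nlinarith
  · intro x hx
    have : c x = 0 := by
      simp only [hc, hΔ, hx]
      rw [one_pow, sub_self, mul_zero, add_zero, Real.sqrt_sq (hsphere x hx).le, sub_self,
        zero_div]
    simp [this]

/-- **Brouwer's fixed point theorem** for the closed unit ball. -/
theorem exists_fixedPoint_closedBall {f : E → E}
    (hf : ContinuousOn f (Metric.closedBall 0 1))
    (hm : Set.MapsTo f (Metric.closedBall 0 1) (Metric.closedBall 0 1)) :
    ∃ x ∈ Metric.closedBall (0 : E) 1, f x = x := by
  by_contra! hcon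
  -- Composing with the radial projection extends f continuously to the whole space, so that it can
  -- be approximated by a smooth map.
  set P : E → E := fun x => (max 1 ‖x‖)⁻¹ • x with hP
  have hmax : ∀ x : E, 0 < max 1 ‖x‖ := fun x => lt_of_lt_of_le one_pos (le_max_left _ _)
  have hPc : Continuous P :=
    ((continuous_const.max continuous_norm).inv₀ fun x => (hmax x).ne').smul continuous_id
  have hPm : ∀ x, P x ∈ Metric.closedBall (0 : E) 1 := by
    intro x
    rw [mem_closedBall_zero_iff, hP, norm_smul, norm_inv, Real.norm_of_nonneg (hmax x).le,
      inv_mul_le_iff₀ (hmax x), mul_one]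
    exact le_max_right _ _
  have hPid : ∀ x ∈ Metric.closedBall (0 : E) 1, P x = x := by
    intro x hx
    rw [hP]
    simp only [max_eq_left (mem_closedBall_zero_iff.1 hx), inv_one, one_smul]
  have hfP : Continuous (f ∘ P) := hf.comp_continuous hPc hPm
  obtain ⟨x₀, hx₀, hmin⟩ := (isCompact_closedBall (0 : E) 1).exists_isMinOn ⟨0, by simp⟩
    (hf.sub continuousOn_id).norm
  set ε := ‖f x₀ - x₀‖ with hε
  have hε0 : 0 < ε := norm_pos_iff.2 (sub_ne_zero.2 (hcon x₀ hx₀))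
  obtain ⟨g, hg, hgf, -⟩ := hfP.exists_contDiff_approx 1 (ε := fun _ => ε / 4) continuous_const
    fun _ => by positivity
  have hgn : ∀ x, ‖g x‖ < 1 + ε / 2 := by
    intro x
    have h1 := hgf x
    rw [dist_eq_norm] at h1
    have h2 := mem_closedBall_zero_iff.1 (hm (hPm x))
    have h3 := norm_add_le (g x - (f ∘ P) x) ((f ∘ P) x)
    rw [sub_add_cancel] at h3
    simp only [Function.comp_apply] at h1 h3
    linarith
  have hpos : 0 < 1 + ε / 2 := by positivity
  -- Dividing by 1 + ε/2 brings the approximation into the open unit ball. A fixed point x of the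
  -- quotient would lie in the ball and satisfy |f x - x| ≤ ε/4 + ε/2 < ε, against the minimality of
  -- ε.
  refine not_contDiff_fixedPointFree (k := fun x => (1 + ε / 2)⁻¹ • g x) (hg.const_smul _) ?_ ?_
  · intro x
    rw [norm_smul, norm_inv, Real.norm_of_nonneg hpos.le, inv_mul_lt_iff₀ hpos, mul_one]
    exact hgn x
  · intro x hx
    have hgx : g x = (1 + ε / 2) • x := by
      rw [← hx, smul_smul, mul_inv_cancel₀ hpos.ne', one_smul, hx]
    have hxn : ‖x‖ ≤ 1 := by
      have := hgn x
      rw [hgx, norm_smul, Real.norm_of_nonneg hpos.le] at this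
      by_contra h
      push Not at h
      nlinarith
    have hxm := mem_closedBall_zero_iff.2 hxn
    have h1 := hgf x
    rw [dist_eq_norm, Function.comp_apply, hPid x hxm, norm_sub_rev] at h1
    have h2 : ε ≤ ‖f x - x‖ := hmin hxm
    have h3 : ‖f x - x‖ ≤ ‖f x - g x‖ + ‖g x - x‖ := norm_sub_le_norm_sub_add_norm_sub _ _ _
    have h4 : g x - x = (ε / 2) • x := by
      rw [hgx, add_smul, one_smul, add_sub_cancel_left]
    rw [h4, norm_smul, Real.norm_of_nonneg (by positivity)] at h3
    nlinarith

/-- A continuous map on a ball of radius `R` that stays within `R` of the translation `x ↦ x - c`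
vanishes somewhere on the ball. -/
theorem exists_zero_of_norm_sub_le {Φ : E → E} {c : E} {R : ℝ} (hR : 0 < R)
    (hΦ : ContinuousOn Φ (Metric.closedBall c R))
    (h : ∀ x ∈ Metric.closedBall c R, ‖Φ x - (x - c)‖ ≤ R) :
    ∃ x ∈ Metric.closedBall c R, Φ x = 0 := by
  have hmaps : Set.MapsTo (fun u : E => c + R • u) (Metric.closedBall 0 1)
      (Metric.closedBall c R) := by
    intro u hu
    rw [mem_closedBall_iff_norm, add_sub_cancel_left, norm_smul, Real.norm_of_nonneg hR.le]
    exact mul_le_of_le_one_right hR.le (mem_closedBall_zero_iff.1 hu)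
  obtain ⟨u, hu, hfix⟩ := exists_fixedPoint_closedBall
    (f := fun u : E => u - R⁻¹ • Φ (c + R • u))
    (continuousOn_id.sub ((hΦ.comp (by fun_prop) hmaps).const_smul R⁻¹)) (by
      intro u hu
      have h1 := h _ (hmaps hu)
      rw [mem_closedBall_zero_iff]
      have h2 : u - R⁻¹ • Φ (c + R • u) = -(R⁻¹ • (Φ (c + R • u) - (c + R • u - c))) := by
        rw [add_sub_cancel_left, smul_sub, smul_smul, inv_mul_cancel₀ hR.ne', one_smul, neg_sub]
      change ‖u - R⁻¹ • Φ (c + R • u)‖ ≤ 1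
      rw [h2, norm_neg, norm_smul, norm_inv, Real.norm_of_nonneg hR.le, inv_mul_le_iff₀ hR, mul_one]
      exact h1)
  refine ⟨_, hmaps hu, ?_⟩
  have : R⁻¹ • Φ (c + R • u) = 0 := by simpa using hfix
  exact (smul_eq_zero.1 this).resolve_left (inv_ne_zero hR.ne')

end Brouwer

/-! ## Differentiability in quadratic mean -/

namespace Semiparametric

variable {Θ Z : Type*} [MeasurableSpace Z]

theorem sq_integral_mul_le {μ : Measure Z} {f g : Z → ℝ} (hf : MemLp f 2 μ) (hg : MemLp g 2 μ) :
    (∫ z, f z * g z ∂μ) ^ 2 ≤ (∫ z, f z ^ 2 ∂μ) * ∫ z, g z ^ 2 ∂μ := by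
  have hff := hf.integrable_sq
  have hgg := hg.integrable_sq
  have hfg : Integrable (fun z => f z * g z) μ := hf.integrable_mul hg
  have h : ∀ x : ℝ, 0 ≤ (∫ z, g z ^ 2 ∂μ) * (x * x) + (2 * ∫ z, f z * g z ∂μ) * x +
      ∫ z, f z ^ 2 ∂μ := by
    intro x
    have h1 : ∫ z, (f z + x * g z) ^ 2 ∂μ = (∫ z, g z ^ 2 ∂μ) * (x * x) +
        (2 * ∫ z, f z * g z ∂μ) * x + ∫ z, f z ^ 2 ∂μ := by
      have h2 : (fun z => (f z + x * g z) ^ 2) =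
          fun z => ((x * x) * g z ^ 2 + (2 * x) * (f z * g z)) + f z ^ 2 := by
        funext z; ring
      rw [h2, integral_add ((hgg.const_mul _).fun_add (hfg.const_mul _)) hff,
        integral_add (hgg.const_mul _) (hfg.const_mul _), integral_const_mul, integral_const_mul]
      ring
    rw [← h1]
    exact integral_nonneg fun z => sq_nonneg _
  have := discrim_le_zero h
  rw [discrim] at this
  nlinarith

section Density

variable {ν : Measure Z} {q : Z → ℝ}

theorem integral_withDensity_ofReal (hq : Measurable q) (hq0 : ∀ z, 0 ≤ q z) (g : Z → ℝ) :
    ∫ z, g z ∂(ν.withDensity fun z => ENNReal.ofReal (q z)) = ∫ z, q z * g z ∂ν := by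
  rw [integral_withDensity_eq_integral_toReal_smul hq.ennreal_ofReal
    (Eventually.of_forall fun z => ENNReal.ofReal_lt_top)]
  refine integral_congr_ae (Eventually.of_forall fun z => ?_)
  simp only [ENNReal.toReal_ofReal (hq0 z), smul_eq_mul]

theorem integrable_withDensity_ofReal_iff (hq : Measurable q) (hq0 : ∀ z, 0 ≤ q z) (g : Z → ℝ) :
    Integrable g (ν.withDensity fun z => ENNReal.ofReal (q z)) ↔
      Integrable (fun z => q z * g z) ν := by
  rw [integrable_withDensity_iff_integrable_smul' hq.ennreal_ofReal
    (Eventually.of_forall fun z => ENNReal.ofReal_lt_top)]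
  refine integrable_congr (Eventually.of_forall fun z => ?_)
  simp only [ENNReal.toReal_ofReal (hq0 z), smul_eq_mul]

theorem memLp_sqrt_mul (hq : Measurable q) (hq0 : ∀ z, 0 ≤ q z) {s : Z → ℝ}
    (hs : MemLp s 2 (ν.withDensity fun z => ENNReal.ofReal (q z))) :
    MemLp (fun z => s z * √(q z)) 2 ν := by
  have hsq := (integrable_withDensity_ofReal_iff hq hq0 _).1 hs.integrable_sq
  have hmeas : AEStronglyMeasurable (fun z => s z * √(q z)) ν := by
    -- Measurability of `s` is given only for the measure with density q, hence says nothing where q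
    -- = 0. The product q s is measurable for ν, and q s / √q equals s √q, both being 0 where q = 0.
    have h1 : AEMeasurable (fun z => ((q z).toNNReal : ℝ) • s z) ν :=
      (aemeasurable_withDensity_iff hq.real_toNNReal).1 hs.1.aemeasurable
    have h2 : AEMeasurable (fun z => ((q z).toNNReal : ℝ) • s z * (√(q z))⁻¹) ν :=
      h1.mul hq.sqrt.inv.aemeasurable
    refine (h2.congr (Eventually.of_forall fun z => ?_)).aestronglyMeasurable
    simp only [Real.coe_toNNReal _ (hq0 z), smul_eq_mul]
    rcases (hq0 z).eq_or_lt with h | h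
    · simp [← h]
    · have h3 := (Real.sqrt_pos.2 h).ne'
      field_simp
      rw [Real.sq_sqrt h.le, mul_comm]
  rw [memLp_two_iff_integrable_sq hmeas]
  refine hsq.congr (Eventually.of_forall fun z => ?_)
  simp only [mul_pow, Real.sq_sqrt (hq0 z), mul_comm]

theorem memLp_sqrt (hq : Measurable q) (hq0 : ∀ z, 0 ≤ q z)
    (hP : IsProbabilityMeasure (ν.withDensity fun z => ENNReal.ofReal (q z))) :
    MemLp (fun z => √(q z)) 2 ν := by
  simpa using memLp_sqrt_mul hq hq0 (memLp_const (1 : ℝ))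

end Density

/-- Cauchy-Schwarz with the Hellinger distance. -/
theorem sq_integral_sub_le_hellinger {ν : Measure Z} {q q' : Z → ℝ}
    (hq : Measurable q) (hq0 : ∀ z, 0 ≤ q z) (hq' : Measurable q') (hq0' : ∀ z, 0 ≤ q' z)
    (hP : IsProbabilityMeasure (ν.withDensity fun z => ENNReal.ofReal (q z)))
    (hP' : IsProbabilityMeasure (ν.withDensity fun z => ENNReal.ofReal (q' z)))
    {g : Z → ℝ} (hg : Measurable g) {K : ℝ} (hK : ∀ z, |g z| ≤ K) :
    (∫ z, g z ∂(ν.withDensity fun z => ENNReal.ofReal (q z)) -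
        ∫ z, g z ∂(ν.withDensity fun z => ENNReal.ofReal (q' z))) ^ 2 ≤
      2 * (∫ z, (√(q z) - √(q' z)) ^ 2 ∂ν) *
        (∫ z, g z ^ 2 ∂(ν.withDensity fun z => ENNReal.ofReal (q z)) +
          ∫ z, g z ^ 2 ∂(ν.withDensity fun z => ENNReal.ofReal (q' z))) := by
  have hu := memLp_sqrt hq hq0 hP
  have hv := memLp_sqrt hq' hq0' hP'
  have hb : ∀ (p : Z → ℝ), Measurable p → (∀ z, 0 ≤ p z) →
      IsProbabilityMeasure (ν.withDensity fun z => ENNReal.ofReal (p z)) →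
      Integrable (fun z => p z * g z) ν ∧ Integrable (fun z => p z * g z ^ 2) ν := by
    intro p hp hp0 hPp
    refine ⟨(integrable_withDensity_ofReal_iff hp hp0 _).1 ?_,
      (integrable_withDensity_ofReal_iff hp hp0 _).1 ?_⟩
    · exact Integrable.of_bound hg.aestronglyMeasurable K (Eventually.of_forall hK)
    · refine Integrable.of_bound (hg.pow_const 2).aestronglyMeasurable (K ^ 2)
        (Eventually.of_forall fun z => ?_)
      rw [norm_pow]
      exact pow_le_pow_left₀ (norm_nonneg _) (hK z) 2
  obtain ⟨h1, h2⟩ := hb q hq hq0 hP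
  obtain ⟨h1', h2'⟩ := hb q' hq' hq0' hP'
  simp only [integral_withDensity_ofReal hq hq0, integral_withDensity_ofReal hq' hq0']
  rw [← integral_sub h1 h1', ← integral_add h2 h2']
  have hd : MemLp (fun z => √(q z) - √(q' z)) 2 ν := hu.sub hv
  have hs : MemLp (fun z => g z * (√(q z) + √(q' z))) 2 ν := by
    refine MemLp.of_le_mul (c := K) (hu.add hv)
      (hg.aestronglyMeasurable.mul (hu.1.add hv.1)) (Eventually.of_forall fun z => ?_)
    rw [norm_mul]
    exact mul_le_mul_of_nonneg_right (hK z) (norm_nonneg _)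
  have hcs := sq_integral_mul_le hd hs
  -- The factorization q - q' = (√q - √q')(√q + √q') turns a difference of means into an L² inner
  -- product; afterwards (√q + √q')² ≤ 2 (q + q').
  have h3 : ∀ z, (√(q z) - √(q' z)) * (g z * (√(q z) + √(q' z))) = q z * g z - q' z * g z := by
    intro z
    have h4 := Real.sq_sqrt (hq0 z)
    have h5 := Real.sq_sqrt (hq0' z)
    linear_combination g z * h4 - g z * h5
  simp only [h3] at hcs
  refine hcs.trans ?_
  have h6 : ∫ z, (g z * (√(q z) + √(q' z))) ^ 2 ∂ν ≤
      ∫ z, 2 * (q z * g z ^ 2 + q' z * g z ^ 2) ∂ν := by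
    refine integral_mono hs.integrable_sq ((h2.add h2').const_mul 2) fun z => ?_
    have h4 := Real.sq_sqrt (hq0 z)
    have h5 := Real.sq_sqrt (hq0' z)
    have h7 := mul_nonneg (sq_nonneg (g z)) (sq_nonneg (√(q z) - √(q' z)))
    change (g z * (√(q z) + √(q' z))) ^ 2 ≤ 2 * (q z * g z ^ 2 + q' z * g z ^ 2)
    nlinarith
  rw [integral_const_mul] at h6
  have h8 : 0 ≤ ∫ z, (√(q z) - √(q' z)) ^ 2 ∂ν := integral_nonneg fun z => sq_nonneg _
  nlinarith [mul_le_mul_of_nonneg_left h6 h8]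

/-- Along a regular submodel expectations of bounded functions are close in a Hellinger sense, and
have a first order expansion that is uniform over functions bounded by one. -/
theorem IsRegularSubmodel.expansion {obs : Θ → Measure Z} (hobs : ∀ θ, IsProbabilityMeasure (obs θ))
    {𝓜 : Set Θ} {θ₀ : Θ} {path : ℝ → Θ} {s : Z → ℝ} (h : IsRegularSubmodel obs 𝓜 θ₀ path s) :
    ∃ (C : ℝ) (ρ : ℝ → ℝ), 0 ≤ C ∧ Tendsto ρ (𝓝[≠] 0) (𝓝 0) ∧ ∀ᶠ t in 𝓝[≠] (0 : ℝ),
      (∀ (g : Z → ℝ) (K : ℝ), Measurable g → (∀ z, |g z| ≤ K) →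
        (∫ z, g z ∂(obs (path t)) - ∫ z, g z ∂(obs θ₀)) ^ 2 ≤
          C * t ^ 2 * (∫ z, g z ^ 2 ∂(obs (path t)) + ∫ z, g z ^ 2 ∂(obs θ₀))) ∧
      ∀ g : Z → ℝ, Measurable g → (∀ z, |g z| ≤ 1) →
        |∫ z, g z ∂(obs (path t)) - ∫ z, g z ∂(obs θ₀) - t * ∫ z, g z * s z ∂(obs θ₀)| ≤
          |t| * ρ t := by
  obtain ⟨ν, q, -, hqm, hq0, hobsq, hlim⟩ := h.qmd
  have hobs0 := hobsq.self_of_nhds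
  rw [h.base] at hobs0
  have hP0 : IsProbabilityMeasure (ν.withDensity fun z => ENNReal.ofReal (q 0 z)) :=
    hobs0 ▸ hobs θ₀
  have hs : MemLp s 2 (ν.withDensity fun z => ENNReal.ofReal (q 0 z)) := hobs0 ▸ h.memLp
  have hv := memLp_sqrt (hqm 0) (hq0 0) hP0
  have hsv := memLp_sqrt_mul (hqm 0) (hq0 0) hs
  set D : ℝ → Z → ℝ := fun t z => (√(q t z) - √(q 0 z)) / t - s z / 2 * √(q 0 z) with hD
  set η : ℝ → ℝ := fun t => ∫ z, D t z ^ 2 ∂ν with hη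
  have hDm : ∀ t, AEStronglyMeasurable (D t) ν := by
    intro t
    have h1 : AEStronglyMeasurable (fun z => (√(q t z) - √(q 0 z)) / t) ν :=
      (((hqm t).sqrt.sub (hqm 0).sqrt).div_const t).aestronglyMeasurable
    refine (h1.sub (hsv.1.const_mul (1 / 2))).congr (Eventually.of_forall fun z => ?_)
    simp only [hD, Pi.sub_apply]
    ring
  have hηeq : ∀ t, η t = (∫⁻ z, ENNReal.ofReal (D t z ^ 2) ∂ν).toReal := fun t =>
    integral_eq_lintegral_of_nonneg_ae (Eventually.of_forall fun z => sq_nonneg _)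
      ((hDm t).pow 2)
  have hηlim : Tendsto η (𝓝[≠] 0) (𝓝 0) := by
    have := (ENNReal.tendsto_toReal ENNReal.zero_ne_top).comp hlim
    simp only [ENNReal.toReal_zero] at this
    exact this.congr fun t => (hηeq t).symm
  have hη0 : ∀ t, 0 ≤ η t := fun t => integral_nonneg fun z => sq_nonneg _
  set I : ℝ := ∫ z, (s z * √(q 0 z)) ^ 2 ∂ν with hI
  -- With √q_t - √q_0 = t R and R = D + s √q_0 / 2, one has ∫ R² ≤ 2η + I/2. The first constant is
  -- the factor 2 of the Hellinger inequality times this bound when η < 1; the rate ρ bounds the two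
  -- terms of the identity `hkey` below.
  refine ⟨2 * (2 + I / 2), fun t => 2 * √(η t) + |t| * (2 * η t + I / 2), by positivity, ?_, ?_⟩
  · have h1 : Tendsto (fun t => √(η t)) (𝓝[≠] 0) (𝓝 0) := by
      simpa using hηlim.sqrt
    have h2 : Tendsto (fun t : ℝ => |t|) (𝓝[≠] 0) (𝓝 0) := by
      simpa using (continuous_abs.tendsto (0 : ℝ)).mono_left nhdsWithin_le_nhds
    simpa using (h1.const_mul 2).add (h2.mul ((hηlim.const_mul 2).add_const (I / 2)))
  · have hfin : ∀ᶠ t in 𝓝[≠] (0 : ℝ), ∫⁻ z, ENNReal.ofReal (D t z ^ 2) ∂ν < ⊤ :=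
      hlim.eventually (gt_mem_nhds ENNReal.zero_lt_top)
    have hle : ∀ᶠ t in 𝓝[≠] (0 : ℝ), η t < 1 := hηlim.eventually (gt_mem_nhds one_pos)
    filter_upwards [hfin, hle, hobsq.filter_mono nhdsWithin_le_nhds, self_mem_nhdsWithin]
      with t hfin hle hobst ht0
    have ht0' : t ≠ 0 := ht0
    have hPt : IsProbabilityMeasure (ν.withDensity fun z => ENNReal.ofReal (q t z)) :=
      hobst ▸ hobs (path t)
    have hDint : Integrable (fun z => D t z ^ 2) ν := by
      refine ⟨(hDm t).pow 2, ?_⟩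
      rw [hasFiniteIntegral_iff_ofReal (Eventually.of_forall fun z => sq_nonneg _)]
      exact hfin
    have hDL : MemLp (D t) 2 ν := (memLp_two_iff_integrable_sq (hDm t)).2 hDint
    have hdiff : ∀ z, √(q t z) - √(q 0 z) = t * (D t z + s z * √(q 0 z) / 2) := by
      intro z
      simp only [hD]
      field_simp
      ring
    have hRL : MemLp (fun z => D t z + s z * √(q 0 z) / 2) 2 ν := hDL.add (by
      simpa [div_eq_inv_mul] using hsv.const_mul (2⁻¹))
    have hR : ∫ z, (D t z + s z * √(q 0 z) / 2) ^ 2 ∂ν ≤ 2 * η t + I / 2 := by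
      calc ∫ z, (D t z + s z * √(q 0 z) / 2) ^ 2 ∂ν
          ≤ ∫ z, (2 * D t z ^ 2 + 2⁻¹ * (s z * √(q 0 z)) ^ 2) ∂ν := by
            refine integral_mono hRL.integrable_sq
              ((hDint.const_mul 2).add (hsv.integrable_sq.const_mul _)) fun z => ?_
            change (D t z + s z * √(q 0 z) / 2) ^ 2 ≤
              2 * D t z ^ 2 + 2⁻¹ * (s z * √(q 0 z)) ^ 2
            nlinarith [sq_nonneg (D t z - s z * √(q 0 z) / 2)]
        _ = 2 * η t + I / 2 := by
            rw [integral_add (hDint.const_mul 2) (hsv.integrable_sq.const_mul _),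
              integral_const_mul, integral_const_mul]
            ring
    rw [hobst, hobs0]
    refine ⟨fun g K hg hK => ?_, fun g hg hK => ?_⟩
    · have h1 := sq_integral_sub_le_hellinger (hqm t) (hq0 t) (hqm 0) (hq0 0) hPt hP0 hg hK
      refine h1.trans (mul_le_mul_of_nonneg_right ?_ (by positivity))
      simp_rw [hdiff, mul_pow]
      rw [integral_const_mul]
      nlinarith [mul_le_mul_of_nonneg_left hR (sq_nonneg t), sq_nonneg t]
    · rw [integral_withDensity_ofReal (hqm t) (hq0 t), integral_withDensity_ofReal (hqm 0) (hq0 0),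
        integral_withDensity_ofReal (hqm 0) (hq0 0)]
      have hgi : ∀ (p : Z → ℝ), Measurable p → (∀ z, 0 ≤ p z) →
          IsProbabilityMeasure (ν.withDensity fun z => ENNReal.ofReal (p z)) →
          Integrable (fun z => p z * g z) ν := fun p hp hp0 hPp =>
        (integrable_withDensity_ofReal_iff hp hp0 _).1
          (Integrable.of_bound hg.aestronglyMeasurable 1 (Eventually.of_forall hK))
      have hgL : MemLp (fun z => g z * √(q 0 z)) 2 ν := by
        refine MemLp.of_le_mul (c := 1) hv (hg.aestronglyMeasurable.mul hv.1)
          (Eventually.of_forall fun z => ?_)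
        rw [norm_mul]
        exact mul_le_mul_of_nonneg_right (hK z) (norm_nonneg _)
      have hgs : Integrable (fun z => q 0 z * (g z * s z)) ν := by
        refine (hsv.integrable_mul hgL).congr (Eventually.of_forall fun z => ?_)
        have h4 := Real.sq_sqrt (hq0 0 z)
        simp only [Pi.mul_apply]
        linear_combination (s z * g z) * h4
      have hDv : Integrable (fun z => D t z * (g z * √(q 0 z))) ν := hDL.integrable_mul hgL
      have hgR : Integrable (fun z => g z * (D t z + s z * √(q 0 z) / 2) ^ 2) ν :=
        hRL.integrable_sq.bdd_mul hg.aestronglyMeasurable (Eventually.of_forall hK)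
      have hgd : Integrable (fun z => q t z * g z - q 0 z * g z) ν :=
        (hgi _ (hqm t) (hq0 t) hPt).sub (hgi _ (hqm 0) (hq0 0) hP0)
      -- Squaring √q_t = √q_0 + t R gives q_t - q_0 - t s q_0 = 2 t D √q_0 + t² R² pointwise.
      have hkey : ∫ z, q t z * g z ∂ν - ∫ z, q 0 z * g z ∂ν - t * ∫ z, q 0 z * (g z * s z) ∂ν =
          t * (2 * ∫ z, D t z * (g z * √(q 0 z)) ∂ν) +
            t ^ 2 * ∫ z, g z * (D t z + s z * √(q 0 z) / 2) ^ 2 ∂ν := by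
        rw [← integral_const_mul, ← integral_const_mul, ← integral_const_mul, ← integral_const_mul,
          ← integral_sub (hgi _ (hqm t) (hq0 t) hPt) (hgi _ (hqm 0) (hq0 0) hP0),
          ← integral_sub hgd (hgs.const_mul t), ← integral_add ((hDv.const_mul 2).const_mul t)
            (hgR.const_mul (t ^ 2))]
        refine integral_congr_ae (Eventually.of_forall fun z => ?_)
        have h4 := Real.sq_sqrt (hq0 0 z)
        have h5 := Real.sq_sqrt (hq0 t z)
        have h6 : √(q t z) = √(q 0 z) + t * (D t z + s z * √(q 0 z) / 2) := by
          linear_combination hdiff z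
        rw [h6] at h5
        simp only
        linear_combination -(g z) * h5 + (g z + t * s z * g z) * h4
      rw [hkey]
      have h1 : |∫ z, D t z * (g z * √(q 0 z)) ∂ν| ≤ √(η t) := by
        refine Real.abs_le_sqrt ((sq_integral_mul_le hDL hgL).trans ?_)
        have h2 : ∫ z, (g z * √(q 0 z)) ^ 2 ∂ν ≤ 1 := by
          calc ∫ z, (g z * √(q 0 z)) ^ 2 ∂ν ≤ ∫ z, q 0 z * 1 ∂ν := by
                refine integral_mono hgL.integrable_sq ((integrable_withDensity_ofReal_iff
                  (hqm 0) (hq0 0) _).1 (integrable_const 1)) fun z => ?_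
                change (g z * √(q 0 z)) ^ 2 ≤ q 0 z * 1
                rw [mul_pow, Real.sq_sqrt (hq0 0 z), mul_comm]
                exact mul_le_mul_of_nonneg_left ((sq_le_one_iff_abs_le_one _).2 (hK z)) (hq0 0 z)
            _ = 1 := by
                rw [← integral_withDensity_ofReal (hqm 0) (hq0 0)]
                simp
        exact mul_le_of_le_one_right (hη0 t) h2
      have h2 : |∫ z, g z * (D t z + s z * √(q 0 z) / 2) ^ 2 ∂ν| ≤ 2 * η t + I / 2 := by
        refine (abs_integral_le_integral_abs).trans (le_trans ?_ hR)
        refine integral_mono hgR.abs hRL.integrable_sq fun z => ?_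
        change |g z * (D t z + s z * √(q 0 z) / 2) ^ 2| ≤ (D t z + s z * √(q 0 z) / 2) ^ 2
        rw [abs_mul, abs_of_nonneg (sq_nonneg (D t z + s z * √(q 0 z) / 2))]
        exact mul_le_of_le_one_left (sq_nonneg _) (hK z)
      refine (abs_add_le _ _).trans ?_
      rw [abs_mul, abs_mul, abs_mul, abs_two, abs_of_nonneg (sq_nonneg t), ← sq_abs t]
      have h3 := abs_nonneg t
      have h4 := mul_le_mul_of_nonneg_left h1 h3
      have h5 := mul_le_mul_of_nonneg_left h2 (sq_nonneg |t|)
      nlinarith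

/-- A score has mean zero. -/
theorem IsRegularSubmodel.integral_score {obs : Θ → Measure Z}
    (hobs : ∀ θ, IsProbabilityMeasure (obs θ))
    {𝓜 : Set Θ} {θ₀ : Θ} {path : ℝ → Θ} {s : Z → ℝ} (h : IsRegularSubmodel obs 𝓜 θ₀ path s) :
    ∫ z, s z ∂(obs θ₀) = 0 := by
  obtain ⟨C, ρ, -, hρ, hexp⟩ := h.expansion hobs
  have h1 : ∀ᶠ t in 𝓝[≠] (0 : ℝ), |∫ z, s z ∂(obs θ₀)| ≤ ρ t := by
    filter_upwards [hexp, self_mem_nhdsWithin] with t ht ht0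
    -- For the test function 1 both expectations equal 1, so only t ∫ s remains in the expansion.
    have h2 := ht.2 (fun _ => 1) measurable_const (by simp)
    simp only [integral_const, probReal_univ, smul_eq_mul, mul_one, sub_self, zero_sub, one_mul,
      abs_neg, abs_mul] at h2
    exact le_of_mul_le_mul_left h2 (abs_pos.2 ht0)
  have h2 := ge_of_tendsto hρ h1
  exact abs_nonpos_iff.1 h2

/-- The difference is exactly -(√(1+x) - 1)²/2, and |√(1+x) - 1| ≤ |x|. Unlike a Taylor bound, this
needs no distance from x = -1. -/
theorem abs_sqrt_one_add_sub_le {x : ℝ} (hx : 0 ≤ 1 + x) : |√(1 + x) - 1 - x / 2| ≤ x ^ 2 / 2 := by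
  have h1 := Real.sq_sqrt hx
  have h2 := Real.sqrt_nonneg (1 + x)
  have h3 : √(1 + x) - 1 - x / 2 = -((√(1 + x) - 1) ^ 2 / 2) := by linear_combination (1 / 2) * h1
  rw [h3, abs_neg, abs_of_nonneg (by positivity)]
  have h4 : x = (√(1 + x) - 1) * (√(1 + x) + 1) := by linear_combination -h1
  have h5 : x ^ 2 = (√(1 + x) - 1) ^ 2 * (√(1 + x) + 1) ^ 2 := by
    nth_rewrite 1 [h4]; ring
  rw [h5]
  nlinarith [sq_nonneg (√(1 + x) - 1)]

/-- A path with densities `1 + t a + t² r` relative to the base law, with `a` and `r` bounded, is a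
regular submodel with score `a`. -/
theorem IsRegularSubmodel.of_density {obs : Θ → Measure Z} {𝓜 : Set Θ} {θ₀ : Θ} {path : ℝ → Θ}
    (hobs : IsProbabilityMeasure (obs θ₀)) (hbase : path 0 = θ₀)
    (hmem : ∀ᶠ t in 𝓝 (0 : ℝ), path t ∈ 𝓜) {a r s : Z → ℝ} (ha : Measurable a)
    (hr : Measurable r) {K : ℝ} (haK : ∀ z, |a z| ≤ K) (hrK : ∀ z, |r z| ≤ K)
    (hdens : ∀ᶠ t in 𝓝 (0 : ℝ), obs (path t) =
      (obs θ₀).withDensity fun z => ENNReal.ofReal (1 + t * a z + t ^ 2 * r z))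
    (hs : s =ᵐ[obs θ₀] a) : IsRegularSubmodel obs 𝓜 θ₀ path s := by
  -- Densities must be nonnegative for every t, whence the truncation at 0; it changes nothing for
  -- small t, where 1 + t a + t² r > 0.
  refine ⟨hbase, hmem, ?_, obs θ₀, fun t z => max (1 + t * a z + t ^ 2 * r z) 0, inferInstance,
    fun t => ?_, fun t z => le_max_right _ _, ?_, ?_⟩
  · exact (memLp_congr_ae hs).2 (MemLp.of_bound ha.aestronglyMeasurable K
      (Eventually.of_forall haK))
  · exact ((measurable_const.add (ha.const_mul t)).add (hr.const_mul _)).max measurable_const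
  · filter_upwards [hdens] with t ht
    rw [ht]
    congr 1
    funext z
    rw [ENNReal.ofReal_max, ENNReal.ofReal_zero, max_eq_left (zero_le)]
  · set c : ℝ := K / 2 + (2 * K) ^ 2 / 2
    have hbound : ∀ᶠ t in 𝓝[≠] (0 : ℝ), ∫⁻ z, ENNReal.ofReal
        (((√(max (1 + t * a z + t ^ 2 * r z) 0) - √(max (1 + 0 * a z + 0 ^ 2 * r z) 0)) / t -
          s z / 2 * √(max (1 + 0 * a z + 0 ^ 2 * r z) 0)) ^ 2) ∂(obs θ₀) ≤
        ENNReal.ofReal ((|t| * c) ^ 2) := by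
      have hev : ∀ᶠ t in 𝓝[≠] (0 : ℝ), |t| < 1 ∧ |t| * (2 * K) < 1 := by
        refine Filter.Eventually.filter_mono nhdsWithin_le_nhds ?_
        have h1 : Tendsto (fun t : ℝ => |t|) (𝓝 0) (𝓝 0) := by
          simpa using continuous_abs.tendsto (0 : ℝ)
        have h2 : Tendsto (fun t : ℝ => |t| * (2 * K)) (𝓝 0) (𝓝 0) := by
          simpa using h1.mul_const (2 * K)
        exact (h1.eventually (gt_mem_nhds one_pos)).and (h2.eventually (gt_mem_nhds one_pos))
      filter_upwards [hev, self_mem_nhdsWithin] with t ht ht0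
      have ht0' : t ≠ 0 := ht0
      have htp : 0 < |t| := abs_pos.2 ht0'
      calc _ ≤ ∫⁻ _, ENNReal.ofReal ((|t| * c) ^ 2) ∂(obs θ₀) := by
            refine lintegral_mono_ae ?_
            filter_upwards [hs] with z hz
            refine ENNReal.ofReal_le_ofReal ?_
            set x := t * a z + t ^ 2 * r z with hx
            have hxb : |x| ≤ |t| * (2 * K) := by
              calc |x| ≤ |t| * |a z| + |t| ^ 2 * |r z| := by
                    rw [hx, ← abs_pow, ← abs_mul, ← abs_mul]; exact abs_add_le _ _
                _ ≤ |t| * K + |t| * K := by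
                    have h1 := mul_le_mul_of_nonneg_left (haK z) htp.le
                    have h2 := mul_le_mul_of_nonneg_left (hrK z) htp.le
                    have h3 := mul_le_mul_of_nonneg_right ht.1.le
                      (mul_nonneg htp.le (abs_nonneg (r z)))
                    nlinarith
                _ = _ := by ring
            have hx1 : 0 ≤ 1 + x := by linarith [neg_abs_le x, ht.2]
            have h1 : max (1 + t * a z + t ^ 2 * r z) 0 = 1 + x := by
              rw [hx, add_assoc, max_eq_left (by rw [← hx]; exact hx1)]
            have h2 : max (1 + 0 * a z + 0 ^ 2 * r z) 0 = 1 := by simp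
            rw [h1, h2, Real.sqrt_one, mul_one, hz]
            have h3 := abs_sqrt_one_add_sub_le hx1
            have h4 : (√(1 + x) - 1) / t - a z / 2 =
                (√(1 + x) - 1 - x / 2) / t + t * r z / 2 := by
              rw [hx]
              field_simp
              ring
            rw [h4]
            refine sq_le_sq.2 ((?_ : _ ≤ |t| * c).trans (le_abs_self _))
            · have h5 : |(√(1 + x) - 1 - x / 2) / t + t * r z / 2| ≤ |t| * c := by
                refine (abs_add_le _ _).trans ?_
                rw [abs_div, abs_div, abs_mul, abs_two]
                have h6 : |√(1 + x) - 1 - x / 2| / |t| ≤ |t| * ((2 * K) ^ 2 / 2) := by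
                  rw [div_le_iff₀ htp]
                  refine h3.trans ?_
                  have := pow_le_pow_left₀ (abs_nonneg x) hxb 2
                  rw [sq_abs] at this
                  nlinarith
                have h7 := mul_le_mul_of_nonneg_left (hrK z) htp.le
                have h8 : |t| * c = |t| * K / 2 + |t| * ((2 * K) ^ 2 / 2) := by
                  simp only [c]; ring
                rw [h8]
                linarith
              exact h5
        _ = ENNReal.ofReal ((|t| * c) ^ 2) := by simp
    have hlim : Tendsto (fun t : ℝ => ENNReal.ofReal ((|t| * c) ^ 2)) (𝓝[≠] 0) (𝓝 0) := by
      have h1 : Tendsto (fun t : ℝ => ENNReal.ofReal ((|t| * c) ^ 2)) (𝓝 0)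
          (𝓝 (ENNReal.ofReal ((|(0 : ℝ)| * c) ^ 2))) :=
        (ENNReal.continuous_ofReal.comp
          (by fun_prop : Continuous fun t : ℝ => (|t| * c) ^ 2)).tendsto 0
      simp only [abs_zero, zero_mul, ne_eq, OfNat.ofNat_ne_zero, not_false_eq_true, zero_pow,
        ENNReal.ofReal_zero] at h1
      exact h1.mono_left nhdsWithin_le_nhds
    exact tendsto_of_tendsto_of_tendsto_of_le_of_le' tendsto_const_nhds hlim
      (Eventually.of_forall fun _ => zero_le) hbound

end Semiparametric

/-! ## Integrals with respect to the laws of a population -/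

noncomputable section

namespace Population

variable {𝓑 𝓧 : Type*} [MeasurableSpace 𝓑] [MeasurableSpace 𝓧]

instance (F : Population 𝓑 𝓧) : IsProbabilityMeasure F.cov := F.isProbabilityMeasure_cov

instance (F : Population 𝓑 𝓧) : IsMarkovKernel F.bid := F.isMarkovKernel_bid

instance (F : Population 𝓑 𝓧) : IsMarkovKernel F.treatment where
  isProbabilityMeasure x := by
    refine ⟨?_⟩
    change (ENNReal.ofReal (F.prop x) • Measure.dirac true +
      ENNReal.ofReal (1 - F.prop x) • Measure.dirac false : Measure Bool) Set.univ = 1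
    simp only [Measure.coe_add, Measure.coe_smul, Pi.add_apply, Pi.smul_apply, measure_univ,
      smul_eq_mul, mul_one]
    rw [← ENNReal.ofReal_add (F.prop_pos x).le (by linarith [F.prop_lt_one x])]
    simp

instance (F : Population 𝓑 𝓧) : IsProbabilityMeasure F.fullLaw := by
  unfold fullLaw; infer_instance

instance (F : Population 𝓑 𝓧) : IsProbabilityMeasure F.obsLaw :=
  Measure.isProbabilityMeasure_map measurable_observe.aemeasurable

instance (F : Population 𝓑 𝓧) (w : Bool) : IsProbabilityMeasure (F.potLaw w) :=
  Measure.isProbabilityMeasure_map (measurable_pi_apply w).aemeasurable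

variable (F : Population 𝓑 𝓧)

theorem armProb_pos (w : Bool) (x : 𝓧) : 0 < F.armProb w x := by
  cases w
  · simpa [armProb] using F.prop_lt_one x
  · simpa [armProb] using F.prop_pos x

theorem armProb_lt_one (w : Bool) (x : 𝓧) : F.armProb w x < 1 := by
  cases w
  · simpa [armProb] using F.prop_pos x
  · simpa [armProb] using F.prop_lt_one x

theorem measurable_armProb (w : Bool) : Measurable (F.armProb w) := by
  cases w
  · exact measurable_const.sub F.measurable_prop
  · exact F.measurable_prop

/-- `E[h(B(w)) | X = x]`. -/
def condMean (w : Bool) (h : 𝓑 → ℝ) (x : 𝓧) : ℝ := ∫ b, h (b w) ∂(F.bid x)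

variable {F} {w : Bool} {h : 𝓑 → ℝ} {K : ℝ}

theorem measurable_condMean (hh : Measurable h) : Measurable (F.condMean w h) :=
  ((hh.comp (measurable_pi_apply w)).stronglyMeasurable.integral_kernel).measurable

theorem integrable_bid (hh : Measurable h) (hK : ∀ b, |h b| ≤ K) (x : 𝓧) :
    Integrable (fun b : Bool → 𝓑 => h (b w)) (F.bid x) :=
  Integrable.of_bound (hh.comp (measurable_pi_apply w)).aestronglyMeasurable K
    (Eventually.of_forall fun b => hK (b w))

theorem abs_condMean_le (hK : ∀ b, |h b| ≤ K) (x : 𝓧) : |F.condMean w h x| ≤ K := by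
  have := norm_integral_le_of_norm_le_const (μ := F.bid x) (f := fun b => h (b w))
    (Eventually.of_forall fun b => hK (b w))
  simpa [condMean] using this

theorem sq_condMean_le (hh : Measurable h) (hK : ∀ b, |h b| ≤ K) (x : 𝓧) :
    F.condMean w h x ^ 2 ≤ F.condMean w (fun b => h b ^ 2) x := by
  have h1 : MemLp (fun b : Bool → 𝓑 => h (b w)) 2 (F.bid x) :=
    MemLp.of_bound (hh.comp (measurable_pi_apply w)).aestronglyMeasurable K
      (Eventually.of_forall fun b => hK (b w))
  simpa [condMean] using Semiparametric.sq_integral_mul_le h1 (memLp_const (1 : ℝ))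

theorem lintegral_potLaw {f : 𝓑 → ENNReal} (hf : Measurable f) :
    ∫⁻ b, f b ∂(F.potLaw w) = ∫⁻ x, ∫⁻ b, f (b w) ∂(F.bid x) ∂F.cov := by
  rw [potLaw, lintegral_map hf (measurable_pi_apply w),
    Measure.lintegral_bind (f := fun b : Bool → 𝓑 => f (b w)) (Kernel.aemeasurable _)
      (hf.comp (measurable_pi_apply w)).aemeasurable]

theorem integral_potLaw (hh : Measurable h) (hK : ∀ b, |h b| ≤ K) :
    ∫ b, h b ∂(F.potLaw w) = ∫ x, F.condMean w h x ∂F.cov := by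
  rw [potLaw, integral_map (measurable_pi_apply w).aemeasurable hh.aestronglyMeasurable]
  have hm : Measurable fun b : Bool → 𝓑 => h (b w) := hh.comp (measurable_pi_apply w)
  rw [← Measure.snd_compProd, Measure.snd,
    integral_map measurable_snd.aemeasurable hm.aestronglyMeasurable,
    Measure.integral_compProd (f := fun q : 𝓧 × (Bool → 𝓑) => h (q.2 w))
    (Integrable.of_bound (hm.comp measurable_snd).aestronglyMeasurable K
      (Eventually.of_forall fun q => hK (q.2 w)))]
  rfl

/-- Unconfoundedness enters here: given X the treatment is independent of the potential submissions,
so arm w shows B(w) under its full conditional law, weighted by the treatment probability. -/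
theorem lintegral_obsLaw {f : 𝓑 × Bool × 𝓧 → ENNReal} (hf : Measurable f) :
    ∫⁻ z, f z ∂F.obsLaw = ∫⁻ x, (ENNReal.ofReal (F.armProb true x) *
        ∫⁻ b, f (b true, true, x) ∂(F.bid x) + ENNReal.ofReal (F.armProb false x) *
        ∫⁻ b, f (b false, false, x) ∂(F.bid x)) ∂F.cov := by
  rw [obsLaw, lintegral_map hf measurable_observe, fullLaw,
    Measure.lintegral_compProd (f := fun ω => f (observe ω)) (hf.comp measurable_observe)]
  refine lintegral_congr fun x => ?_
  have hm : Measurable fun q : (Bool → 𝓑) × Bool => f (observe (x, q)) :=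
    (hf.comp measurable_observe).comp measurable_prodMk_left
  rw [Kernel.prod_apply, lintegral_prod_symm (f := fun q => f (observe (x, q))) hm.aemeasurable]
  change ∫⁻ w, ∫⁻ b, f (observe (x, b, w)) ∂(F.bid x) ∂(ENNReal.ofReal (F.prop x) •
    Measure.dirac true + ENNReal.ofReal (1 - F.prop x) • Measure.dirac false : Measure Bool) = _
  rw [lintegral_add_measure, lintegral_smul_measure, lintegral_smul_measure, lintegral_dirac,
    lintegral_dirac]
  simp [observe, armProb]

theorem integral_obsLaw {f : 𝓑 × Bool × 𝓧 → ℝ} (hf : Measurable f) (hK : ∀ z, |f z| ≤ K) :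
    ∫ z, f z ∂F.obsLaw = ∫ x, (F.armProb true x * ∫ b, f (b true, true, x) ∂(F.bid x) +
      F.armProb false x * ∫ b, f (b false, false, x) ∂(F.bid x)) ∂F.cov := by
  rw [obsLaw, integral_map measurable_observe.aemeasurable hf.aestronglyMeasurable, fullLaw,
    Measure.integral_compProd (f := fun ω => f (observe ω)) (Integrable.of_bound
      (hf.comp measurable_observe).aestronglyMeasurable K (Eventually.of_forall fun z => hK _))]
  refine integral_congr_ae (Eventually.of_forall fun x => ?_)
  have hm : Measurable fun q : (Bool → 𝓑) × Bool => f (observe (x, q)) :=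
    (hf.comp measurable_observe).comp measurable_prodMk_left
  simp only
  rw [Kernel.prod_apply, integral_prod_symm (f := fun q => f (observe (x, q)))
    (Integrable.of_bound hm.aestronglyMeasurable K
    (Eventually.of_forall fun z => hK _))]
  change ∫ w, ∫ b, f (observe (x, b, w)) ∂(F.bid x) ∂(ENNReal.ofReal (F.prop x) •
    Measure.dirac true + ENNReal.ofReal (1 - F.prop x) • Measure.dirac false : Measure Bool) = _
  have hi : ∀ ν : Measure Bool, IsFiniteMeasure ν → Integrable
      (fun w => ∫ b, f (observe (x, b, w)) ∂(F.bid x)) ν := fun ν _ => Integrable.of_finite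
  rw [integral_add_measure (hi _ (Measure.smul_finite _ ENNReal.ofReal_ne_top))
    (hi _ (Measure.smul_finite _ ENNReal.ofReal_ne_top)), integral_smul_measure,
    integral_smul_measure, integral_dirac, integral_dirac,
    ENNReal.toReal_ofReal (F.prop_pos x).le,
    ENNReal.toReal_ofReal (by linarith [F.prop_lt_one x])]
  simp [observe, armProb]

theorem map_obsLaw_covariate : F.obsLaw.map (fun z => z.2.2) = F.cov := by
  rw [obsLaw, Measure.map_map (by fun_prop) measurable_observe]
  have : (fun z : 𝓑 × Bool × 𝓧 => z.2.2) ∘ observe = Prod.fst := rfl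
  rw [this]
  exact Measure.fst_compProd F.cov (F.bid.prod F.treatment)

theorem integral_obsLaw_covariate {a : 𝓧 → ℝ} (ha : Measurable a) :
    ∫ z, a z.2.2 ∂F.obsLaw = ∫ x, a x ∂F.cov := by
  rw [← map_obsLaw_covariate (F := F),
    integral_map (by fun_prop) ha.aestronglyMeasurable]

theorem integral_obsLaw_arm {k : 𝓑 → 𝓧 → ℝ} (hk : Measurable (Function.uncurry k))
    (hK : ∀ b x, |k b x| ≤ K) :
    ∫ z, (if z.2.1 = w then k z.1 z.2.2 else 0) ∂F.obsLaw =
      ∫ x, F.armProb w x * ∫ b, k (b w) x ∂(F.bid x) ∂F.cov := by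
  have hm : Measurable fun z : 𝓑 × Bool × 𝓧 => if z.2.1 = w then k z.1 z.2.2 else 0 :=
    Measurable.ite (measurableSet_eq_fun (by fun_prop) measurable_const)
      (hk.comp (measurable_fst.prodMk measurable_snd.snd)) measurable_const
  rw [integral_obsLaw hm (K := K) fun z => ?_]
  · cases w <;> simp
  · split_ifs
    · exact hK _ _
    · simpa using (abs_nonneg _).trans (hK z.1 z.2.2)

end Population

end

/-! ## Doubly robust scores -/

noncomputable section

namespace Semiparametric

variable {Z : Type*} [MeasurableSpace Z]

/-- The measures `P` and `Q` are as close for bounded test functions as measures whose squared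
Hellinger distance is of order `c`. -/
def HellingerLe (P Q : Measure Z) (c : ℝ) : Prop :=
  ∀ (g : Z → ℝ) (K : ℝ), Measurable g → (∀ z, |g z| ≤ K) →
    (∫ z, g z ∂P - ∫ z, g z ∂Q) ^ 2 ≤ c * (∫ z, g z ^ 2 ∂P + ∫ z, g z ^ 2 ∂Q)

/-- A self-bounding argument. In the application e is a squared nuisance error and g a test function
detecting it: centred under Q, with mean A = ∫ e dP under P. With A₀ = ∫ e dQ, both A² and (A - A₀)²
are at most c k (A + A₀). Since A + A₀ = 2A - (A - A₀), its square is at most (8 + 2) c k (A + A₀).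
The error e is thus of order c, not √c. -/
theorem HellingerLe.integral_le {P Q : Measure Z} [IsProbabilityMeasure P] [IsProbabilityMeasure Q]
    {c : ℝ} (h : HellingerLe P Q c) (hc : 0 ≤ c) {g e : Z → ℝ} {K k : ℝ} (hg : Measurable g)
    (he : Measurable e) (hgK : ∀ z, |g z| ≤ K) (heK : ∀ z, |e z| ≤ K) (he0 : ∀ z, 0 ≤ e z)
    (hgP : ∫ z, g z ∂P = ∫ z, e z ∂P) (hgQ : ∫ z, g z ∂Q = 0) (hge : ∀ z, g z ^ 2 ≤ k * e z)
    (hee : ∀ z, e z ^ 2 ≤ k * e z) (hk : 0 ≤ k) : ∫ z, e z ∂P ≤ 10 * c * k := by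
  have hei : ∀ μ : Measure Z, IsProbabilityMeasure μ → Integrable e μ := fun μ _ =>
    Integrable.of_bound he.aestronglyMeasurable K (Eventually.of_forall heK)
  have hsq : ∀ μ : Measure Z, IsProbabilityMeasure μ → ∀ f : Z → ℝ, Measurable f →
      (∀ z, |f z| ≤ K) → (∀ z, f z ^ 2 ≤ k * e z) → ∫ z, f z ^ 2 ∂μ ≤ k * ∫ z, e z ∂μ := by
    intro μ hμ f hf hfK hfe
    rw [← integral_const_mul]
    refine integral_mono ?_ ((hei μ hμ).const_mul k) hfe
    refine Integrable.of_bound (hf.pow_const 2).aestronglyMeasurable (K ^ 2)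
      (Eventually.of_forall fun z => ?_)
    rw [norm_pow]
    exact pow_le_pow_left₀ (norm_nonneg _) (hfK z) 2
  have h1 := h g K hg hgK
  have h2 := h e K he heK
  rw [hgP, hgQ, sub_zero] at h1
  have h3 := hsq P inferInstance g hg hgK hge
  have h4 := hsq Q inferInstance g hg hgK hge
  have h5 := hsq P inferInstance e he heK hee
  have h6 := hsq Q inferInstance e he heK hee
  have hA : 0 ≤ ∫ z, e z ∂P := integral_nonneg he0
  have hA0 : 0 ≤ ∫ z, e z ∂Q := integral_nonneg he0
  set A := ∫ z, e z ∂P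
  set A₀ := ∫ z, e z ∂Q
  have h9 : (A + A₀) ^ 2 ≤ 10 * c * k * (A + A₀) := by
    nlinarith [sq_nonneg (A + A + (A - A₀))]
  rcases (add_nonneg hA hA0).eq_or_lt with h0 | h0
  · have : A = 0 := by linarith
    rw [this]; positivity
  · have : A + A₀ ≤ 10 * c * k := by
      by_contra hcon
      push Not at hcon
      nlinarith
    linarith

end Semiparametric

namespace Population

open Semiparametric

variable {𝓑 𝓧 : Type*} [MeasurableSpace 𝓑] [MeasurableSpace 𝓧]

/-- The doubly robust score for `E[h(B(w))]`, with propensities `π`. -/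
def doublyRobust (F : Population 𝓑 𝓧) (π : 𝓧 → ℝ) (w : Bool) (h : 𝓑 → ℝ) (z : 𝓑 × Bool × 𝓧) : ℝ :=
  F.condMean w h z.2.2 + if z.2.1 = w then (π z.2.2)⁻¹ * (h z.1 - F.condMean w h z.2.2) else 0

variable {F F₀ : Population 𝓑 𝓧} {π : 𝓧 → ℝ} {w : Bool} {h : 𝓑 → ℝ} {K κ : ℝ}

theorem measurable_doublyRobust (hπ : Measurable π) (hh : Measurable h) :
    Measurable (F.doublyRobust π w h) := by
  have hm := measurable_condMean (F := F) (w := w) hh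
  refine (hm.comp measurable_snd.snd).add (Measurable.ite
    (measurableSet_eq_fun measurable_snd.fst measurable_const) ?_ measurable_const)
  exact (hπ.comp measurable_snd.snd).inv.mul
    ((hh.comp measurable_fst).sub (hm.comp measurable_snd.snd))

theorem abs_sub_condMean_le (hK : ∀ b, |h b| ≤ K) (b : 𝓑) (x : 𝓧) :
    |h b - F.condMean w h x| ≤ 2 * K := by
  have := abs_sub (h b) (F.condMean w h x)
  linarith [hK b, abs_condMean_le (F := F) (w := w) hK x]

theorem abs_doublyRobust_le (hκ : 0 < κ) (hπκ : ∀ x, κ ≤ π x) (hK : ∀ b, |h b| ≤ K)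
    (z : 𝓑 × Bool × 𝓧) : |F.doublyRobust π w h z| ≤ K * (1 + 2 * κ⁻¹) := by
  have h1 := abs_condMean_le (F := F) (w := w) hK z.2.2
  have h2 := abs_sub_condMean_le (F := F) (w := w) hK z.1 z.2.2
  have hK0 : 0 ≤ K := (abs_nonneg _).trans h1
  have h3 : (π z.2.2)⁻¹ ≤ κ⁻¹ := inv_anti₀ hκ (hπκ _)
  have h4 : 0 ≤ (π z.2.2)⁻¹ := inv_nonneg.2 (hκ.le.trans (hπκ _))
  have h5 : 0 ≤ κ⁻¹ := inv_nonneg.2 hκ.le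
  unfold doublyRobust
  refine (abs_add_le _ _).trans ?_
  split_ifs
  · rw [abs_mul, abs_of_nonneg h4]
    have := mul_le_mul h3 h2 (abs_nonneg _) h5
    linarith
  · rw [abs_zero]
    have := mul_nonneg hK0 h5
    linarith

theorem integral_doublyRobust (hκ : 0 < κ) (hπ : Measurable π) (hπκ : ∀ x, κ ≤ π x)
    (hh : Measurable h) (hK : ∀ b, |h b| ≤ K) :
    ∫ z, F₀.doublyRobust π w h z ∂F.obsLaw = ∫ x, (F₀.condMean w h x +
      F.armProb w x * ((π x)⁻¹ * (F.condMean w h x - F₀.condMean w h x))) ∂F.cov := by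
  have hm₀ := measurable_condMean (F := F₀) (w := w) hh
  have hm := measurable_condMean (F := F) (w := w) hh
  have hk : Measurable (Function.uncurry fun (b : 𝓑) (x : 𝓧) =>
      (π x)⁻¹ * (h b - F₀.condMean w h x)) :=
    (hπ.comp measurable_snd).inv.mul ((hh.comp measurable_fst).sub (hm₀.comp measurable_snd))
  have hinv : ∀ x, |(π x)⁻¹| ≤ κ⁻¹ := fun x => by
    rw [abs_of_nonneg (inv_nonneg.2 (hκ.le.trans (hπκ x)))]
    exact inv_anti₀ hκ (hπκ x)
  have hkb : ∀ (G : Population 𝓑 𝓧) (b : 𝓑) (x : 𝓧),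
      |(π x)⁻¹ * (h b - G.condMean w h x)| ≤ κ⁻¹ * (2 * K) := fun G b x => by
    rw [abs_mul]
    exact mul_le_mul (hinv x) (abs_sub_condMean_le hK b x) (abs_nonneg _) (by positivity)
  have hi1 : Integrable (fun z : 𝓑 × Bool × 𝓧 => F₀.condMean w h z.2.2) F.obsLaw :=
    Integrable.of_bound (hm₀.comp measurable_snd.snd).aestronglyMeasurable K
      (Eventually.of_forall fun z => abs_condMean_le hK _)
  have hi2 : Integrable (fun z : 𝓑 × Bool × 𝓧 => if z.2.1 = w then
      (π z.2.2)⁻¹ * (h z.1 - F₀.condMean w h z.2.2) else 0) F.obsLaw := by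
    refine Integrable.of_bound (Measurable.aestronglyMeasurable ?_) (κ⁻¹ * (2 * K))
      (Eventually.of_forall fun z => ?_)
    · exact Measurable.ite (measurableSet_eq_fun measurable_snd.fst measurable_const)
        (hk.comp (measurable_fst.prodMk measurable_snd.snd)) measurable_const
    · split_ifs
      · exact hkb F₀ _ _
      · simpa using (abs_nonneg _).trans (hkb F₀ z.1 z.2.2)
  have hi3 : Integrable (fun x => F₀.condMean w h x) F.cov :=
    Integrable.of_bound hm₀.aestronglyMeasurable K
      (Eventually.of_forall fun x => abs_condMean_le hK _)
  have hi4 : Integrable (fun x => F.armProb w x *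
      ((π x)⁻¹ * (F.condMean w h x - F₀.condMean w h x))) F.cov := by
    refine Integrable.of_bound ((F.measurable_armProb w).mul
      (hπ.inv.mul (hm.sub hm₀))).aestronglyMeasurable (1 * (κ⁻¹ * (K + K)))
      (Eventually.of_forall fun x => ?_)
    rw [Real.norm_eq_abs, abs_mul, abs_mul, abs_of_pos (F.armProb_pos w x)]
    have h1 := abs_sub (F.condMean w h x) (F₀.condMean w h x)
    have h2 := abs_condMean_le (F := F) (w := w) hK x
    have h3 := abs_condMean_le (F := F₀) (w := w) hK x
    exact mul_le_mul (F.armProb_lt_one w x).le (mul_le_mul (hinv x) (by linarith) (abs_nonneg _)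
      (by positivity)) (by positivity) zero_le_one
  unfold doublyRobust
  rw [integral_add hi1 hi2, integral_obsLaw_covariate hm₀,
    integral_obsLaw_arm (k := fun b x => (π x)⁻¹ * (h b - F₀.condMean w h x)) hk (hkb F₀),
    integral_add hi3 hi4]
  congr 1
  refine integral_congr_ae (Eventually.of_forall fun x => ?_)
  simp only
  rw [integral_const_mul, integral_sub (integrable_bid hh hK x) (integrable_const _)]
  simp [condMean]

theorem integral_doublyRobust_self (hκ : 0 < κ) (hπ : Measurable π) (hπκ : ∀ x, κ ≤ π x)
    (hh : Measurable h) (hK : ∀ b, |h b| ≤ K) :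
    ∫ z, F.doublyRobust π w h z ∂F.obsLaw = ∫ b, h b ∂F.potLaw w := by
  rw [integral_doublyRobust hκ hπ hπκ hh hK, integral_potLaw hh hK]
  simp

/-- The doubly robust score is an `L²` bounded function of `h`. -/
theorem integral_sq_doublyRobust_le (hκ : 0 < κ) (hπ : Measurable π) (hπκ : ∀ x, κ ≤ π x)
    (hh : Measurable h) (hK : ∀ b, |h b| ≤ K) :
    ∫ z, F.doublyRobust π w h z ^ 2 ∂F.obsLaw ≤
      (2 + 8 * κ⁻¹ ^ 2) * ∫ b, h b ^ 2 ∂F.potLaw w := by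
  have hh2 : Measurable fun b => h b ^ 2 := hh.pow_const 2
  have hK2 : ∀ b, |h b ^ 2| ≤ K ^ 2 := fun b => by
    rw [abs_pow]; exact pow_le_pow_left₀ (abs_nonneg _) (hK b) 2
  set m2 := F.condMean w fun b => h b ^ 2 with hm2
  have hm2m : Measurable m2 := measurable_condMean hh2
  have hm20 : ∀ x, 0 ≤ m2 x := fun x => integral_nonneg fun b => sq_nonneg _
  have hm2K : ∀ x, |m2 x| ≤ K ^ 2 := abs_condMean_le hK2
  have hdrm := measurable_doublyRobust (F := F) (w := w) hπ hh
  have hdrb := abs_doublyRobust_le (F := F) (w := w) hκ hπκ hK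
  have hk : Measurable (Function.uncurry fun (b : 𝓑) (_ : 𝓧) => h b ^ 2) :=
    hh2.comp measurable_fst
  have hi1 : Integrable (fun z : 𝓑 × Bool × 𝓧 => (2 + 4 * κ⁻¹ ^ 2) * m2 z.2.2) F.obsLaw :=
    (Integrable.of_bound (hm2m.comp measurable_snd.snd).aestronglyMeasurable (K ^ 2)
      (Eventually.of_forall fun z => hm2K _)).const_mul _
  have hi2 : Integrable (fun z : 𝓑 × Bool × 𝓧 => (4 * κ⁻¹ ^ 2) *
      if z.2.1 = w then h z.1 ^ 2 else 0) F.obsLaw := by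
    refine Integrable.const_mul (Integrable.of_bound (Measurable.aestronglyMeasurable ?_) (K ^ 2)
      (Eventually.of_forall fun z => ?_)) _
    · exact Measurable.ite (measurableSet_eq_fun measurable_snd.fst measurable_const)
        (hh2.comp measurable_fst) measurable_const
    · split_ifs
      · exact hK2 _
      · simpa using sq_nonneg K
  -- Conditional Jensen replaces the squared regression by the conditional mean of h², leaving only
  -- terms whose means are controlled by E[h(B(w))²].
  have hbound : ∀ z, F.doublyRobust π w h z ^ 2 ≤ (2 + 4 * κ⁻¹ ^ 2) * m2 z.2.2 +
      (4 * κ⁻¹ ^ 2) * if z.2.1 = w then h z.1 ^ 2 else 0 := by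
    intro z
    have h1 : F.condMean w h z.2.2 ^ 2 ≤ m2 z.2.2 := sq_condMean_le hh hK _
    have h3 : (π z.2.2)⁻¹ ≤ κ⁻¹ := inv_anti₀ hκ (hπκ _)
    have h4 : 0 ≤ (π z.2.2)⁻¹ := inv_nonneg.2 (hκ.le.trans (hπκ _))
    have h5 : (π z.2.2)⁻¹ ^ 2 ≤ κ⁻¹ ^ 2 := pow_le_pow_left₀ h4 h3 2
    unfold doublyRobust
    set m := F.condMean w h z.2.2
    set p := (π z.2.2)⁻¹
    split_ifs
    · calc (m + p * (h z.1 - m)) ^ 2 ≤ 2 * m ^ 2 + 2 * (p ^ 2 * (h z.1 - m) ^ 2) := by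
            nlinarith [sq_nonneg (m - p * (h z.1 - m))]
        _ ≤ 2 * m ^ 2 + 2 * (κ⁻¹ ^ 2 * (2 * h z.1 ^ 2 + 2 * m ^ 2)) := by
            have : (h z.1 - m) ^ 2 ≤ 2 * h z.1 ^ 2 + 2 * m ^ 2 := by
              nlinarith [sq_nonneg (h z.1 + m)]
            have := mul_le_mul h5 this (sq_nonneg _) (sq_nonneg _)
            linarith
        _ ≤ _ := by
            have := mul_le_mul_of_nonneg_left h1 (by positivity : 0 ≤ 2 + 4 * κ⁻¹ ^ 2)
            linarith
    · have := mul_le_mul_of_nonneg_left h1 (by positivity : 0 ≤ 2 + 4 * κ⁻¹ ^ 2)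
      nlinarith [sq_nonneg m, mul_nonneg (sq_nonneg κ⁻¹) (sq_nonneg m)]
  have hmono : ∫ z, F.doublyRobust π w h z ^ 2 ∂F.obsLaw ≤
      ∫ z, ((2 + 4 * κ⁻¹ ^ 2) * m2 z.2.2 +
        (4 * κ⁻¹ ^ 2) * if z.2.1 = w then h z.1 ^ 2 else 0) ∂F.obsLaw := by
    refine integral_mono (Integrable.of_bound (hdrm.pow_const 2).aestronglyMeasurable
      ((K * (1 + 2 * κ⁻¹)) ^ 2) (Eventually.of_forall fun z => ?_)) (hi1.add hi2) hbound
    rw [norm_pow]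
    exact pow_le_pow_left₀ (norm_nonneg _) (hdrb z) 2
  refine hmono.trans ?_
  rw [integral_add hi1 hi2, integral_const_mul, integral_const_mul, integral_obsLaw_covariate hm2m,
    integral_obsLaw_arm (k := fun b _ => h b ^ 2) hk (fun b _ => hK2 b), integral_potLaw hh2 hK2]
  have h6 : ∫ x, F.armProb w x * ∫ b, h (b w) ^ 2 ∂(F.bid x) ∂F.cov ≤ ∫ x, m2 x ∂F.cov := by
    refine integral_mono ?_ ?_ fun x => ?_
    · refine Integrable.of_bound ((F.measurable_armProb w).mul hm2m).aestronglyMeasurable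
        (1 * K ^ 2) (Eventually.of_forall fun x => ?_)
      rw [norm_mul, Real.norm_of_nonneg (F.armProb_pos w x).le]
      exact mul_le_mul (F.armProb_lt_one w x).le (hm2K x) (norm_nonneg _) zero_le_one
    · exact Integrable.of_bound hm2m.aestronglyMeasurable (K ^ 2) (Eventually.of_forall hm2K)
    · exact mul_le_of_le_one_left (hm20 x) (F.armProb_lt_one w x).le
  have h7 := mul_le_mul_of_nonneg_left h6 (by positivity : 0 ≤ 4 * κ⁻¹ ^ 2)
  linarith

/-- The bias of the doubly robust score is quadratic in the Hellinger distance. -/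
theorem abs_integral_potLaw_sub_doublyRobust_le {c : ℝ} (hc : 0 ≤ c)
    (hHel : HellingerLe F.obsLaw F₀.obsLaw c) (hκ : 0 < κ) (hπ : Measurable π)
    (hπκ : ∀ x, κ ≤ π x) (hπ1 : ∀ x, π x ≤ 1) (hπ₀ : π =ᵐ[F₀.cov] F₀.armProb w)
    (hh : Measurable h) (hK0 : 0 < K) (hK : ∀ b, |h b| ≤ K) :
    |∫ b, h b ∂F.potLaw w - ∫ z, F₀.doublyRobust π w h z ∂F.obsLaw| ≤
      κ⁻¹ * (1 + κ⁻¹ + 4 * K * κ⁻¹) * (10 + 10 * (4 * K ^ 2)) * c := by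
  have hm₀ := measurable_condMean (F := F₀) (w := w) hh
  have hm := measurable_condMean (F := F) (w := w) hh
  have hp := F.measurable_armProb w
  have hp0 := F.armProb_pos w
  have hp1 := F.armProb_lt_one w
  set p := F.armProb w with hpdef
  set m := F.condMean w h with hmdef
  set m₀ := F₀.condMean w h with hm₀def
  set a : 𝓧 → ℝ := fun x => p x - π x with ha
  set v : 𝓧 → ℝ := fun x => m x - m₀ x with hv
  have ham : Measurable a := hp.sub hπ
  have hvm : Measurable v := hm.sub hm₀
  have hab : ∀ x, |a x| ≤ 1 := fun x => by
    rw [abs_le]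
    constructor <;> simp only [ha] <;> linarith [hp0 x, hp1 x, hπκ x, hπ1 x]
  have hvb : ∀ x, |v x| ≤ 2 * K := fun x => by
    have h1 := abs_sub (m x) (m₀ x)
    have h2 : |m x| ≤ K := abs_condMean_le hK x
    have h3 : |m₀ x| ≤ K := abs_condMean_le hK x
    simp only [hv]; linarith
  have ha2 : ∀ x, a x ^ 2 ≤ 1 := fun x => (sq_le_one_iff_abs_le_one _).2 (hab x)
  have hv2 : ∀ x, v x ^ 2 ≤ 4 * K ^ 2 := fun x => by
    have := sq_le_sq' (abs_le.1 (hvb x)).1 (abs_le.1 (hvb x)).2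
    linarith
  have hind : ∀ k : 𝓑 → 𝓧 → ℝ, Measurable (Function.uncurry k) →
      Measurable fun z : 𝓑 × Bool × 𝓧 => if z.2.1 = w then k z.1 z.2.2 else 0 := fun k hk =>
    Measurable.ite (measurableSet_eq_fun measurable_snd.fst measurable_const)
      (hk.comp (measurable_fst.prodMk measurable_snd.snd)) measurable_const
  -- propensities
  have hA : ∫ x, a x ^ 2 ∂F.cov ≤ 10 * c * 1 := by
    have hg1 : Measurable fun z : 𝓑 × Bool × 𝓧 => if z.2.1 = w then a z.2.2 else 0 :=
      hind (fun _ x => a x) (ham.comp measurable_snd)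
    have hpa : Measurable fun x => π x * a x := hπ.mul ham
    have hpab : ∀ x, |π x * a x| ≤ 1 := fun x => by
      rw [abs_mul, abs_of_pos (hκ.trans_le (hπκ x))]
      exact mul_le_one₀ (hπ1 x) (abs_nonneg _) (hab x)
    have hval : ∀ G : Population 𝓑 𝓧, ∫ z, ((if z.2.1 = w then a z.2.2 else 0) -
        π z.2.2 * a z.2.2) ∂G.obsLaw = ∫ x, (G.armProb w x - π x) * a x ∂G.cov := by
      intro G
      have hpi : Integrable (fun z : 𝓑 × Bool × 𝓧 => π z.2.2 * a z.2.2) G.obsLaw :=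
        Integrable.of_bound (hpa.comp measurable_snd.snd).aestronglyMeasurable 1
          (Eventually.of_forall fun z => hpab _)
      rw [integral_sub (Integrable.of_bound hg1.aestronglyMeasurable 1
          (Eventually.of_forall fun z => by split_ifs <;> simp [hab]))
        hpi,
        integral_obsLaw_arm (k := fun _ x => a x) (ham.comp measurable_snd) (fun _ x => hab x),
        integral_obsLaw_covariate hpa, ← integral_sub]
      · refine integral_congr_ae (Eventually.of_forall fun x => ?_)
        simp [sub_mul]
      · refine Integrable.of_bound ((G.measurable_armProb w).mul
          (by simpa using ham)).aestronglyMeasurable (1 * 1) (Eventually.of_forall fun x => ?_)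
        rw [norm_mul, Real.norm_of_nonneg (G.armProb_pos w x).le]
        exact mul_le_mul (G.armProb_lt_one w x).le (by simpa using hab x) (norm_nonneg _) zero_le_one
      · exact Integrable.of_bound hpa.aestronglyMeasurable 1 (Eventually.of_forall hpab)
    rw [← integral_obsLaw_covariate (F := F) (ham.pow_const 2)]
    refine hHel.integral_le hc (K := 2) (hg1.sub (hpa.comp measurable_snd.snd))
      ((ham.pow_const 2).comp measurable_snd.snd) ?_ ?_ (fun z => sq_nonneg _) ?_ ?_ ?_ ?_
      zero_le_one
    · intro z
      refine (abs_sub _ _).trans ?_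
      have h1 : |if z.2.1 = w then a z.2.2 else 0| ≤ 1 := by split_ifs <;> simp [hab]
      have := hpab z.2.2
      simp only [Function.comp_apply]
      linarith
    · intro z
      rw [abs_of_nonneg (sq_nonneg _)]
      linarith [ha2 z.2.2]
    · refine (hval F).trans ?_
      rw [integral_obsLaw_covariate (F := F) (ham.pow_const 2)]
      refine integral_congr_ae (Eventually.of_forall fun x => ?_)
      simp only [ha, sq]
      rfl
    · refine (hval F₀).trans ?_
      rw [integral_eq_zero_of_ae]
      filter_upwards [hπ₀] with x hx
      simp [hx]
    · intro z
      have h1 := hκ.trans_le (hπκ z.2.2)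
      have h2 := hπ1 z.2.2
      have h3 : ((if z.2.1 = w then a z.2.2 else 0) - π z.2.2 * a z.2.2) ^ 2 =
          ((if z.2.1 = w then 1 else 0) - π z.2.2) ^ 2 * a z.2.2 ^ 2 := by
        split_ifs <;> ring
      refine (le_of_eq h3).trans (mul_le_mul_of_nonneg_right ?_ (sq_nonneg _))
      rw [sq_le_one_iff_abs_le_one, abs_le]
      split_ifs <;> constructor <;> linarith
    · intro z
      have h1 := ha2 z.2.2
      nlinarith [sq_nonneg (a z.2.2)]
  -- conditional means
  have hD : ∫ x, p x * v x ^ 2 ∂F.cov ≤ 10 * c * (4 * K ^ 2) := by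
    have hk1 : Measurable (Function.uncurry fun (b : 𝓑) (x : 𝓧) => (h b - m₀ x) * v x) :=
      ((hh.comp measurable_fst).sub (hm₀.comp measurable_snd)).mul (hvm.comp measurable_snd)
    have hk1b : ∀ b x, |(h b - m₀ x) * v x| ≤ 4 * K ^ 2 := fun b x => by
      rw [abs_mul]
      have := mul_le_mul (abs_sub_condMean_le (F := F₀) (w := w) hK b x) (hvb x) (abs_nonneg _)
        (by positivity)
      linarith
    have hk2 : Measurable (Function.uncurry fun (_ : 𝓑) (x : 𝓧) => v x ^ 2) :=
      (hvm.pow_const 2).comp measurable_snd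
    have hk2b : ∀ (b : 𝓑) x, |v x ^ 2| ≤ 4 * K ^ 2 := fun b x => by
      rw [abs_of_nonneg (sq_nonneg _)]; exact hv2 x
    have hval : ∀ G : Population 𝓑 𝓧, ∫ z, (if z.2.1 = w then (h z.1 - m₀ z.2.2) * v z.2.2 else 0)
        ∂G.obsLaw = ∫ x, G.armProb w x * ((G.condMean w h x - m₀ x) * v x) ∂G.cov := by
      intro G
      rw [integral_obsLaw_arm hk1 hk1b]
      refine integral_congr_ae (Eventually.of_forall fun x => ?_)
      simp only
      rw [integral_mul_const, integral_sub (integrable_bid hh hK x) (integrable_const _)]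
      simp [condMean]
    have hval2 : ∫ z, (if z.2.1 = w then v z.2.2 ^ 2 else 0) ∂F.obsLaw =
        ∫ x, p x * v x ^ 2 ∂F.cov := by
      rw [integral_obsLaw_arm hk2 hk2b]
      simp [hpdef]
    rw [← hval2]
    refine hHel.integral_le hc (K := 4 * K ^ 2) (hind _ hk1) (hind _ hk2) ?_ ?_ ?_ ?_ ?_ ?_ ?_
      (by positivity)
    · intro z
      split_ifs
      · exact hk1b _ _
      · rw [abs_zero]; positivity
    · intro z
      split_ifs
      · exact hk2b z.1 _
      · rw [abs_zero]; positivity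
    · intro z
      split_ifs
      · exact sq_nonneg _
      · exact le_rfl
    · rw [hval2]
      refine (hval F).trans ?_
      refine integral_congr_ae (Eventually.of_forall fun x => ?_)
      simp only [hv, sq]
      rfl
    · refine (hval F₀).trans ?_
      simp [hm₀def]
    · intro z
      split_ifs
      · rw [mul_pow]
        refine mul_le_mul_of_nonneg_right ?_ (sq_nonneg _)
        have := abs_le.1 (abs_sub_condMean_le (F := F₀) (w := w) hK z.1 z.2.2)
        have := sq_le_sq' this.1 this.2
        linarith
      · simp
    · intro z
      split_ifs
      · have h1 := hv2 z.2.2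
        nlinarith [sq_nonneg (v z.2.2)]
      · simp
  have hinv : ∀ x, (π x)⁻¹ ≤ κ⁻¹ := fun x => inv_anti₀ hκ (hπκ x)
  have hinv0 : ∀ x, 0 ≤ (π x)⁻¹ := fun x => inv_nonneg.2 (hκ.le.trans (hπκ x))
  have hκ0 : 0 < κ⁻¹ := inv_pos.2 hκ
  have hint1 : Integrable m F.cov := Integrable.of_bound hm.aestronglyMeasurable K
    (Eventually.of_forall fun x => abs_condMean_le hK x)
  have hi3 : Integrable m₀ F.cov := Integrable.of_bound hm₀.aestronglyMeasurable K
    (Eventually.of_forall fun x => abs_condMean_le hK x)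
  have hi4 : Integrable (fun x => p x * ((π x)⁻¹ * v x)) F.cov := by
    refine Integrable.of_bound (hp.mul (hπ.inv.mul hvm)).aestronglyMeasurable
      (1 * (κ⁻¹ * (2 * K))) (Eventually.of_forall fun x => ?_)
    rw [Real.norm_eq_abs, abs_mul, abs_mul, abs_of_pos (hp0 x), abs_of_nonneg (hinv0 x)]
    exact mul_le_mul (hp1 x).le (mul_le_mul (hinv x) (hvb x) (abs_nonneg _) hκ0.le)
      (mul_nonneg (hinv0 x) (abs_nonneg _)) zero_le_one
  have hi34 : Integrable (fun x => m₀ x + p x * ((π x)⁻¹ * v x)) F.cov := hi3.add hi4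
  have hia : Integrable (fun x => a x ^ 2) F.cov :=
    Integrable.of_bound (ham.pow_const 2).aestronglyMeasurable 1
      (Eventually.of_forall fun x => by rw [Real.norm_of_nonneg (sq_nonneg _)]; exact ha2 x)
  have hiv : Integrable (fun x => p x * v x ^ 2) F.cov := by
    refine Integrable.of_bound (hp.mul (hvm.pow_const 2)).aestronglyMeasurable
      (1 * (4 * K ^ 2)) (Eventually.of_forall fun x => ?_)
    rw [norm_mul, Real.norm_of_nonneg (hp0 x).le, Real.norm_of_nonneg (sq_nonneg _)]
    exact mul_le_mul (hp1 x).le (hv2 x) (sq_nonneg _) zero_le_one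
  set C : ℝ := κ⁻¹ * (1 + κ⁻¹ + 4 * K * κ⁻¹) with hC
  have hC0 : 0 ≤ C := by positivity
  have hpt : ∀ x, |m x - (m₀ x + p x * ((π x)⁻¹ * v x))| ≤ C * (a x ^ 2 + p x * v x ^ 2) := by
    intro x
    have hπ0 : π x ≠ 0 := (hκ.trans_le (hπκ x)).ne'
    -- The double robustness identity: at each covariate the bias is the product of the propensity
    -- error and the regression error, divided by π.
    have h1 : m x - (m₀ x + p x * ((π x)⁻¹ * v x)) = -((π x)⁻¹ * (a x * v x)) := by
      simp only [ha, hv]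
      field_simp
      ring
    rw [h1, abs_neg, abs_mul, abs_of_nonneg (hinv0 x), abs_mul]
    have h2 : |a x| * |v x| ≤ (1 + κ⁻¹ + 4 * K * κ⁻¹) * (a x ^ 2 + p x * v x ^ 2) := by
      have hv0 := abs_nonneg (v x)
      have hsa := sq_abs (a x)
      have hsv := sq_abs (v x)
      have hpv : 0 ≤ p x * v x ^ 2 := mul_nonneg (hp0 x).le (sq_nonneg _)
      have hK' : 0 ≤ 4 * K * κ⁻¹ := by positivity
      -- F itself need not have strong overlap. Where p ≥ κ/2, v² is controlled by p v² and the
      -- arithmetic-geometric mean inequality applies. Where p ≤ κ/2, the propensity error a is at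
      -- least κ/2 in size, so |a| ≤ 2κ⁻¹ a², and |v| ≤ 2K suffices.
      rcases le_total (κ / 2) (p x) with h3 | h3
      · have h4 : v x ^ 2 / 2 ≤ κ⁻¹ * (p x * v x ^ 2) := by
          have : (1 : ℝ) / 2 ≤ κ⁻¹ * p x := by
            rw [inv_mul_eq_div, le_div_iff₀ hκ]; linarith
          nlinarith [sq_nonneg (v x)]
        have h5 : |a x| * |v x| ≤ a x ^ 2 / 2 + v x ^ 2 / 2 := by
          nlinarith [sq_nonneg (|a x| - |v x|)]
        nlinarith [sq_nonneg (a x), mul_nonneg hK' (sq_nonneg (a x)), mul_nonneg hK' hpv,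
          mul_nonneg hκ0.le (sq_nonneg (a x))]
      · have h4 : κ / 2 ≤ |a x| := by
          rw [abs_sub_comm]
          exact le_trans (by linarith [hπκ x]) (le_abs_self _)
        have h5 : |a x| ≤ 2 * κ⁻¹ * a x ^ 2 := by
          rw [← hsa]
          have : 1 ≤ 2 * κ⁻¹ * |a x| := by
            have := mul_le_mul_of_nonneg_left h4 hκ0.le
            rw [mul_div_assoc', inv_mul_cancel₀ hκ.ne'] at this
            linarith
          nlinarith
        have h6 : |a x| * |v x| ≤ (2 * κ⁻¹ * a x ^ 2) * (2 * K) :=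
          mul_le_mul h5 (hvb x) hv0 (by positivity)
        nlinarith [sq_nonneg (a x), mul_nonneg hK' hpv,
          mul_nonneg hκ0.le (sq_nonneg (a x)), mul_nonneg hκ0.le hpv]
    calc (π x)⁻¹ * (|a x| * |v x|)
        ≤ κ⁻¹ * ((1 + κ⁻¹ + 4 * K * κ⁻¹) * (a x ^ 2 + p x * v x ^ 2)) :=
          mul_le_mul (hinv x) h2 (by positivity) hκ0.le
      _ = _ := by rw [hC]; ring
  rw [integral_doublyRobust hκ hπ hπκ hh hK, integral_potLaw hh hK,
    show (fun x => F₀.condMean w h x + F.armProb w x * ((π x)⁻¹ * (F.condMean w h x -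
      F₀.condMean w h x))) = fun x => m₀ x + p x * ((π x)⁻¹ * v x) from rfl,
    ← integral_sub hint1 hi34]
  refine (abs_integral_le_integral_abs).trans ?_
  calc ∫ x, |m x - (m₀ x + p x * ((π x)⁻¹ * v x))| ∂F.cov
      ≤ ∫ x, C * (a x ^ 2 + p x * v x ^ 2) ∂F.cov :=
        integral_mono (hint1.sub hi34).abs ((hia.add hiv).const_mul C) hpt
    _ = C * (∫ x, a x ^ 2 ∂F.cov + ∫ x, p x * v x ^ 2 ∂F.cov) := by
        rw [integral_const_mul, integral_add hia hiv]
    _ ≤ C * (10 * c * 1 + 10 * c * (4 * K ^ 2)) :=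
        mul_le_mul_of_nonneg_left (add_le_add hA hD) hC0
    _ = _ := by ring

end Population

end

/-! ### Potential-outcome means along a regular submodel -/

noncomputable section

namespace Population

open Semiparametric

variable {𝓑 𝓧 : Type*} [MeasurableSpace 𝓑] [MeasurableSpace 𝓧]

/-- The treatment probabilities, bounded away from zero. -/
def clippedProb (F : Population 𝓑 𝓧) (κ : ℝ) (w : Bool) (x : 𝓧) : ℝ := max κ (F.armProb w x)

variable {F F₀ : Population 𝓑 𝓧} {π : 𝓧 → ℝ} {w : Bool} {h h' : 𝓑 → ℝ} {K κ : ℝ}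

theorem measurable_clippedProb : Measurable (F.clippedProb κ w) :=
  measurable_const.max (F.measurable_armProb w)

theorem le_clippedProb (x : 𝓧) : κ ≤ F.clippedProb κ w x := le_max_left _ _

theorem clippedProb_le_one (hκ : κ ≤ 1) (x : 𝓧) : F.clippedProb κ w x ≤ 1 :=
  max_le hκ (F.armProb_lt_one w x).le

/-- Overlap holds only almost surely for the true covariates, while the bias estimates integrate
over other populations. Clipping bounds the inverse weights everywhere and changes nothing almost
surely at the truth. -/
theorem clippedProb_ae_eq (hov : ∀ᵐ x ∂F.cov, κ ≤ F.prop x ∧ F.prop x ≤ 1 - κ) :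
    F.clippedProb κ w =ᵐ[F.cov] F.armProb w := by
  filter_upwards [hov] with x hx
  refine max_eq_right ?_
  cases w <;> simp only [armProb] <;> norm_num <;> linarith [hx.1, hx.2]

theorem le_one_of_overlap (hov : ∀ᵐ x ∂F.cov, κ ≤ F.prop x ∧ F.prop x ≤ 1 - κ) : κ ≤ 1 := by
  obtain ⟨x, hx⟩ := hov.exists
  linarith [hx.1, hx.2]

theorem doublyRobust_sub (hh : Measurable h) (hK : ∀ b, |h b| ≤ K) (hh' : Measurable h')
    (hK' : ∀ b, |h' b| ≤ K) (z : 𝓑 × Bool × 𝓧) :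
    F.doublyRobust π w (fun b => h b - h' b) z =
      F.doublyRobust π w h z - F.doublyRobust π w h' z := by
  have h1 : F.condMean w (fun b => h b - h' b) z.2.2 =
      F.condMean w h z.2.2 - F.condMean w h' z.2.2 :=
    integral_sub (integrable_bid hh hK _) (integrable_bid hh' hK' _)
  unfold doublyRobust
  rw [h1]
  split_ifs <;> ring

theorem memLp_doublyRobust (hκ : 0 < κ) (hπ : Measurable π) (hπκ : ∀ x, κ ≤ π x)
    (hh : Measurable h) (hK : ∀ b, |h b| ≤ K) (μ : Measure (𝓑 × Bool × 𝓧)) [IsFiniteMeasure μ] :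
    MemLp (F.doublyRobust π w h) 2 μ :=
  MemLp.of_bound (measurable_doublyRobust hπ hh).aestronglyMeasurable _
    (Eventually.of_forall (abs_doublyRobust_le hκ hπκ hK))

/-- The pairing of the doubly robust score with s is linear in h, and Cauchy-Schwarz with the L²
bound on that score makes it continuous. This lets the derivative functional be evaluated at test
functions that move with the cutoffs. -/
theorem sq_integral_doublyRobust_mul_sub_le (hκ : 0 < κ) (hπ : Measurable π) (hπκ : ∀ x, κ ≤ π x)
    (hh : Measurable h) (hK : ∀ b, |h b| ≤ K) (hh' : Measurable h') (hK' : ∀ b, |h' b| ≤ K)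
    {s : 𝓑 × Bool × 𝓧 → ℝ} (hs : MemLp s 2 F.obsLaw) :
    (∫ z, F.doublyRobust π w h z * s z ∂F.obsLaw -
      ∫ z, F.doublyRobust π w h' z * s z ∂F.obsLaw) ^ 2 ≤
      (2 + 8 * κ⁻¹ ^ 2) * (∫ b, (h b - h' b) ^ 2 ∂F.potLaw w) * ∫ z, s z ^ 2 ∂F.obsLaw := by
  have hd : ∀ b, |h b - h' b| ≤ K + K := fun b =>
    (abs_sub _ _).trans (add_le_add (hK b) (hK' b))
  have h1 := memLp_doublyRobust (F := F) (w := w) hκ hπ hπκ hh hK F.obsLaw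
  have h2 := memLp_doublyRobust (F := F) (w := w) hκ hπ hπκ hh' hK' F.obsLaw
  have h3 := memLp_doublyRobust (F := F) (w := w) hκ hπ hπκ (hh.sub hh') hd F.obsLaw
  have hi1 : Integrable (fun z => F.doublyRobust π w h z * s z) F.obsLaw := h1.integrable_mul hs
  have hi2 : Integrable (fun z => F.doublyRobust π w h' z * s z) F.obsLaw := h2.integrable_mul hs
  rw [← integral_sub hi1 hi2]
  have h4 := sq_integral_mul_le h3 hs
  have h5 : ∀ z, F.doublyRobust π w (fun b => h b - h' b) z * s z =
      F.doublyRobust π w h z * s z - F.doublyRobust π w h' z * s z := fun z => by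
    rw [doublyRobust_sub hh hK hh' hK', sub_mul]
  have h6 : ∫ z, F.doublyRobust π w h z * s z - F.doublyRobust π w h' z * s z ∂F.obsLaw =
      ∫ z, F.doublyRobust π w (fun b => h b - h' b) z * s z ∂F.obsLaw :=
    integral_congr_ae (Eventually.of_forall fun z => (h5 z).symm)
  refine (le_of_eq (congrArg (· ^ 2) h6)).trans (h4.trans ?_)
  exact mul_le_mul_of_nonneg_right (integral_sq_doublyRobust_le hκ hπ hπκ (hh.sub hh') hd)
    (integral_nonneg fun z => sq_nonneg _)

/-- First order expansion of potential outcome means along a regular submodel, uniform over bounded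
functions. -/
theorem potLaw_expansion (hκ : 0 < κ) (hov : ∀ᵐ x ∂F₀.cov, κ ≤ F₀.prop x ∧ F₀.prop x ≤ 1 - κ)
    {𝓜 : Set (Population 𝓑 𝓧)} {path : ℝ → Population 𝓑 𝓧} {s : 𝓑 × Bool × 𝓧 → ℝ}
    (hreg : IsRegularSubmodel obsLaw 𝓜 F₀ path s) (hK0 : 0 < K) :
    ∃ ρ : ℝ → ℝ, Tendsto ρ (𝓝[≠] 0) (𝓝 0) ∧ ∀ᶠ t in 𝓝[≠] (0 : ℝ), ∀ (w : Bool) (h : 𝓑 → ℝ),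
      Measurable h → (∀ b, |h b| ≤ K) →
      |∫ b, h b ∂(path t).potLaw w - ∫ b, h b ∂F₀.potLaw w -
        t * ∫ z, F₀.doublyRobust (F₀.clippedProb κ w) w h z * s z ∂F₀.obsLaw| ≤ |t| * ρ t := by
  obtain ⟨C, ρ, hC, hρ, hexp⟩ := hreg.expansion fun F => inferInstance
  set K' : ℝ := K * (1 + 2 * κ⁻¹) with hK'
  have hK'0 : 0 < K' := by positivity
  set B : ℝ := κ⁻¹ * (1 + κ⁻¹ + 4 * K * κ⁻¹) * (10 + 10 * (4 * K ^ 2)) with hB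
  refine ⟨fun t => K' * ρ t + B * C * |t|, ?_, ?_⟩
  · have h2 : Tendsto (fun t : ℝ => |t|) (𝓝[≠] 0) (𝓝 0) := by
      simpa using (continuous_abs.tendsto (0 : ℝ)).mono_left nhdsWithin_le_nhds
    simpa using (hρ.const_mul K').add (h2.const_mul (B * C))
  · filter_upwards [hexp] with t ht w h hh hK
    have hπ : Measurable (F₀.clippedProb κ w) := measurable_clippedProb
    have hb := abs_doublyRobust_le (F := F₀) (w := w) hκ (le_clippedProb (F := F₀) (w := w)) hK
    have hm := measurable_doublyRobust (F := F₀) (w := w) hπ hh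
    set d := F₀.doublyRobust (F₀.clippedProb κ w) w h with hd
    have h1 := abs_integral_potLaw_sub_doublyRobust_le (F := path t) (by positivity)
      (fun g K hg hgK => ht.1 g K hg hgK : HellingerLe (path t).obsLaw F₀.obsLaw (C * t ^ 2)) hκ hπ
      le_clippedProb (clippedProb_le_one (le_one_of_overlap hov)) (clippedProb_ae_eq hov) hh hK0 hK
    -- The expansion is uniform over functions bounded by one; division by K', a bound for the score
    -- depending only on K and κ, makes it uniform in h.
    have h2 := ht.2 (fun z => K'⁻¹ * d z) (hm.const_mul _) (fun z => by
      rw [abs_mul, abs_of_pos (inv_pos.2 hK'0), inv_mul_le_iff₀ hK'0, mul_one]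
      exact hb z)
    simp only [mul_assoc, integral_const_mul] at h2
    have h3 : ∫ z, d z ∂F₀.obsLaw = ∫ b, h b ∂F₀.potLaw w :=
      integral_doublyRobust_self hκ hπ le_clippedProb hh hK
    have h4 : |∫ z, d z ∂(path t).obsLaw - ∫ z, d z ∂F₀.obsLaw -
        t * ∫ z, d z * s z ∂F₀.obsLaw| ≤ K' * (|t| * ρ t) := by
      rw [← inv_mul_le_iff₀ hK'0, ← abs_of_pos (inv_pos.2 hK'0), ← abs_mul]
      refine le_trans (le_of_eq (congrArg _ ?_)) h2
      ring
    rw [← h3]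
    have h5 := abs_add_le (∫ b, h b ∂(path t).potLaw w - ∫ z, d z ∂(path t).obsLaw)
      (∫ z, d z ∂(path t).obsLaw - ∫ z, d z ∂F₀.obsLaw - t * ∫ z, d z * s z ∂F₀.obsLaw)
    have h6 : B * (C * t ^ 2) = |t| * (B * C * |t|) := by
      rw [← sq_abs t]; ring
    rw [h6] at h1
    calc _ = |(∫ b, h b ∂(path t).potLaw w - ∫ z, d z ∂(path t).obsLaw) +
      (∫ z, d z ∂(path t).obsLaw - ∫ z, d z ∂F₀.obsLaw - t * ∫ z, d z * s z ∂F₀.obsLaw)| := by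
          congr 1; ring
      _ ≤ _ := by linarith

/-- Potential outcome means are Lipschitz along a regular submodel, uniformly over bounded
functions. -/
theorem potLaw_lipschitz (hκ : 0 < κ) (hov : ∀ᵐ x ∂F₀.cov, κ ≤ F₀.prop x ∧ F₀.prop x ≤ 1 - κ)
    {𝓜 : Set (Population 𝓑 𝓧)} {path : ℝ → Population 𝓑 𝓧} {s : 𝓑 × Bool × 𝓧 → ℝ}
    (hreg : IsRegularSubmodel obsLaw 𝓜 F₀ path s) (hK0 : 0 < K) :
    ∃ C : ℝ, 0 < C ∧ ∀ᶠ t in 𝓝[≠] (0 : ℝ), ∀ (w : Bool) (h : 𝓑 → ℝ),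
      Measurable h → (∀ b, |h b| ≤ K) →
      |∫ b, h b ∂(path t).potLaw w - ∫ b, h b ∂F₀.potLaw w| ≤ C * |t| := by
  obtain ⟨ρ, hρ, hexp⟩ := potLaw_expansion hκ hov hreg hK0
  set K' : ℝ := K * (1 + 2 * κ⁻¹) with hK'
  have hK'0 : 0 < K' := by positivity
  have hsi : Integrable s F₀.obsLaw := hreg.memLp.integrable one_le_two
  refine ⟨1 + K' * ∫ z, |s z| ∂F₀.obsLaw, by positivity, ?_⟩
  filter_upwards [hexp, hρ.eventually (gt_mem_nhds one_pos)] with t ht hρt w h hh hK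
  have h1 := ht w h hh hK
  have hb := abs_doublyRobust_le (F := F₀) (w := w) hκ (le_clippedProb (F := F₀) (w := w)) hK
  set d := F₀.doublyRobust (F₀.clippedProb κ w) w h with hd
  have h2 : |∫ z, d z * s z ∂F₀.obsLaw| ≤ K' * ∫ z, |s z| ∂F₀.obsLaw := by
    rw [← integral_const_mul]
    refine abs_integral_le_integral_abs.trans (integral_mono_of_nonneg
      (Eventually.of_forall fun z => abs_nonneg _) (hsi.abs.const_mul K')
      (Eventually.of_forall fun z => ?_))
    simp only [abs_mul]
    exact mul_le_mul_of_nonneg_right (hb z) (abs_nonneg _)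
  have h3 := abs_add_le (∫ b, h b ∂(path t).potLaw w - ∫ b, h b ∂F₀.potLaw w -
    t * ∫ z, d z * s z ∂F₀.obsLaw) (t * ∫ z, d z * s z ∂F₀.obsLaw)
  rw [sub_add_cancel, abs_mul] at h3
  have h4 := mul_le_mul_of_nonneg_left h2 (abs_nonneg t)
  have h5 := mul_le_mul_of_nonneg_left hρt.le (abs_nonneg t)
  linarith

end Population

end

/-! ## Regularity of the continuum market at the true population -/

noncomputable section

/-- The derivative at a point of a family of differentiable functions depending measurably on a
parameter is measurable in the parameter. -/
theorem stronglyMeasurable_fderiv_of_differentiableAt {X E : Type*} [MeasurableSpace X]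
    [NormedAddCommGroup E] [InnerProductSpace ℝ E] [FiniteDimensional ℝ E] {f : X → E → ℝ} {p : E}
    (hf : ∀ p, Measurable fun x => f x p) (hd : ∀ x, DifferentiableAt ℝ (f x) p) :
    StronglyMeasurable fun x => fderiv ℝ (f x) p := by
  have hv : ∀ v : E, Measurable fun x => fderiv ℝ (f x) p v := by
    intro v
    have hu : Tendsto (fun n : ℕ => 1 / ((n : ℝ) + 1)) atTop (𝓝[≠] 0) :=
      tendsto_nhdsWithin_iff.2 ⟨tendsto_one_div_add_atTop_nhds_zero_nat,
        Eventually.of_forall fun n => (by positivity : (0 : ℝ) < 1 / ((n : ℝ) + 1)).ne'⟩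
    refine measurable_of_tendsto_metrizable (f := fun (n : ℕ) x =>
      (1 / ((n : ℝ) + 1))⁻¹ • (f x (p + (1 / ((n : ℝ) + 1)) • v) - f x p)) (fun n => ?_) ?_
    · exact ((hf (p + (1 / ((n : ℝ) + 1)) • v)).sub (hf p)).const_mul (1 / ((n : ℝ) + 1))⁻¹
    · rw [tendsto_pi_nhds]
      intro x
      exact ((hd x).hasFDerivAt.hasLineDerivAt v).tendsto_slope_zero.comp hu
  set b := stdOrthonormalBasis ℝ E
  have heq : (fun x => fderiv ℝ (f x) p) =
      fun x => ∑ i, fderiv ℝ (f x) p (b i) • innerSL ℝ (b i) := by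
    funext x
    ext v
    conv_lhs => rw [← b.sum_repr v]
    simp [b.repr_apply_apply, mul_comm]
  rw [heq]
  exact Finset.stronglyMeasurable_fun_sum _ fun i _ =>
    (hv (b i)).stronglyMeasurable.smul_const _

namespace CutoffMechanism

open Population

variable {𝓑 𝓧 : Type*} [MeasurableSpace 𝓑] [MeasurableSpace 𝓧] {J : ℕ}
  {M : CutoffMechanism 𝓑 J} {F F₀ : Population 𝓑 𝓧} {pstar : Bool → EuclideanSpace ℝ (Fin J)}

/-- The outcome at cutoffs `p`, net of the allocation valued at the prices `ℓ`. -/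
def netOutcome (M : CutoffMechanism 𝓑 J) (ℓ : EuclideanSpace ℝ (Fin J) →L[ℝ] ℝ)
    (p : EuclideanSpace ℝ (Fin J)) (b : 𝓑) : ℝ :=
  M.outcome b p - ℓ (M.alloc b p - M.capacity)

theorem measurable_netOutcome (ℓ : EuclideanSpace ℝ (Fin J) →L[ℝ] ℝ)
    (p : EuclideanSpace ℝ (Fin J)) : Measurable (M.netOutcome ℓ p) :=
  (M.measurable_outcome p).sub (ℓ.measurable.comp ((M.measurable_alloc p).sub_const _))

theorem Assumptions.exists_bound (hF₀ : M.Assumptions F₀ pstar) :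
    ∃ K : ℝ, 0 < K ∧ ∀ b, ∀ p ∈ M.cutoffs, ‖M.alloc b p‖ ≤ K ∧ |M.outcome b p| ≤ K := by
  obtain ⟨K₁, h₁⟩ := hF₀.alloc_bounded
  obtain ⟨K₂, h₂⟩ := hF₀.outcome_bounded
  exact ⟨max (max K₁ K₂) 1, lt_max_of_lt_right one_pos, fun b p hp =>
    ⟨(h₁ b p hp).trans ((le_max_left _ _).trans (le_max_left _ _)),
      (h₂ b p hp).trans ((le_max_right _ _).trans (le_max_left _ _))⟩⟩

theorem Assumptions.exists_bound_netOutcome (hF₀ : M.Assumptions F₀ pstar)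
    (ℓ : EuclideanSpace ℝ (Fin J) →L[ℝ] ℝ) :
    ∃ K : ℝ, 0 < K ∧ ∀ p ∈ M.cutoffs, ∀ b, |M.netOutcome ℓ p b| ≤ K := by
  obtain ⟨K, hK0, hK⟩ := hF₀.exists_bound
  refine ⟨K + ‖ℓ‖ * (K + ‖M.capacity‖), by positivity, fun p hp b => ?_⟩
  obtain ⟨h1, h2⟩ := hK b p hp
  refine (abs_sub _ _).trans (add_le_add h2 ?_)
  refine (ℓ.le_opNorm _).trans (mul_le_mul_of_nonneg_left ?_ (norm_nonneg _))
  exact (norm_sub_le _ _).trans (by linarith)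

theorem Assumptions.integrable_alloc (hF₀ : M.Assumptions F₀ pstar) {p : EuclideanSpace ℝ (Fin J)}
    (hp : p ∈ M.cutoffs) (μ : Measure 𝓑) [IsFiniteMeasure μ] :
    Integrable (fun b => M.alloc b p) μ := by
  obtain ⟨K, -, hK⟩ := hF₀.exists_bound
  exact Integrable.of_bound (M.measurable_alloc p).aestronglyMeasurable K
    (Eventually.of_forall fun b => (hK b p hp).1)

theorem Assumptions.integrable_outcome (hF₀ : M.Assumptions F₀ pstar)
    {p : EuclideanSpace ℝ (Fin J)} (hp : p ∈ M.cutoffs) (μ : Measure 𝓑) [IsFiniteMeasure μ] :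
    Integrable (fun b => M.outcome b p) μ := by
  obtain ⟨K, -, hK⟩ := hF₀.exists_bound
  exact Integrable.of_bound (M.measurable_outcome p).aestronglyMeasurable K
    (Eventually.of_forall fun b => (hK b p hp).2)

/-- At clearing cutoffs the second term vanishes, so there the net outcome has the same mean as the
outcome, whatever the prices ℓ. -/
theorem Assumptions.integral_netOutcome (hF₀ : M.Assumptions F₀ pstar)
    {p : EuclideanSpace ℝ (Fin J)} (hp : p ∈ M.cutoffs) (ℓ : EuclideanSpace ℝ (Fin J) →L[ℝ] ℝ)
    (F : Population 𝓑 𝓧) (w : Bool) :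
    ∫ b, M.netOutcome ℓ p b ∂F.potLaw w = M.meanOutcome F w p - ℓ (M.excess F w p) := by
  have h1 := hF₀.integrable_alloc hp (F.potLaw w)
  have h2 := hF₀.integrable_outcome hp (F.potLaw w)
  have h3 : Integrable (fun b => M.alloc b p - M.capacity) (F.potLaw w) :=
    h1.sub (integrable_const _)
  unfold netOutcome
  rw [integral_sub h2 (ℓ.integrable_comp h3), ℓ.integral_comp_comm h3,
    integral_sub h1 (integrable_const _)]
  simp [meanOutcome, excess]

theorem Assumptions.exists_integral_sq_le (hF₀ : M.Assumptions F₀ pstar) :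
    ∃ L : ℝ, 0 < L ∧ ∀ w, ∀ p ∈ M.cutoffs, ∀ p' ∈ M.cutoffs,
      ∫ b, ‖M.alloc b p - M.alloc b p'‖ ^ 2 ∂F₀.potLaw w ≤ L * ‖p - p'‖ ∧
      ∫ b, (M.outcome b p - M.outcome b p') ^ 2 ∂F₀.potLaw w ≤ L * ‖p - p'‖ := by
  obtain ⟨L, hL0, hL⟩ := hF₀.weak_continuity
  obtain ⟨K, hK0, hK⟩ := hF₀.exists_bound
  -- J copies of L cover the coordinates of the allocation; the extra one covers the outcome and
  -- keeps the constant positive when J = 0.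
  refine ⟨(J + 1) * L, by positivity, fun w p hp p' hp' => ?_⟩
  obtain ⟨h1, h2⟩ := hL w p hp p' hp'
  have hn := norm_nonneg (p - p')
  constructor
  · simp_rw [EuclideanSpace.norm_sq_eq, PiLp.sub_apply, Real.norm_eq_abs, sq_abs]
    rw [integral_finsetSum]
    · refine (Finset.sum_le_sum fun j _ => h1 j).trans ?_
      simp only [Finset.sum_const, Finset.card_univ, Fintype.card_fin, nsmul_eq_mul]
      nlinarith [mul_nonneg hL0.le hn]
    · intro j _
      have hm : ∀ p, Measurable fun b => M.alloc b p j := fun p =>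
        (EuclideanSpace.proj j : EuclideanSpace ℝ (Fin J) →L[ℝ] ℝ).measurable.comp
          (M.measurable_alloc p)
      refine Integrable.of_bound (((hm p).sub (hm p')).pow_const 2).aestronglyMeasurable
        ((K + K) ^ 2) (Eventually.of_forall fun b => ?_)
      rw [norm_pow]
      refine pow_le_pow_left₀ (norm_nonneg _) ?_ 2
      exact (norm_sub_le _ _).trans (add_le_add ((PiLp.norm_apply_le _ _).trans (hK b p hp).1)
        ((PiLp.norm_apply_le _ _).trans (hK b p' hp').1))
  · refine h2.trans ?_
    have : 0 ≤ J * (L * ‖p - p'‖) := by positivity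
    nlinarith

theorem Assumptions.exists_integral_sq_netOutcome_le (hF₀ : M.Assumptions F₀ pstar)
    (ℓ : EuclideanSpace ℝ (Fin J) →L[ℝ] ℝ) :
    ∃ L : ℝ, ∀ w, ∀ p ∈ M.cutoffs, ∀ p' ∈ M.cutoffs,
      ∫ b, (M.netOutcome ℓ p b - M.netOutcome ℓ p' b) ^ 2 ∂F₀.potLaw w ≤ L * ‖p - p'‖ := by
  obtain ⟨L, hL0, hL⟩ := hF₀.exists_integral_sq_le
  obtain ⟨K, hK0, hK⟩ := hF₀.exists_bound
  refine ⟨2 * L + 2 * ‖ℓ‖ ^ 2 * L, fun w p hp p' hp' => ?_⟩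
  obtain ⟨h1, h2⟩ := hL w p hp p' hp'
  have hi1 : Integrable (fun b => ‖M.alloc b p - M.alloc b p'‖ ^ 2) (F₀.potLaw w) := by
    refine Integrable.of_bound (((M.measurable_alloc p).sub
      (M.measurable_alloc p')).norm.pow_const 2).aestronglyMeasurable
      ((K + K) ^ 2) (Eventually.of_forall fun b => ?_)
    rw [norm_pow, norm_norm]
    exact pow_le_pow_left₀ (norm_nonneg _)
      ((norm_sub_le _ _).trans (add_le_add (hK b p hp).1 (hK b p' hp').1)) 2
  have hi2 : Integrable (fun b => (M.outcome b p - M.outcome b p') ^ 2) (F₀.potLaw w) := by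
    refine Integrable.of_bound (((M.measurable_outcome p).sub
      (M.measurable_outcome p')).pow_const 2).aestronglyMeasurable
      ((K + K) ^ 2) (Eventually.of_forall fun b => ?_)
    rw [norm_pow]
    exact pow_le_pow_left₀ (norm_nonneg _)
      ((norm_sub_le _ _).trans (add_le_add (hK b p hp).2 (hK b p' hp').2)) 2
  calc _ ≤ ∫ b, (2 * (M.outcome b p - M.outcome b p') ^ 2 +
        2 * ‖ℓ‖ ^ 2 * ‖M.alloc b p - M.alloc b p'‖ ^ 2) ∂F₀.potLaw w := by
        refine integral_mono_of_nonneg (Eventually.of_forall fun b => sq_nonneg _)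
          ((hi2.const_mul 2).add (hi1.const_mul _)) (Eventually.of_forall fun b => ?_)
        have h3 : M.netOutcome ℓ p b - M.netOutcome ℓ p' b =
            (M.outcome b p - M.outcome b p') - ℓ (M.alloc b p - M.alloc b p') := by
          simp only [netOutcome, map_sub]; ring
        have h4 := ℓ.le_opNorm (M.alloc b p - M.alloc b p')
        have h5 : ℓ (M.alloc b p - M.alloc b p') ^ 2 ≤
            ‖ℓ‖ ^ 2 * ‖M.alloc b p - M.alloc b p'‖ ^ 2 := by
          rw [← mul_pow, ← sq_abs]
          exact pow_le_pow_left₀ (abs_nonneg _) h4 2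
        simp only [h3]
        nlinarith [sq_nonneg ((M.outcome b p - M.outcome b p') + ℓ (M.alloc b p - M.alloc b p'))]
    _ = 2 * ∫ b, (M.outcome b p - M.outcome b p') ^ 2 ∂F₀.potLaw w +
        2 * ‖ℓ‖ ^ 2 * ∫ b, ‖M.alloc b p - M.alloc b p'‖ ^ 2 ∂F₀.potLaw w := by
        rw [integral_add (hi2.const_mul 2) (hi1.const_mul _), integral_const_mul,
          integral_const_mul]
    _ ≤ _ := by
        have := mul_le_mul_of_nonneg_left h1 (by positivity : 0 ≤ 2 * ‖ℓ‖ ^ 2)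
        linarith

/-- Excess demand is continuous for all populations whose potential submissions are dominated by
those of the true population. -/
theorem Assumptions.continuousOn_excess (hF₀ : M.Assumptions F₀ pstar) {w : Bool} {c : NNReal}
    (hle : F.potLaw w ≤ c • F₀.potLaw w) : ContinuousOn (M.excess F w) M.cutoffs := by
  obtain ⟨L, hL0, hL⟩ := hF₀.exists_integral_sq_le
  obtain ⟨K, hK0, hK⟩ := hF₀.exists_bound
  have hbound : ∀ p ∈ M.cutoffs, ∀ p' ∈ M.cutoffs,
      ‖M.excess F w p - M.excess F w p'‖ ^ 2 ≤ c * (L * ‖p - p'‖) := by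
    intro p hp p' hp'
    have h1 := hF₀.integrable_alloc hp (F.potLaw w)
    have h2 := hF₀.integrable_alloc hp' (F.potLaw w)
    have hm : Measurable fun b => ‖M.alloc b p - M.alloc b p'‖ :=
      ((M.measurable_alloc p).sub (M.measurable_alloc p')).norm
    have hb : ∀ b, ‖M.alloc b p - M.alloc b p'‖ ≤ K + K := fun b =>
      (norm_sub_le _ _).trans (add_le_add (hK b p hp).1 (hK b p' hp').1)
    have hL2 : MemLp (fun b => ‖M.alloc b p - M.alloc b p'‖) 2 (F.potLaw w) :=
      MemLp.of_bound hm.aestronglyMeasurable (K + K)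
        (Eventually.of_forall fun b => by rw [norm_norm]; exact hb b)
    have h3 : ‖M.excess F w p - M.excess F w p'‖ ≤
        ∫ b, ‖M.alloc b p - M.alloc b p'‖ ∂F.potLaw w := by
      rw [excess, excess, sub_sub_sub_cancel_right, ← integral_sub h1 h2]
      exact norm_integral_le_integral_norm _
    have h4 := Semiparametric.sq_integral_mul_le hL2 (memLp_const (1 : ℝ))
    simp only [mul_one, one_pow, integral_const, probReal_univ, smul_eq_mul] at h4
    have hi : Integrable (fun b => ‖M.alloc b p - M.alloc b p'‖ ^ 2) (c • F₀.potLaw w) := by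
      refine Integrable.of_bound (hm.pow_const 2).aestronglyMeasurable
        ((K + K) ^ 2) (Eventually.of_forall fun b => ?_)
      rw [norm_pow, norm_norm]
      exact pow_le_pow_left₀ (norm_nonneg _) (hb b) 2
    -- Domination transfers the mean-square continuity, assumed only at the true population, to F.
    have h5 : ∫ b, ‖M.alloc b p - M.alloc b p'‖ ^ 2 ∂F.potLaw w ≤
        ∫ b, ‖M.alloc b p - M.alloc b p'‖ ^ 2 ∂(c • F₀.potLaw w) :=
      integral_mono_measure hle (Eventually.of_forall fun b => sq_nonneg _) hi
    rw [integral_smul_nnreal_measure, NNReal.smul_def, smul_eq_mul] at h5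
    calc ‖M.excess F w p - M.excess F w p'‖ ^ 2 ≤ _ := pow_le_pow_left₀ (norm_nonneg _) h3 2
      _ ≤ _ := h4
      _ ≤ _ := h5
      _ ≤ _ := mul_le_mul_of_nonneg_left (hL w p hp p' hp').1 c.2
  intro p hp
  rw [ContinuousWithinAt, tendsto_iff_norm_sub_tendsto_zero]
  have hlim : Tendsto (fun p' => √(c * (L * ‖p' - p‖))) (𝓝[M.cutoffs] p) (𝓝 0) := by
    have : Continuous fun p' => √(c * (L * ‖p' - p‖)) := by fun_prop
    have h := this.tendsto p
    simp only [sub_self, norm_zero, mul_zero, Real.sqrt_zero] at h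
    exact h.mono_left nhdsWithin_le_nhds
  refine squeeze_zero' (Eventually.of_forall fun _ => norm_nonneg _) ?_ hlim
  filter_upwards [self_mem_nhdsWithin] with p' hp'
  exact Real.le_sqrt_of_sq_le (hbound p' hp' p hp)

theorem Assumptions.cutoffs_mem_nhds (hF₀ : M.Assumptions F₀ pstar) (w : Bool) :
    M.cutoffs ∈ 𝓝 (pstar w) := by
  obtain ⟨c₁, hc₁, h⟩ := hF₀.interior_equilibrium
  exact Filter.mem_of_superset (Metric.ball_mem_nhds _ hc₁) (h w)

/-- The Jacobian condition already contains differentiability: otherwise `fderiv` is 0 by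
convention, the lower bound c₃ forces the space to be trivial, and there every map is
differentiable. -/
theorem Assumptions.differentiableAt_excess (hF₀ : M.Assumptions F₀ pstar) (w : Bool) :
    DifferentiableAt ℝ (M.excess F₀ w) (pstar w) := by
  by_contra h
  obtain ⟨c₃, c₄, hc₃, hj⟩ := hF₀.jacobian
  have hzero := fderiv_zero_of_not_differentiableAt h
  have : Subsingleton (EuclideanSpace ℝ (Fin J)) := by
    refine subsingleton_of_forall_eq 0 fun v => ?_
    have h1 := (hj w v).1
    rw [hzero, zero_apply, norm_zero] at h1
    exact norm_le_zero_iff.1 (nonpos_of_mul_nonpos_right h1 hc₃)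
  exact h (hasFDerivAt_of_subsingleton _ _).differentiableAt

/-- No singular-value condition helps for outcomes, so one differentiates under the integral over
covariates; the uniform bound on first derivatives dominates. -/
theorem Assumptions.differentiableAt_meanOutcome (hF₀ : M.Assumptions F₀ pstar) (w : Bool) :
    DifferentiableAt ℝ (M.meanOutcome F₀ w) (pstar w) := by
  obtain ⟨c₁, hc₁, hball⟩ := hF₀.interior_equilibrium
  obtain ⟨c', hsm⟩ := hF₀.smooth
  obtain ⟨K, hK0, hK⟩ := hF₀.exists_bound
  have hint : Metric.ball (pstar w) c₁ ⊆ interior M.cutoffs :=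
    interior_maximal (hball w) Metric.isOpen_ball
  have hd : ∀ x, ∀ p ∈ Metric.ball (pstar w) c₁, DifferentiableAt ℝ (M.condOutcome F₀ w x) p :=
    fun x p hp => ((hsm w x).2.1.contDiffAt
      (isOpen_interior.mem_nhds (hint hp))).differentiableAt two_ne_zero
  have hm : ∀ p, Measurable fun x => M.condOutcome F₀ w x p := fun p =>
    measurable_condMean (F := F₀) (w := w) (M.measurable_outcome p)
  have hp : pstar w ∈ Metric.ball (pstar w) c₁ := Metric.mem_ball_self hc₁
  have hder : HasFDerivAt (fun p => ∫ x, M.condOutcome F₀ w x p ∂F₀.cov)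
      (∫ x, fderiv ℝ (M.condOutcome F₀ w x) (pstar w) ∂F₀.cov) (pstar w) := by
    refine hasFDerivAt_integral_of_dominated_of_fderiv_le (bound := fun _ => c')
      (F' := fun p x => fderiv ℝ (M.condOutcome F₀ w x) p)
      (Metric.ball_mem_nhds (pstar w) hc₁) (Eventually.of_forall fun p =>
        (hm p).aestronglyMeasurable) ?_ ?_ ?_ (integrable_const _) ?_
    · exact Integrable.of_bound (hm _).aestronglyMeasurable K (Eventually.of_forall fun x =>
        abs_condMean_le (fun b => (hK b _ (hball w hp)).2) x)
    · exact (stronglyMeasurable_fderiv_of_differentiableAt hm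
        fun x => hd x _ hp).aestronglyMeasurable
    · refine Eventually.of_forall fun x p hp => ?_
      rw [← norm_iteratedFDeriv_one]
      exact ((hsm w x).2.2 1 le_rfl one_le_two p (hint hp)).2
    · exact Eventually.of_forall fun x p hp => (hd x p hp).hasFDerivAt
  refine (hder.congr_of_eventuallyEq ?_).differentiableAt
  filter_upwards [hF₀.cutoffs_mem_nhds w] with p hp
  exact integral_potLaw (M.measurable_outcome p) fun b => (hK b p hp).2

end CutoffMechanism

end

/-! ## Pathwise differentiability of the global treatment effect -/

noncomputable section

namespace CutoffMechanism

open Population Semiparametric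

variable {𝓑 𝓧 : Type*} [MeasurableSpace 𝓑] [MeasurableSpace 𝓧] {J : ℕ}
  {M : CutoffMechanism 𝓑 J} {F₀ : Population 𝓑 𝓧} {pstar : Bool → EuclideanSpace ℝ (Fin J)}

/-- The outcome net of the allocation valued at the prices `ν_w`, at the market-clearing cutoffs. -/
def equilibriumOutcome (M : CutoffMechanism 𝓑 J) (F₀ : Population 𝓑 𝓧)
    (pstar : Bool → EuclideanSpace ℝ (Fin J)) (w : Bool) : 𝓑 → ℝ :=
  M.netOutcome (M.nu F₀ w (pstar w)) (pstar w)

theorem Assumptions.exists_jacobian_equiv (hF₀ : M.Assumptions F₀ pstar) (w : Bool) :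
    ∃ e : EuclideanSpace ℝ (Fin J) ≃L[ℝ] EuclideanSpace ℝ (Fin J),
      fderiv ℝ (M.excess F₀ w) (pstar w) = e := by
  obtain ⟨c₃, c₄, hc₃, hj⟩ := hF₀.jacobian
  set A := fderiv ℝ (M.excess F₀ w) (pstar w) with hA
  have hinj : Function.Injective A := by
    rw [injective_iff_map_eq_zero]
    intro v hv
    have := (hj w v).1
    rw [hv, norm_zero] at this
    exact norm_le_zero_iff.1 (nonpos_of_mul_nonpos_right this hc₃)
  refine ⟨(LinearEquiv.ofInjectiveEndo (A : EuclideanSpace ℝ (Fin J) →ₗ[ℝ]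
    EuclideanSpace ℝ (Fin J)) hinj).toContinuousLinearEquiv, ?_⟩
  ext1 v
  rfl

/-- This says that y_w - ν_w z_w has zero gradient at the clearing cutoffs. It rests on
invertibility, since `inverse` is 0 by convention at a non-invertible map. -/
theorem Assumptions.nu_comp (hF₀ : M.Assumptions F₀ pstar) (w : Bool) :
    (M.nu F₀ w (pstar w)).comp (fderiv ℝ (M.excess F₀ w) (pstar w)) =
      fderiv ℝ (M.meanOutcome F₀ w) (pstar w) := by
  obtain ⟨e, he⟩ := hF₀.exists_jacobian_equiv w
  ext1 v
  simp only [nu, he, ContinuousLinearMap.inverse_equiv, ContinuousLinearMap.comp_apply,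
    ContinuousLinearEquiv.coe_coe, ContinuousLinearEquiv.symm_apply_apply]

theorem Assumptions.cut_eq (hF₀ : M.Assumptions F₀ pstar)
    {cut : Population 𝓑 𝓧 → Bool → EuclideanSpace ℝ (Fin J)} (hcut : M.IsCutoffRule cut)
    (w : Bool) : cut F₀ w = pstar w :=
  hF₀.unique_equilibrium w _ (hcut F₀ w ⟨_, hF₀.clears w⟩)

/-- Market-clearing cutoffs are well separated. -/
theorem Assumptions.exists_lt_norm_excess (hF₀ : M.Assumptions F₀ pstar) (w : Bool) {ε : ℝ}
    (hε : 0 < ε) :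
    ∃ m : ℝ, 0 < m ∧ ∀ p ∈ M.cutoffs, ε ≤ dist p (pstar w) → m ≤ ‖M.excess F₀ w p‖ := by
  have hcont : ContinuousOn (M.excess F₀ w) M.cutoffs :=
    hF₀.continuousOn_excess (c := 1) (by rw [one_smul])
  set T := M.cutoffs ∩ (Metric.ball (pstar w) ε)ᶜ with hT
  have hTc : IsCompact T := hF₀.compact_cutoffs.inter_right Metric.isOpen_ball.isClosed_compl
  rcases T.eq_empty_or_nonempty with h | h
  · refine ⟨1, one_pos, fun p hp hd => ?_⟩
    have : p ∈ T := ⟨hp, by simpa using hd⟩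
    simp [h] at this
  · obtain ⟨p₀, hp₀, hmin⟩ := hTc.exists_isMinOn h (hcont.mono Set.inter_subset_left).norm
    refine ⟨‖M.excess F₀ w p₀‖, norm_pos_iff.2 fun h0 => ?_, fun p hp hd => ?_⟩
    · have := hF₀.unique_equilibrium w p₀ ⟨hp₀.1, h0⟩
      exact hp₀.2 (by rw [this]; exact Metric.mem_ball_self hε)
    · exact hmin (show p ∈ T from ⟨hp, by simpa using hd⟩)

/-- Near the market-clearing cutoffs, excess demand controls the distance to them. -/
theorem Assumptions.eventually_norm_sub_le (hF₀ : M.Assumptions F₀ pstar) (w : Bool) :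
    ∃ c : ℝ, 0 < c ∧ ∀ᶠ p in 𝓝 (pstar w), c * ‖p - pstar w‖ ≤ ‖M.excess F₀ w p‖ := by
  obtain ⟨c₃, c₄, hc₃, hj⟩ := hF₀.jacobian
  refine ⟨c₃ / 2, by positivity, ?_⟩
  have hd := (hF₀.differentiableAt_excess w).hasFDerivAt
  have hlo := hd.isLittleO.def (by positivity : 0 < c₃ / 2)
  filter_upwards [hlo] with p hp
  rw [(hF₀.clears w).2, sub_zero] at hp
  have h1 := (hj w (p - pstar w)).1
  have h2 := norm_sub_norm_le (fderiv ℝ (M.excess F₀ w) (pstar w) (p - pstar w))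
    (fderiv ℝ (M.excess F₀ w) (pstar w) (p - pstar w) - M.excess F₀ w p)
  rw [sub_sub_cancel, norm_sub_rev _ (M.excess F₀ w p)] at h2
  linarith

variable {path : ℝ → Population 𝓑 𝓧} {s : 𝓑 × Bool × 𝓧 → ℝ}

/-- A norming functional reduces the vector bound to a scalar one. The functional depends on t and
p, which is harmless because the scalar bound is uniform over all test functions bounded by K. -/
theorem Assumptions.excess_lipschitz (hF₀ : M.Assumptions F₀ pstar)
    {𝓜 : Set (Population 𝓑 𝓧)} (hreg : IsRegularSubmodel obsLaw 𝓜 F₀ path s) :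
    ∃ C : ℝ, 0 < C ∧ ∀ᶠ t in 𝓝[≠] (0 : ℝ), ∀ w, ∀ p ∈ M.cutoffs,
      ‖M.excess (path t) w p - M.excess F₀ w p‖ ≤ C * |t| := by
  obtain ⟨κ, hκ, hov⟩ := hF₀.strong_overlap
  obtain ⟨K, hK0, hK⟩ := hF₀.exists_bound
  obtain ⟨C, hC, hlip⟩ := potLaw_lipschitz hκ hov hreg hK0
  refine ⟨C, hC, ?_⟩
  filter_upwards [hlip] with t ht w p hp
  obtain ⟨ℓ, hℓ, hℓv⟩ := exists_dual_vector'' ℝ (M.excess (path t) w p - M.excess F₀ w p)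
  have h1 := ht w (fun b => ℓ (M.alloc b p)) (ℓ.measurable.comp (M.measurable_alloc p)) fun b =>
    (ℓ.le_opNorm _).trans ((mul_le_of_le_one_left (norm_nonneg _) hℓ).trans (hK b p hp).1)
  rw [ℓ.integral_comp_comm (hF₀.integrable_alloc hp _),
    ℓ.integral_comp_comm (hF₀.integrable_alloc hp _), ← map_sub] at h1
  have h2 : M.excess (path t) w p - M.excess F₀ w p =
      (∫ b, M.alloc b p ∂(path t).potLaw w) - ∫ b, M.alloc b p ∂F₀.potLaw w :=
    sub_sub_sub_cancel_right _ _ _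
  have h3 : ‖M.excess (path t) w p - M.excess F₀ w p‖ =
      ℓ (M.excess (path t) w p - M.excess F₀ w p) := by
    rw [hℓv]; rfl
  rw [h3, h2]
  exact (le_abs_self _).trans h1

/-- Along a regular submodel market-clearing cutoffs deviate from those of the true population at
most linearly. -/
theorem Assumptions.cut_lipschitz (hF₀ : M.Assumptions F₀ pstar)
    {cut : Population 𝓑 𝓧 → Bool → EuclideanSpace ℝ (Fin J)} (hcut : M.IsCutoffRule cut)
    (hreg : IsRegularSubmodel obsLaw (M.model 𝓧) F₀ path s) (w : Bool) :
    ∃ C : ℝ, 0 < C ∧ ∀ᶠ t in 𝓝[≠] (0 : ℝ), M.Clears (path t) w (cut (path t) w) ∧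
      ‖cut (path t) w - pstar w‖ ≤ C * |t| := by
  obtain ⟨C, hC, hex⟩ := hF₀.excess_lipschitz hreg
  have hclears : ∀ᶠ t in 𝓝[≠] (0 : ℝ), M.Clears (path t) w (cut (path t) w) := by
    filter_upwards [hreg.mem.filter_mono nhdsWithin_le_nhds] with t ht
    exact hcut _ w (ht w)
  have hsmall : ∀ᶠ t in 𝓝[≠] (0 : ℝ), ‖M.excess F₀ w (cut (path t) w)‖ ≤ C * |t| := by
    filter_upwards [hex, hclears] with t ht hc
    have := ht w _ hc.1
    rwa [hc.2, zero_sub, norm_neg] at this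
  -- Well-separation first gives convergence without a rate; only then does the local lower bound
  -- from the Jacobian apply and give the linear rate.
  have htend : Tendsto (fun t => cut (path t) w) (𝓝[≠] 0) (𝓝 (pstar w)) := by
    rw [Metric.tendsto_nhds]
    intro ε hε
    obtain ⟨m, hm, hsep⟩ := hF₀.exists_lt_norm_excess w hε
    have h0 : Tendsto (fun t : ℝ => C * |t|) (𝓝[≠] 0) (𝓝 0) := by
      have := ((continuous_abs.const_mul C).tendsto (0 : ℝ))
      simp only [abs_zero, mul_zero] at this
      exact this.mono_left nhdsWithin_le_nhds
    filter_upwards [hsmall, hclears, h0.eventually (gt_mem_nhds hm)] with t h1 h2 h3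
    by_contra hcon
    push Not at hcon
    have := hsep _ h2.1 hcon
    linarith
  obtain ⟨c, hc, hlow⟩ := hF₀.eventually_norm_sub_le w
  refine ⟨c⁻¹ * C, by positivity, ?_⟩
  filter_upwards [hsmall, hclears, htend.eventually hlow] with t h1 h2 h3
  refine ⟨h2, ?_⟩
  rw [mul_assoc, le_inv_mul_iff₀ hc]
  exact h3.trans h1

/-- Let q_p be the outcome net of ν times excess demand at cutoffs p, G(p) its true mean and D(h)
the pairing of the score of h with s. Clearing gives y_t(p_t) = E_t[q_{p_t}], and E_t[q_{p_t}] -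
E_0[q_{p*}] is the sum of E_t[q_{p_t}] - E_0[q_{p_t}] = t D(q_{p_t}) + o(t), by the uniform
expansion, and of G(p_t) - G(p*) = o(t), as the gradient of G vanishes and p_t - p* = O(t). Finally
D(q_{p_t}) → D(q_{p*}) by mean-square continuity. -/
theorem Assumptions.hasDerivAt_meanOutcome (hF₀ : M.Assumptions F₀ pstar)
    {cut : Population 𝓑 𝓧 → Bool → EuclideanSpace ℝ (Fin J)} (hcut : M.IsCutoffRule cut)
    (hreg : IsRegularSubmodel obsLaw (M.model 𝓧) F₀ path s) {κ : ℝ} (hκ : 0 < κ)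
    (hov : ∀ᵐ x ∂F₀.cov, κ ≤ F₀.prop x ∧ F₀.prop x ≤ 1 - κ) (w : Bool) :
    HasDerivAt (fun t => M.meanOutcome (path t) w (cut (path t) w))
      (∫ z, F₀.doublyRobust (F₀.clippedProb κ w) w (M.equilibriumOutcome F₀ pstar w) z * s z
        ∂F₀.obsLaw) 0 := by
  set ℓ := M.nu F₀ w (pstar w) with hℓ
  set q := M.equilibriumOutcome F₀ pstar w with hq
  obtain ⟨K, hK0, hK⟩ := hF₀.exists_bound_netOutcome ℓ
  obtain ⟨ρ, hρ, hexp⟩ := potLaw_expansion hκ hov hreg hK0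
  obtain ⟨C, hC, hlip⟩ := hF₀.cut_lipschitz hcut hreg w
  obtain ⟨L, hL⟩ := hF₀.exists_integral_sq_netOutcome_le ℓ
  set D : (𝓑 → ℝ) → ℝ := fun h =>
    ∫ z, F₀.doublyRobust (F₀.clippedProb κ w) w h z * s z ∂F₀.obsLaw with hD
  have hpath0 : path 0 = F₀ := hreg.base
  have hstar : pstar w ∈ M.cutoffs := (hF₀.clears w).1
  have habs : Tendsto (fun t : ℝ => |t|) (𝓝[≠] 0) (𝓝 0) := by
    simpa using (continuous_abs.tendsto (0 : ℝ)).mono_left nhdsWithin_le_nhds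
  have htend : Tendsto (fun t => ‖cut (path t) w - pstar w‖) (𝓝[≠] 0) (𝓝 0) := by
    refine squeeze_zero' (Eventually.of_forall fun _ => norm_nonneg _)
      (hlip.mono fun t ht => ht.2) ?_
    simpa using habs.const_mul C
  have htend' : Tendsto (fun t => cut (path t) w) (𝓝[≠] 0) (𝓝 (pstar w)) :=
    tendsto_iff_norm_sub_tendsto_zero.2 htend
  set G : EuclideanSpace ℝ (Fin J) → ℝ := fun p => M.meanOutcome F₀ w p - ℓ (M.excess F₀ w p)
    with hG
  have hGd : HasFDerivAt G (0 : EuclideanSpace ℝ (Fin J) →L[ℝ] ℝ) (pstar w) := by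
    have h1 := (hF₀.differentiableAt_meanOutcome w).hasFDerivAt.sub
      (ℓ.hasFDerivAt.comp (pstar w) (hF₀.differentiableAt_excess w).hasFDerivAt)
    rw [hℓ, hF₀.nu_comp w, sub_self] at h1
    exact h1
  have hG0 : G (pstar w) = M.meanOutcome F₀ w (pstar w) := by
    simp [hG, (hF₀.clears w).2]
  have hGlim : Tendsto (fun t : ℝ => t⁻¹ * (G (cut (path t) w) - G (pstar w))) (𝓝[≠] 0) (𝓝 0) := by
    rw [Metric.tendsto_nhds]
    intro ε hε
    have hlo := htend'.eventually (hGd.isLittleO.def (by positivity : 0 < ε / (2 * C)))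
    filter_upwards [hlo, hlip, self_mem_nhdsWithin] with t h1 h2 ht0
    have htp : 0 < |t| := abs_pos.2 ht0
    rw [zero_apply, sub_zero, Real.norm_eq_abs] at h1
    rw [dist_zero_right, norm_mul, norm_inv, Real.norm_eq_abs, Real.norm_eq_abs,
      inv_mul_lt_iff₀ htp]
    have h3 := mul_le_mul_of_nonneg_left h2.2 (by positivity : 0 ≤ ε / (2 * C))
    have h4 : ε / (2 * C) * (C * |t|) = |t| * ε / 2 := by field_simp
    have := mul_pos htp hε
    linarith
  have hDlim : Tendsto (fun t => D (M.netOutcome ℓ (cut (path t) w)) - D q) (𝓝[≠] 0) (𝓝 0) := by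
    have hI : 0 ≤ ∫ z, s z ^ 2 ∂F₀.obsLaw := integral_nonneg fun z => sq_nonneg _
    set B : ℝ := (2 + 8 * κ⁻¹ ^ 2) * L * ∫ z, s z ^ 2 ∂F₀.obsLaw with hB
    have hsq : ∀ᶠ t in 𝓝[≠] (0 : ℝ), ‖D (M.netOutcome ℓ (cut (path t) w)) - D q‖ ≤
        √(B * ‖cut (path t) w - pstar w‖) := by
      filter_upwards [hlip] with t ht
      rw [Real.norm_eq_abs]
      refine Real.abs_le_sqrt ((sq_integral_doublyRobust_mul_sub_le hκ measurable_clippedProb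
        le_clippedProb (measurable_netOutcome _ _) (hK _ ht.1.1) (measurable_netOutcome _ _)
        (hK _ hstar) hreg.memLp).trans ?_)
      have h1 := mul_le_mul_of_nonneg_left (hL w _ ht.1.1 _ hstar)
        (by positivity : 0 ≤ 2 + 8 * κ⁻¹ ^ 2)
      refine (mul_le_mul_of_nonneg_right h1 hI).trans (le_of_eq ?_)
      rw [hB]; ring
    refine squeeze_zero_norm' hsq ?_
    have := (htend.const_mul B).sqrt
    simpa using this
  rw [hasDerivAt_iff_tendsto_slope_zero]
  have hmain : Tendsto (fun t : ℝ => t⁻¹ * (∫ b, M.netOutcome ℓ (cut (path t) w) b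
      ∂(path t).potLaw w - ∫ b, M.netOutcome ℓ (cut (path t) w) b ∂F₀.potLaw w -
      t * D (M.netOutcome ℓ (cut (path t) w)))) (𝓝[≠] 0) (𝓝 0) := by
    refine squeeze_zero_norm' ?_ hρ
    filter_upwards [hexp, hlip, self_mem_nhdsWithin] with t h1 h2 ht0
    have htp : 0 < |t| := abs_pos.2 ht0
    rw [norm_mul, norm_inv, Real.norm_eq_abs, Real.norm_eq_abs, inv_mul_le_iff₀ htp]
    exact h1 w _ (measurable_netOutcome _ _) (hK _ h2.1.1)
  have hsum := ((hmain.add hGlim).add hDlim).add_const (D q)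
  simp only [add_zero, zero_add] at hsum
  refine hsum.congr' ?_
  filter_upwards [hlip, self_mem_nhdsWithin] with t h2 ht0
  have ht0' : t ≠ 0 := ht0
  rw [hF₀.integral_netOutcome h2.1.1, hF₀.integral_netOutcome h2.1.1, h2.1.2, map_zero, sub_zero,
    zero_add, hpath0, hF₀.cut_eq hcut, hG0, smul_eq_mul]
  simp only [hG]
  field_simp
  ring

end CutoffMechanism

end

/-! ## Regular submodels through a population -/

noncomputable section

namespace Population

open Semiparametric

variable {𝓑 𝓧 : Type*} [MeasurableSpace 𝓑] [MeasurableSpace 𝓧]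

/-- A bounded direction in which to tilt a population: `cov` is the score of the covariates and
`bid w` that of `B(w)` given the covariates. -/
structure Tilt (F : Population 𝓑 𝓧) where
  cov : 𝓧 → ℝ
  bid : Bool → 𝓑 → 𝓧 → ℝ
  bound : ℝ
  measurable_cov : Measurable cov
  measurable_bid : ∀ w, Measurable (Function.uncurry (bid w))
  abs_cov_le : ∀ x, |cov x| ≤ bound
  abs_bid_le : ∀ w b x, |bid w b x| ≤ bound
  integral_cov : ∫ x, cov x ∂F.cov = 0
  integral_bid : ∀ w x, ∫ b, bid w (b w) x ∂F.bid x = 0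

namespace Tilt

variable {F : Population 𝓑 𝓧} (T : F.Tilt) {t : ℝ}

theorem one_add_mem {y : ℝ} (ht : |t| * T.bound ≤ 1) (hy : |y| ≤ T.bound) :
    0 ≤ 1 + t * y ∧ 1 + t * y ≤ 2 := by
  have h1 : |t * y| ≤ 1 := by
    rw [abs_mul]
    exact (mul_le_mul_of_nonneg_left hy (abs_nonneg t)).trans ht
  constructor <;> linarith [(abs_le.1 h1).1, (abs_le.1 h1).2]

theorem lintegral_one_add {Ω : Type*} [MeasurableSpace Ω] {μ : Measure Ω} [IsProbabilityMeasure μ]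
    {f : Ω → ℝ} (ht : |t| * T.bound ≤ 1) (hf : Measurable f) (hb : ∀ z, |f z| ≤ T.bound)
    (h0 : ∫ z, f z ∂μ = 0) : ∫⁻ z, ENNReal.ofReal (1 + t * f z) ∂μ = 1 := by
  have hi : Integrable f μ :=
    Integrable.of_bound hf.aestronglyMeasurable T.bound (Eventually.of_forall hb)
  have hi' : Integrable (fun z => 1 + t * f z) μ := (integrable_const 1).add (hi.const_mul t)
  rw [← ofReal_integral_eq_lintegral_ofReal hi' (Eventually.of_forall fun z => (T.one_add_mem ht (hb z)).1),
    integral_add (integrable_const 1) (hi.const_mul t), integral_const_mul, h0]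
  simp

theorem measurable_bidDensity (t : ℝ) (w : Bool) :
    Measurable (Function.uncurry fun (x : 𝓧) (b : Bool → 𝓑) =>
      ENNReal.ofReal (1 + t * T.bid w (b w) x)) := by
  have h : Measurable fun q : 𝓧 × (Bool → 𝓑) => T.bid w (q.2 w) q.1 := (T.measurable_bid w).comp
    (f := fun q : 𝓧 × (Bool → 𝓑) => (q.2 w, q.1))
    (((measurable_pi_apply w).comp measurable_snd).prodMk measurable_fst)
  exact ((h.const_mul t).const_add 1).ennreal_ofReal

/-- The tilted conditional law of the potential submissions, of which only the coordinate `w` is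
used. -/
def armKernel (t : ℝ) (w : Bool) : Kernel 𝓧 (Bool → 𝓑) :=
  Kernel.withDensity F.bid fun x b => ENNReal.ofReal (1 + t * T.bid w (b w) x)

theorem isMarkovKernel_armKernel (ht : |t| * T.bound ≤ 1) (w : Bool) :
    IsMarkovKernel (T.armKernel t w) where
  isProbabilityMeasure x := by
    refine ⟨?_⟩
    rw [armKernel, Kernel.withDensity_apply' _ (T.measurable_bidDensity t w), setLIntegral_univ]
    have hm : Measurable fun b : Bool → 𝓑 => T.bid w (b w) x :=
      (T.measurable_bid w).comp
      (f := fun b : Bool → 𝓑 => (b w, x)) ((measurable_pi_apply w).prodMk measurable_const)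
    exact T.lintegral_one_add ht hm (fun b => T.abs_bid_le w _ x) (T.integral_bid w x)

/-- Joins the treated coordinate of one draw and the control coordinate of another. -/
def join (p : (Bool → 𝓑) × (Bool → 𝓑)) (w : Bool) : 𝓑 := if w then p.1 w else p.2 w

omit [MeasurableSpace 𝓧] in
theorem measurable_join : Measurable (join (𝓑 := 𝓑)) := by
  refine measurable_pi_iff.2 fun w => ?_
  cases w
  · exact (measurable_pi_apply false).comp measurable_snd
  · exact (measurable_pi_apply true).comp measurable_fst

/-- The population tilted by `t`, with independent potential submissions given the covariates. -/
def population (t : ℝ) (ht : |t| * T.bound ≤ 1) : Population 𝓑 𝓧 where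
  cov := F.cov.withDensity fun x => ENNReal.ofReal (1 + t * T.cov x)
  -- The data never show both potential submissions, so their coupling is free. Independence allows
  -- each conditional marginal to be tilted exactly, without disturbing the other.
  bid := ((T.armKernel t true) ×ₖ (T.armKernel t false)).map join
  prop := F.prop
  isProbabilityMeasure_cov := by
    refine ⟨?_⟩
    rw [withDensity_apply _ MeasurableSet.univ, setLIntegral_univ]
    exact T.lintegral_one_add ht T.measurable_cov T.abs_cov_le T.integral_cov
  isMarkovKernel_bid := by
    have h1 := T.isMarkovKernel_armKernel ht true
    have h2 := T.isMarkovKernel_armKernel ht false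
    exact Kernel.IsMarkovKernel.map _ measurable_join
  measurable_prop := F.measurable_prop
  prop_pos := F.prop_pos
  prop_lt_one := F.prop_lt_one

theorem lintegral_population_bid (ht : |t| * T.bound ≤ 1) (w : Bool) {f : 𝓑 → ENNReal}
    (hf : Measurable f) (x : 𝓧) :
    ∫⁻ b, f (b w) ∂((T.population t ht).bid x) =
      ∫⁻ b, ENNReal.ofReal (1 + t * T.bid w (b w) x) * f (b w) ∂F.bid x := by
  have h1 := T.isMarkovKernel_armKernel ht true
  have h2 := T.isMarkovKernel_armKernel ht false
  have hfw : ∀ w : Bool, Measurable fun b : Bool → 𝓑 => f (b w) := fun w =>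
    hf.comp (measurable_pi_apply w)
  change ∫⁻ b, f (b w) ∂(((T.armKernel t true) ×ₖ (T.armKernel t false)).map join x) = _
  rw [← Kernel.lintegral_withDensity F.bid (T.measurable_bidDensity t w) x (hfw w),
    Kernel.map_apply _ measurable_join, lintegral_map (hfw w) measurable_join, Kernel.prod_apply]
  cases w
  · simp only [join, Bool.false_eq_true, if_false]
    rw [lintegral_prod (fun p : (Bool → 𝓑) × (Bool → 𝓑) => f (p.2 false)) ((hfw false).comp measurable_snd).aemeasurable]
    simp only [lintegral_const, measure_univ, mul_one]
    rfl
  · simp only [join, if_true]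
    rw [lintegral_prod (fun p : (Bool → 𝓑) × (Bool → 𝓑) => f (p.1 true)) ((hfw true).comp measurable_fst).aemeasurable]
    simp only [lintegral_const, measure_univ, mul_one]
    rfl

theorem lintegral_population_cov (ht : |t| * T.bound ≤ 1) {f : 𝓧 → ENNReal} (hf : Measurable f) :
    ∫⁻ x, f x ∂(T.population t ht).cov =
      ∫⁻ x, ENNReal.ofReal (1 + t * T.cov x) * f x ∂F.cov := by
  change ∫⁻ x, f x ∂(F.cov.withDensity fun x => ENNReal.ofReal (1 + t * T.cov x)) = _
  have hm : Measurable fun x => ENNReal.ofReal (1 + t * T.cov x) :=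
    ((T.measurable_cov.const_mul t).const_add 1).ennreal_ofReal
  rw [lintegral_withDensity_eq_lintegral_mul _ hm hf]
  rfl

/-- The densities of X and of B(w) given X are each at most 2. This domination makes the tilted
excess demand continuous. -/
theorem potLaw_population_le (ht : |t| * T.bound ≤ 1) (w : Bool) :
    (T.population t ht).potLaw w ≤ (4 : NNReal) • F.potLaw w := by
  refine Measure.le_iff.2 fun s hs => ?_
  have hm : Measurable (s.indicator (1 : 𝓑 → ENNReal)) := measurable_one.indicator hs
  have hmw : Measurable fun b : Bool → 𝓑 => s.indicator (1 : 𝓑 → ENNReal) (b w) :=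
    hm.comp (measurable_pi_apply w)
  have h2 : ∀ {y : ℝ}, |y| ≤ T.bound → ENNReal.ofReal (1 + t * y) ≤ 2 := fun hy => by
    simpa using ENNReal.ofReal_le_ofReal (T.one_add_mem ht hy).2
  rw [← lintegral_indicator_one hs, lintegral_potLaw hm,
    lintegral_population_cov _ _ (Measurable.lintegral_kernel hmw), Measure.smul_apply,
    ← lintegral_indicator_one hs, lintegral_potLaw hm]
  calc _ ≤ ∫⁻ x, 2 * (2 * ∫⁻ b, s.indicator (1 : 𝓑 → ENNReal) (b w) ∂F.bid x) ∂F.cov := by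
        refine lintegral_mono fun x => mul_le_mul' (h2 (T.abs_cov_le x)) ?_
        rw [T.lintegral_population_bid ht w hm, ← lintegral_const_mul _ hmw]
        exact lintegral_mono fun b => mul_le_mul_left (h2 (T.abs_bid_le w _ x)) _
    _ = _ := by
        rw [lintegral_const_mul _ ((Measurable.lintegral_kernel hmw).const_mul 2),
          lintegral_const_mul _ (Measurable.lintegral_kernel hmw), ← mul_assoc,
          ENNReal.smul_def, smul_eq_mul]
        norm_num

/-- The score of the tilt. -/
def score (z : 𝓑 × Bool × 𝓧) : ℝ := T.cov z.2.2 + T.bid z.2.1 z.1 z.2.2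

theorem measurable_bid_obs : Measurable fun z : 𝓑 × Bool × 𝓧 => T.bid z.2.1 z.1 z.2.2 := by
  have h : Measurable fun q : (𝓑 × 𝓧) × Bool => T.bid q.2 q.1.1 q.1.2 :=
    measurable_from_prod_countable_left fun w => T.measurable_bid w
  exact h.comp ((measurable_fst.prodMk measurable_snd.snd).prodMk measurable_snd.fst)

theorem measurable_score : Measurable T.score :=
  (T.measurable_cov.comp measurable_snd.snd).add T.measurable_bid_obs

/-- The two tilts multiply, and their cross term is the second-order part of the density; the
coupling of the potential submissions drops out. -/
theorem obsLaw_population (ht : |t| * T.bound ≤ 1) :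
    (T.population t ht).obsLaw = F.obsLaw.withDensity fun z => ENNReal.ofReal
      (1 + t * T.score z + t ^ 2 * (T.cov z.2.2 * T.bid z.2.1 z.1 z.2.2)) := by
  have hdens : ∀ z : 𝓑 × Bool × 𝓧, ENNReal.ofReal
      (1 + t * T.score z + t ^ 2 * (T.cov z.2.2 * T.bid z.2.1 z.1 z.2.2)) =
      ENNReal.ofReal (1 + t * T.cov z.2.2) * ENNReal.ofReal (1 + t * T.bid z.2.1 z.1 z.2.2) := by
    intro z
    rw [← ENNReal.ofReal_mul (T.one_add_mem ht (T.abs_cov_le _)).1, score]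
    congr 1
    ring
  have hdm : Measurable fun z : 𝓑 × Bool × 𝓧 =>
      ENNReal.ofReal (1 + t * T.cov z.2.2) * ENNReal.ofReal (1 + t * T.bid z.2.1 z.1 z.2.2) :=
    (measurable_const.add ((T.measurable_cov.comp
      measurable_snd.snd).const_mul t)).ennreal_ofReal.mul
      (measurable_const.add (T.measurable_bid_obs.const_mul t)).ennreal_ofReal
  simp_rw [hdens]
  refine Measure.ext_of_lintegral _ fun f hf => ?_
  rw [lintegral_withDensity_eq_lintegral_mul _ hdm hf, lintegral_obsLaw hf,
    lintegral_obsLaw (hdm.mul hf)]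
  have hfx : ∀ w x, Measurable fun b : 𝓑 => f (b, w, x) := fun w x =>
    hf.comp (measurable_id.prodMk measurable_const)
  have hinner : ∀ (G : Population 𝓑 𝓧) (w : Bool),
      Measurable fun x => ∫⁻ b, f (b w, w, x) ∂(G.bid x) := fun G w =>
    Measurable.lintegral_kernel_prod_right' (f := fun q : 𝓧 × (Bool → 𝓑) => f (q.2 w, w, q.1))
      (hf.comp (((measurable_pi_apply w).comp measurable_snd).prodMk
        (measurable_const.prodMk measurable_fst)))
  have hsum : Measurable fun x => ENNReal.ofReal ((T.population t ht).armProb true x) *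
      ∫⁻ b, f (b true, true, x) ∂((T.population t ht).bid x) +
      ENNReal.ofReal ((T.population t ht).armProb false x) *
      ∫⁻ b, f (b false, false, x) ∂((T.population t ht).bid x) :=
    (((T.population t ht).measurable_armProb true).ennreal_ofReal.mul (hinner _ true)).add
      (((T.population t ht).measurable_armProb false).ennreal_ofReal.mul (hinner _ false))
  rw [T.lintegral_population_cov ht hsum]
  refine lintegral_congr fun x => ?_
  have harm : ∀ w, ∫⁻ b, ENNReal.ofReal (1 + t * T.cov x) *
      ENNReal.ofReal (1 + t * T.bid w (b w) x) * f (b w, w, x) ∂F.bid x =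
      ENNReal.ofReal (1 + t * T.cov x) * ∫⁻ b, f (b w, w, x) ∂((T.population t ht).bid x) := by
    intro w
    rw [T.lintegral_population_bid ht w (hfx w x), ← lintegral_const_mul]
    · simp_rw [mul_assoc]
    · exact ((T.measurable_bidDensity t w).comp measurable_prodMk_left).mul
        ((hfx w x).comp (measurable_pi_apply w))
  have hprob : ∀ w, (T.population t ht).armProb w x = F.armProb w x := fun w => rfl
  simp only [Pi.mul_apply, harm, hprob]
  ring

/-- The path of populations along a tilt. -/
def path (t : ℝ) : Population 𝓑 𝓧 :=
  -- At t = 0 the tilted population has the observed law of F but makes the potential submissions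
  -- conditionally independent, so it may differ from F. A submodel must start at F itself, hence
  -- the separate value at 0.
  open Classical in if h : t ≠ 0 ∧ |t| * T.bound ≤ 1 then T.population t h.2 else F

theorem path_zero : T.path 0 = F := dif_neg fun h => h.1 rfl

theorem path_eq (ht0 : t ≠ 0) (ht : |t| * T.bound ≤ 1) : T.path t = T.population t ht :=
  dif_pos ⟨ht0, ht⟩

theorem eventually_abs_mul_le : ∀ᶠ t in 𝓝 (0 : ℝ), |t| * T.bound ≤ 1 := by
  have h : Tendsto (fun t : ℝ => |t| * T.bound) (𝓝 0) (𝓝 0) := by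
    have := (continuous_abs.mul_const T.bound).tendsto (0 : ℝ)
    simpa using this
  exact h.eventually (ge_mem_nhds one_pos)

theorem isRegularSubmodel {𝓜 : Set (Population 𝓑 𝓧)} (hmem : ∀ᶠ t in 𝓝 (0 : ℝ), T.path t ∈ 𝓜)
    {s : 𝓑 × Bool × 𝓧 → ℝ} (hs : s =ᵐ[F.obsLaw] T.score) :
    IsRegularSubmodel obsLaw 𝓜 F T.path s := by
  have hK : ∀ z : 𝓑 × Bool × 𝓧, 0 ≤ T.bound := fun z => (abs_nonneg _).trans (T.abs_cov_le z.2.2)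
  refine IsRegularSubmodel.of_density (K := max (2 * T.bound) (T.bound ^ 2))
    (a := T.score)
    (r := fun z : 𝓑 × Bool × 𝓧 => T.cov z.2.2 * T.bid z.2.1 z.1 z.2.2) inferInstance T.path_zero hmem
    T.measurable_score ((T.measurable_cov.comp measurable_snd.snd).mul T.measurable_bid_obs)
    (fun z => ?_) (fun z => ?_) ?_ hs
  · refine le_trans ((abs_add_le _ _).trans ?_) (le_max_left _ _)
    linarith [T.abs_cov_le z.2.2, T.abs_bid_le z.2.1 z.1 z.2.2]
  · refine le_trans ?_ (le_max_right _ _)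
    rw [abs_mul, sq]
    exact mul_le_mul (T.abs_cov_le _) (T.abs_bid_le _ _ _) (abs_nonneg _) (hK z)
  · filter_upwards [T.eventually_abs_mul_le] with t ht
    by_cases h0 : t = 0
    · subst h0
      rw [T.path_zero]
      simp
    · rw [T.path_eq h0 ht, T.obsLaw_population ht]

end Tilt

/-- The population with treatment probabilities `e + t e (1 - e)`. -/
def propensityTilt (F : Population 𝓑 𝓧) (t : ℝ) (ht : |t| < 1) : Population 𝓑 𝓧 where
  cov := F.cov
  bid := F.bid
  prop x := F.prop x * (1 + t * (1 - F.prop x))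
  isProbabilityMeasure_cov := inferInstance
  isMarkovKernel_bid := inferInstance
  measurable_prop := F.measurable_prop.mul
    (measurable_const.add ((measurable_const.sub F.measurable_prop).const_mul t))
  prop_pos x := by
    have h1 := F.prop_pos x
    have h2 := F.prop_lt_one x
    have h3 := abs_lt.1 ht
    refine mul_pos h1 ?_
    nlinarith
  prop_lt_one x := by
    have h1 := F.prop_pos x
    have h2 := F.prop_lt_one x
    have h3 := abs_lt.1 ht
    -- One minus the new propensity factors as (1 - e)(1 - t e).
    have h5 : 0 < (1 - F.prop x) * (1 - t * F.prop x) := by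
      refine mul_pos (by linarith) ?_
      nlinarith
    linarith

/-- The score of the treatment probabilities. -/
def propensityScore (F : Population 𝓑 𝓧) (z : 𝓑 × Bool × 𝓧) : ℝ :=
  (if z.2.1 = true then 1 else 0) - F.prop z.2.2

theorem measurable_propensityScore (F : Population 𝓑 𝓧) : Measurable F.propensityScore :=
  (Measurable.ite (measurableSet_eq_fun measurable_snd.fst measurable_const) measurable_const
    measurable_const).sub (F.measurable_prop.comp measurable_snd.snd)

theorem abs_propensityScore_lt (F : Population 𝓑 𝓧) (z : 𝓑 × Bool × 𝓧) :
    0 < |F.propensityScore z| ∧ |F.propensityScore z| < 1 := by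
  have h1 := F.prop_pos z.2.2
  have h2 := F.prop_lt_one z.2.2
  unfold propensityScore
  split_ifs
  · rw [abs_of_pos (by linarith)]
    constructor <;> linarith
  · rw [abs_of_neg (by linarith)]
    constructor <;> linarith

theorem obsLaw_propensityTilt (F : Population 𝓑 𝓧) {t : ℝ} (ht : |t| < 1) :
    (F.propensityTilt t ht).obsLaw = F.obsLaw.withDensity fun z =>
      ENNReal.ofReal (1 + t * F.propensityScore z) := by
  have hdm : Measurable fun z : 𝓑 × Bool × 𝓧 => ENNReal.ofReal (1 + t * F.propensityScore z) :=
    (measurable_const.add (F.measurable_propensityScore.const_mul t)).ennreal_ofReal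
  refine Measure.ext_of_lintegral _ fun f hf => ?_
  rw [lintegral_withDensity_eq_lintegral_mul _ hdm hf, lintegral_obsLaw hf,
    lintegral_obsLaw (hdm.mul hf)]
  refine lintegral_congr fun x => ?_
  have harm : ∀ w, ENNReal.ofReal ((F.propensityTilt t ht).armProb w x) *
      ∫⁻ b, f (b w, w, x) ∂((F.propensityTilt t ht).bid x) =
      ENNReal.ofReal (F.armProb w x) * ∫⁻ b, ((fun z => ENNReal.ofReal
        (1 + t * F.propensityScore z)) * f) (b w, w, x) ∂F.bid x := by
    intro w
    have hprob : (F.propensityTilt t ht).armProb w x =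
        F.armProb w x * (1 + t * ((if w = true then 1 else 0) - F.prop x)) := by
      cases w <;> simp [armProb, propensityTilt]; ring
    rw [hprob, ENNReal.ofReal_mul (F.armProb_pos w x).le, mul_assoc, ← lintegral_const_mul]
    · rfl
    · exact hf.comp ((measurable_pi_apply w).prodMk measurable_const)
  rw [harm true, harm false]

/-- The path of populations along which only the treatment probabilities vary. -/
def propensityPath (F : Population 𝓑 𝓧) (t : ℝ) : Population 𝓑 𝓧 :=
  open Classical in if h : t ≠ 0 ∧ |t| < 1 then F.propensityTilt t h.2 else F

theorem propensityPath_zero (F : Population 𝓑 𝓧) : F.propensityPath 0 = F :=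
  dif_neg fun h => h.1 rfl

theorem potLaw_propensityPath (F : Population 𝓑 𝓧) (t : ℝ) (w : Bool) :
    (F.propensityPath t).potLaw w = F.potLaw w := by
  unfold propensityPath
  split_ifs <;> rfl

/-- Changing only the treatment probabilities leaves the potential submissions, hence market
clearing, untouched. The path has positive information even when the influence function vanishes. -/
theorem isRegularSubmodel_propensityPath (F : Population 𝓑 𝓧) {𝓜 : Set (Population 𝓑 𝓧)}
    (hmem : ∀ t, F.propensityPath t ∈ 𝓜) :
    IsRegularSubmodel obsLaw 𝓜 F F.propensityPath F.propensityScore := by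
  refine IsRegularSubmodel.of_density (K := 1) (r := fun _ => 0) inferInstance
    F.propensityPath_zero (Eventually.of_forall hmem) F.measurable_propensityScore
    measurable_const (fun z => (F.abs_propensityScore_lt z).2.le) (by simp) ?_
    (Eventually.of_forall fun _ => rfl)
  have h : ∀ᶠ t in 𝓝 (0 : ℝ), |t| < 1 := by
    have := (continuous_abs.tendsto (0 : ℝ))
    rw [abs_zero] at this
    exact this.eventually (gt_mem_nhds one_pos)
  filter_upwards [h] with t ht
  simp only [mul_zero, add_zero]
  by_cases h0 : t = 0
  · subst h0
    rw [F.propensityPath_zero]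
    simp
  · rw [← F.obsLaw_propensityTilt ht, propensityPath, dif_pos ⟨h0, ht⟩]

end Population

end

/-! ## The efficiency bound -/

noncomputable section

namespace CutoffMechanism

open Population Semiparametric

variable {𝓑 𝓧 : Type*} [MeasurableSpace 𝓑] [MeasurableSpace 𝓧] {J : ℕ}
  {M : CutoffMechanism 𝓑 J} {F₀ : Population 𝓑 𝓧} {pstar : Bool → EuclideanSpace ℝ (Fin J)}

/-- Markets with continuous excess demand close to that of the true population clear. -/
theorem Assumptions.exists_clears_of_close (hF₀ : M.Assumptions F₀ pstar) (w : Bool) :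
    ∃ η : ℝ, 0 < η ∧ ∀ F : Population 𝓑 𝓧, ContinuousOn (M.excess F w) M.cutoffs →
      (∀ p ∈ M.cutoffs, ‖M.excess F w p - M.excess F₀ w p‖ ≤ η) → ∃ p, M.Clears F w p := by
  obtain ⟨e, he⟩ := hF₀.exists_jacobian_equiv w
  set N : ℝ := ‖(e.symm : EuclideanSpace ℝ (Fin J) →L[ℝ] EuclideanSpace ℝ (Fin J))‖ with hN
  have hN0 : 0 ≤ N := norm_nonneg _
  -- Linearization error and perturbation each contribute at most ε R to the excess demand; after
  -- the inverse Jacobian, of norm N, the total 2 N ε R stays below R, as Brouwer's theorem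
  -- requires.
  set ε : ℝ := 1 / (2 * (N + 1)) with hε
  have hε0 : 0 < ε := by positivity
  have hd := (hF₀.differentiableAt_excess w).hasFDerivAt
  have hnear := (hd.isLittleO.def hε0).and (hF₀.cutoffs_mem_nhds w)
  obtain ⟨R, hR, hball⟩ := Metric.nhds_basis_closedBall.eventually_iff.1 hnear
  refine ⟨ε * R, by positivity, fun F hcont hclose => ?_⟩
  have hsub : Metric.closedBall (pstar w) R ⊆ M.cutoffs := fun p hp => (hball hp).2
  obtain ⟨p, hp, hzero⟩ := Brouwer.exists_zero_of_norm_sub_le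
    (Φ := fun p => e.symm (M.excess F w p)) hR
    (e.symm.continuous.comp_continuousOn (hcont.mono hsub)) (by
      intro p hp
      have h1 := (hball hp).1
      rw [(hF₀.clears w).2, sub_zero, he] at h1
      have h2 := hclose p (hsub hp)
      have h3 : ‖p - pstar w‖ ≤ R := mem_closedBall_iff_norm.1 hp
      have h4 : e.symm (M.excess F w p) - (p - pstar w) =
          e.symm (M.excess F w p - e (p - pstar w)) := by
        rw [map_sub, e.symm_apply_apply]
      have h5 : ‖M.excess F w p - e (p - pstar w)‖ ≤ ε * R + ε * R := by
        refine (norm_sub_le_norm_sub_add_norm_sub _ (M.excess F₀ w p) _).trans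
          (add_le_add h2 (h1.trans (mul_le_mul_of_nonneg_left h3 hε0.le)))
      have h6 : ‖e.symm (M.excess F w p - e (p - pstar w))‖ ≤
          N * ‖M.excess F w p - e (p - pstar w)‖ :=
        (e.symm : EuclideanSpace ℝ (Fin J) →L[ℝ] EuclideanSpace ℝ (Fin J)).le_opNorm _
      rw [h4]
      refine h6.trans ((mul_le_mul_of_nonneg_left h5 hN0).trans ?_)
      have h7 : N * (ε * R + ε * R) = N / (N + 1) * R := by
        rw [hε]; field_simp; ring
      rw [h7]
      refine mul_le_of_le_one_left hR.le ?_
      rw [div_le_one (by positivity)]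
      linarith)
  exact ⟨p, hsub hp, by simpa using hzero⟩

/-- To avoid circularity the tilt is first viewed as a submodel of the unrestricted model. That
already yields the uniform bound on its excess demand, from which clearing follows. -/
theorem Assumptions.eventually_tilt_mem_model (hF₀ : M.Assumptions F₀ pstar) (T : F₀.Tilt) :
    ∀ᶠ t in 𝓝 (0 : ℝ), T.path t ∈ M.model 𝓧 := by
  have hreg : IsRegularSubmodel obsLaw Set.univ F₀ T.path T.score :=
    T.isRegularSubmodel (Eventually.of_forall fun _ => Set.mem_univ _) EventuallyEq.rfl
  obtain ⟨C, hC, hlip⟩ := hF₀.excess_lipschitz hreg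
  choose η hη hclear using fun w => hF₀.exists_clears_of_close w
  have h0 : Tendsto (fun t : ℝ => C * |t|) (𝓝 0) (𝓝 0) := by
    have := ((continuous_abs.const_mul C).tendsto (0 : ℝ))
    simpa only [abs_zero, mul_zero] using this
  have hev : ∀ w, ∀ᶠ t in 𝓝 (0 : ℝ), C * |t| < η w := fun w =>
    h0.eventually (gt_mem_nhds (hη w))
  rw [eventually_nhdsWithin_iff] at hlip
  filter_upwards [hlip, hev true, hev false, T.eventually_abs_mul_le] with t ht h1 h2 h3
  by_cases ht0 : t = 0
  · rw [ht0, T.path_zero]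
    exact fun w => ⟨_, hF₀.clears w⟩
  · intro w
    refine hclear w _ ?_ fun p hp => (ht ht0 w p hp).trans ?_
    · rw [T.path_eq ht0 h3]
      exact hF₀.continuousOn_excess (T.potLaw_population_le h3 w)
    · cases w
      · exact h2.le
      · exact h1.le

/-- The influence function of the global treatment effect, with propensities bounded below by
`κ`. -/
def influence (M : CutoffMechanism 𝓑 J) (F₀ : Population 𝓑 𝓧)
    (pstar : Bool → EuclideanSpace ℝ (Fin J)) (κ : ℝ) (z : 𝓑 × Bool × 𝓧) : ℝ :=
  F₀.doublyRobust (F₀.clippedProb κ true) true (M.equilibriumOutcome F₀ pstar true) z -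
    F₀.doublyRobust (F₀.clippedProb κ false) false (M.equilibriumOutcome F₀ pstar false) z -
    M.globalEffect F₀ pstar

variable {κ : ℝ}

theorem measurable_influence : Measurable (M.influence F₀ pstar κ) :=
  ((measurable_doublyRobust measurable_clippedProb (measurable_netOutcome _ _)).sub
    (measurable_doublyRobust measurable_clippedProb (measurable_netOutcome _ _))).sub_const _

theorem Assumptions.exists_bound_equilibriumOutcome (hF₀ : M.Assumptions F₀ pstar) :
    ∃ K : ℝ, 0 < K ∧ ∀ w b, |M.equilibriumOutcome F₀ pstar w b| ≤ K := by
  have h := fun w => hF₀.exists_bound_netOutcome (M.nu F₀ w (pstar w))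
  choose K hK0 hK using h
  refine ⟨max (K true) (K false), lt_max_of_lt_left (hK0 true), fun w b => ?_⟩
  refine (hK w _ (hF₀.clears w).1 b).trans ?_
  cases w
  · exact le_max_right _ _
  · exact le_max_left _ _

/-- The influence function is the score of a tilt of the true population. -/
theorem Assumptions.exists_tilt (hF₀ : M.Assumptions F₀ pstar) (hκ : 0 < κ) :
    ∃ T : F₀.Tilt, T.score = M.influence F₀ pstar κ := by
  obtain ⟨K, hK0, hK⟩ := hF₀.exists_bound_equilibriumOutcome
  set q := M.equilibriumOutcome F₀ pstar with hq
  have hqm : ∀ w, Measurable (q w) := fun w => measurable_netOutcome _ _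
  have hm : ∀ w, Measurable (F₀.condMean w (q w)) := fun w => measurable_condMean (hqm w)
  have hmb : ∀ w x, |F₀.condMean w (q w) x| ≤ K := fun w => abs_condMean_le (hK w)
  have hmi : ∀ w, Integrable (F₀.condMean w (q w)) F₀.cov := fun w =>
    Integrable.of_bound (hm w).aestronglyMeasurable K (Eventually.of_forall (hmb w))
  -- Clearing identifies the mean net outcome with the mean outcome, which centres the covariate
  -- part of ψ at τ.
  have hmean : ∀ w, ∫ x, F₀.condMean w (q w) x ∂F₀.cov = M.meanOutcome F₀ w (pstar w) := by
    intro w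
    rw [← integral_potLaw (hqm w) (hK w)]
    refine (hF₀.integral_netOutcome (hF₀.clears w).1 _ F₀ w).trans ?_
    rw [(hF₀.clears w).2, map_zero, sub_zero]
  set τ := M.globalEffect F₀ pstar with hτ
  have hsgn : ∀ w : Bool, |(if w = true then (1 : ℝ) else -1)| = 1 := fun w => by
    cases w <;> simp
  have hbd : 0 ≤ κ⁻¹ * (2 * K) := by positivity
  refine ⟨{
    cov := fun x => F₀.condMean true (q true) x - F₀.condMean false (q false) x - τ
    bid := fun w b x => (if w = true then 1 else -1) *
      ((F₀.clippedProb κ w x)⁻¹ * (q w b - F₀.condMean w (q w) x))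
    bound := 2 * K + |τ| + κ⁻¹ * (2 * K)
    measurable_cov := ((hm true).sub (hm false)).sub_const τ
    measurable_bid := fun w => ((measurable_clippedProb.comp measurable_snd).inv.mul
      (((hqm w).comp measurable_fst).sub ((hm w).comp measurable_snd))).const_mul _
    abs_cov_le := fun x => ?_
    abs_bid_le := fun w b x => ?_
    integral_cov := ?_
    integral_bid := fun w x => ?_ }, ?_⟩
  · refine (abs_sub _ _).trans ?_
    have h1 := abs_sub (F₀.condMean true (q true) x) (F₀.condMean false (q false) x)
    linarith [hmb true x, hmb false x]
  · have h1 : 0 < F₀.clippedProb κ w x := hκ.trans_le (le_clippedProb x)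
    rw [abs_mul, hsgn, one_mul, abs_mul, abs_of_pos (inv_pos.2 h1)]
    have h2 := mul_le_mul (inv_anti₀ hκ (le_clippedProb (F := F₀) (w := w) x))
      (abs_sub_condMean_le (F := F₀) (w := w) (hK w) b x) (abs_nonneg _) (inv_pos.2 hκ).le
    linarith [abs_nonneg τ]
  · have hi12 : Integrable (fun x => F₀.condMean true (q true) x - F₀.condMean false (q false) x)
        F₀.cov := (hmi true).sub (hmi false)
    rw [integral_sub hi12 (integrable_const _),
      integral_sub (hmi true) (hmi false), hmean, hmean]
    simp [hτ, globalEffect]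
  · rw [integral_const_mul, integral_const_mul,
      integral_sub (integrable_bid (hqm w) (hK w) x) (integrable_const _)]
    simp [condMean]
  · funext z
    obtain ⟨b, w, x⟩ := z
    cases w <;> simp [Tilt.score, influence, doublyRobust, ← hq, ← hτ] <;> ring

/-- The doubly robust construction is linear and preserves constants, so ν may be applied inside it;
on W = w the observed submission is B(w). -/
theorem Assumptions.scoreQ_eq (hF₀ : M.Assumptions F₀ pstar) (w : Bool)
    (ω : 𝓧 × (Bool → 𝓑) × Bool) : M.scoreQ F₀ w (pstar w) ω =
      F₀.doublyRobust (F₀.armProb w) w (M.equilibriumOutcome F₀ pstar w) (observe ω) := by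
  obtain ⟨K, hK0, hK⟩ := hF₀.exists_bound
  have hp : pstar w ∈ M.cutoffs := (hF₀.clears w).1
  obtain ⟨x, b, w'⟩ := ω
  have hi1 : Integrable (fun b : Bool → 𝓑 => M.outcome (b w) (pstar w)) (F₀.bid x) :=
    integrable_bid (M.measurable_outcome _) (fun b => (hK b _ hp).2) x
  have hi2 : Integrable (fun b : Bool → 𝓑 => M.alloc (b w) (pstar w)) (F₀.bid x) :=
    Integrable.of_bound ((M.measurable_alloc _).comp (measurable_pi_apply w)).aestronglyMeasurable
      K (Eventually.of_forall fun b => (hK (b w) _ hp).1)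
  have hi3 : Integrable (fun b : Bool → 𝓑 => M.alloc (b w) (pstar w) - M.capacity) (F₀.bid x) :=
    hi2.sub (integrable_const _)
  set ν := M.nu F₀ w (pstar w) with hν
  have hmean : F₀.condMean w (M.equilibriumOutcome F₀ pstar w) x =
      M.condOutcome F₀ w x (pstar w) - ν (M.condAlloc F₀ w x (pstar w) - M.capacity) := by
    simp only [condMean, equilibriumOutcome, netOutcome, ← hν]
    rw [integral_sub hi1 (ν.integrable_comp hi3), ν.integral_comp_comm hi3,
      integral_sub hi2 (integrable_const _)]
    simp [condOutcome, condAlloc]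
  simp only [scoreQ, scoreOutcome, scoreAlloc, ipw, doublyRobust, observe, hmean, ← hν]
  by_cases h : w' = w
  · subst h
    simp only [if_true, equilibriumOutcome, netOutcome, ← hν, map_sub, map_add, map_smul, smul_eq_mul]
    ring
  · simp only [h, if_false, zero_mul, zero_smul, add_zero]

theorem Assumptions.asymptoticVariance_eq (hF₀ : M.Assumptions F₀ pstar)
    (hov : ∀ᵐ x ∂F₀.cov, κ ≤ F₀.prop x ∧ F₀.prop x ≤ 1 - κ) :
    M.asymptoticVariance F₀ pstar = ∫ z, M.influence F₀ pstar κ z ^ 2 ∂F₀.obsLaw := by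
  have hae : ∀ w, ∀ᵐ z ∂F₀.obsLaw, F₀.clippedProb κ w z.2.2 = F₀.armProb w z.2.2 := fun w => by
    have h := clippedProb_ae_eq (F := F₀) (w := w) hov
    rw [← map_obsLaw_covariate (F := F₀)] at h
    exact ae_of_ae_map (by fun_prop) h
  have hmap := integral_map (μ := F₀.fullLaw) (measurable_observe (𝓑 := 𝓑) (𝓧 := 𝓧)).aemeasurable
    (f := fun z => M.influence F₀ pstar κ z ^ 2)
    (measurable_influence.pow_const 2).aestronglyMeasurable
  rw [obsLaw, hmap, asymptoticVariance]
  refine integral_congr_ae ?_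
  have h1 := ae_of_ae_map measurable_observe.aemeasurable (hae true)
  have h2 := ae_of_ae_map measurable_observe.aemeasurable (hae false)
  filter_upwards [h1, h2] with ω h1 h2
  rw [hF₀.scoreQ_eq, hF₀.scoreQ_eq]
  simp only [influence, doublyRobust, h1, h2]

theorem Assumptions.hasDerivAt_globalEffect (hF₀ : M.Assumptions F₀ pstar)
    {cut : Population 𝓑 𝓧 → Bool → EuclideanSpace ℝ (Fin J)} (hcut : M.IsCutoffRule cut)
    {path : ℝ → Population 𝓑 𝓧} {s : 𝓑 × Bool × 𝓧 → ℝ}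
    (hreg : IsRegularSubmodel obsLaw (M.model 𝓧) F₀ path s) (hκ : 0 < κ)
    (hov : ∀ᵐ x ∂F₀.cov, κ ≤ F₀.prop x ∧ F₀.prop x ≤ 1 - κ) :
    HasDerivAt (fun t => M.globalEffect (path t) (cut (path t)))
      (∫ z, M.influence F₀ pstar κ z * s z ∂F₀.obsLaw) 0 := by
  obtain ⟨K, hK0, hK⟩ := hF₀.exists_bound_equilibriumOutcome
  have h := (hF₀.hasDerivAt_meanOutcome hcut hreg hκ hov true).sub
    (hF₀.hasDerivAt_meanOutcome hcut hreg hκ hov false)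
  have hi : ∀ w, Integrable (fun z => F₀.doublyRobust (F₀.clippedProb κ w) w
      (M.equilibriumOutcome F₀ pstar w) z * s z) F₀.obsLaw := fun w =>
    (memLp_doublyRobust hκ measurable_clippedProb le_clippedProb (measurable_netOutcome _ _) (hK w)
      F₀.obsLaw).integrable_mul hreg.memLp
  have hs : Integrable s F₀.obsLaw := hreg.memLp.integrable one_le_two
  have hval : ∫ z, M.influence F₀ pstar κ z * s z ∂F₀.obsLaw =
      ∫ z, F₀.doublyRobust (F₀.clippedProb κ true) true (M.equilibriumOutcome F₀ pstar true) z *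
        s z ∂F₀.obsLaw -
      ∫ z, F₀.doublyRobust (F₀.clippedProb κ false) false (M.equilibriumOutcome F₀ pstar false) z *
        s z ∂F₀.obsLaw := by
    simp only [influence, sub_mul]
    have hi12 : Integrable (fun z =>
        F₀.doublyRobust (F₀.clippedProb κ true) true (M.equilibriumOutcome F₀ pstar true) z * s z -
        F₀.doublyRobust (F₀.clippedProb κ false) false (M.equilibriumOutcome F₀ pstar false) z *
          s z) F₀.obsLaw := (hi true).sub (hi false)
    -- The centring constant τ drops out of the pairing because scores have mean zero.
    rw [integral_sub hi12 (hs.const_mul _),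
      integral_sub (hi true) (hi false), integral_const_mul,
      hreg.integral_score fun F => inferInstance, mul_zero, sub_zero]
  rw [hval]
  exact h

theorem propensityPath_mem_model (hF₀ : M.Assumptions F₀ pstar) (t : ℝ) :
    F₀.propensityPath t ∈ M.model 𝓧 := by
  intro w
  refine ⟨pstar w, (hF₀.clears w).1, ?_⟩
  have h := (hF₀.clears w).2
  rwa [excess, ← potLaw_propensityPath F₀ t w] at h

end CutoffMechanism

theorem Population.integral_sq_propensityScore_pos {𝓑 𝓧 : Type*} [MeasurableSpace 𝓑]
    [MeasurableSpace 𝓧] (F : Population 𝓑 𝓧) : 0 < ∫ z, F.propensityScore z ^ 2 ∂F.obsLaw := by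
  have hi : Integrable (fun z => F.propensityScore z ^ 2) F.obsLaw := by
    refine Integrable.of_bound (F.measurable_propensityScore.pow_const 2).aestronglyMeasurable 1
      (Eventually.of_forall fun z => ?_)
    rw [Real.norm_of_nonneg (sq_nonneg _), sq_le_one_iff_abs_le_one]
    exact (F.abs_propensityScore_lt z).2.le
  rw [integral_pos_iff_support_of_nonneg (fun z => sq_nonneg _) hi]
  have : Function.support (fun z : 𝓑 × Bool × 𝓧 => F.propensityScore z ^ 2) = Set.univ := by
    ext z
    simpa using abs_pos.1 (F.abs_propensityScore_lt z).1
  rw [this, measure_univ]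
  exact one_pos

end

theorem mainTheorem4 {𝓑 𝓧 : Type*} [MeasurableSpace 𝓑] [MeasurableSpace 𝓧] {J : ℕ}
    (M : CutoffMechanism 𝓑 J) (F₀ : Population 𝓑 𝓧)
    (pstar : Bool → EuclideanSpace ℝ (Fin J)) (hF₀ : M.Assumptions F₀ pstar)
    (cut : Population 𝓑 𝓧 → Bool → EuclideanSpace ℝ (Fin J)) (hcut : M.IsCutoffRule cut) :
    Semiparametric.IsEfficiencyBound Population.obsLaw (M.model 𝓧)
      (fun F => M.globalEffect F (cut F)) F₀ (M.asymptoticVariance F₀ pstar) := by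
  obtain ⟨κ, hκ, hov⟩ := hF₀.strong_overlap
  obtain ⟨T, hT⟩ := hF₀.exists_tilt hκ
  rw [hF₀.asymptoticVariance_eq hov]
  have hmem := hF₀.eventually_tilt_mem_model T
  have hreg : Semiparametric.IsRegularSubmodel Population.obsLaw (M.model 𝓧) F₀ T.path T.score :=
    T.isRegularSubmodel hmem EventuallyEq.rfl
  rw [hT] at hreg
  have hψ : MemLp (M.influence F₀ pstar κ) 2 F₀.obsLaw := hreg.memLp
  have hderiv := fun (path : ℝ → Population 𝓑 𝓧) (s : 𝓑 × Bool × 𝓧 → ℝ)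
    (h : Semiparametric.IsRegularSubmodel Population.obsLaw (M.model 𝓧) F₀ path s) =>
    hF₀.hasDerivAt_globalEffect hcut h hκ hov
  refine ⟨⟨hψ.toLp _, ⟨?_, fun path s h => ?_⟩, ?_⟩, ?_, ?_⟩
  -- ψ is itself a score, so it lies in the tangent space before any span or closure is taken.
  · refine Submodule.le_topologicalClosure _ (Submodule.subset_span ⟨T.path, ?_⟩)
    exact T.isRegularSubmodel hmem (by rw [hT]; exact hψ.coeFn_toLp)
  · have heq : ∫ z, hψ.toLp _ z * s z ∂F₀.obsLaw =
        ∫ z, M.influence F₀ pstar κ z * s z ∂F₀.obsLaw :=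
      integral_congr_ae (by filter_upwards [hψ.coeFn_toLp] with z hz; rw [hz])
    rw [heq]
    exact hderiv path s h
  · exact integral_congr_ae (by filter_upwards [hψ.coeFn_toLp] with z hz; rw [hz])
  · rintro v ⟨path, s, τ', h, hd, hpos, rfl⟩
    rw [hd.unique (hderiv path s h), div_le_iff₀ hpos]
    exact Semiparametric.sq_integral_mul_le hψ h.memLp
  · intro u hu
    have hnonneg : 0 ≤ ∫ z, M.influence F₀ pstar κ z ^ 2 ∂F₀.obsLaw :=
      integral_nonneg fun z => sq_nonneg _
    -- If σ² = 0, the path with score ψ has no information and is excluded; the propensity path then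
    -- gives a nonnegative bound. Otherwise the path with score ψ attains (σ²)² / σ² = σ².
    rcases hnonneg.eq_or_lt with h0 | hpos
    · rw [← h0]
      have hp := F₀.isRegularSubmodel_propensityPath
        (CutoffMechanism.propensityPath_mem_model hF₀)
      exact (div_nonneg (sq_nonneg _) F₀.integral_sq_propensityScore_pos.le).trans
        (hu ⟨_, _, _, hp, hderiv _ _ hp, F₀.integral_sq_propensityScore_pos, rfl⟩)
    · refine hu ⟨_, _, _, hreg, hderiv _ _ hreg, hpos, ?_⟩
      simp only [← sq]
      rw [eq_div_iff hpos.ne', sq]
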